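/- **Setting.** Let $\lambda$ be a Borel measure on $\mathbb R$ with $\Lambda(x)=\lambda((-\infty,x])<\infty$ for all $x\in\mathbb R$. All functions are real valued, measurable, and identified when equal $\lambda$-a.e. *Least decreasing majorant:* $\tilde f(x)=\operatorname{ess\,sup}_\lambda\{|f(y)|:y\ge x\}$; $\widetilde{L^1_\lambda}$ is the space of $f$ with $\|f\|_{\widetilde{L^1_\lambda}}=\|\tilde f\|_{L^1_\lambda}<\infty$. *Level function:* a non-negative $\lambda$-measurable $F:\mathbb R\to[0,\infty)$ is $\lambda$-concave if $(\Lambda(b)-\Lambda(x))(F(x)-F(a))\ge(F(b)-F(x))(\Lambda(x)-\Lambda(a))$ whenever $a\le x\le b$. If $x\mapsto\int_{(-\infty,x)}|f|\,d\lambda$ has a (finite) $\lambda$-concave majorant, then $f^o\ge0$ is the Radon–Nikodym derivative with respect to $\lambda$ of the least one, $G$, that is, $\int_{(-\infty,x]}f^o\,d\lambda=G(x)$ for all $x$; otherwise $f^o=\sup_k(\min(|f|,k))^o$. $(L^\infty_\lambda)^o$ is the space of $f$ with $\|f\|_{(L^\infty_\lambda)^o}=\|f^o\|_{L^\infty_\lambda}<\infty$.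 *Couples:* for couples $(X_0,X_1)$, $(Y_0,Y_1)$ of such spaces put $K(t,x;X_0,X_1)=\inf\{\|x_0\|_{X_0}+t\|x_1\|_{X_1}:x_j\in X_j,\ x_0+x_1=x\}$. An operator $T:(X_0,X_1)\to(Y_0,Y_1)$ of norm at most $c$ is a linear map $T:X_0+X_1\to Y_0+Y_1$ that maps $X_j$ into $Y_j$ with $\|Tx\|_{Y_j}\le c\|x\|_{X_j}$ for $x\in X_j$, $j=0,1$. The couples $(X_0,X_1)$ and $(Y_0,Y_1)$ (in this order) form a *$c$-uniform relative Calderón–Mityagin pair* if, whenever $x\in X_0+X_1$ and $y\in Y_0+Y_1$ satisfy $K(t,y;Y_0,Y_1)\le K(t,x;X_0,X_1)$ for all $t>0$, there is an operator $T:(X_0,X_1)\to(Y_0,Y_1)$ of norm at most $c$ with $Tx=y$. *Exact* means $c=1$; $(X_0,X_1)$ is an *exact Calderón–Mityagin couple* if it forms an exact relative pair with itself. *Constants:* write $L^1,L^\infty,\widetilde{L^1},(L^\infty)^o$ for the spaces over Lebesgue measure on $(0,\infty)$. Let $m\ge0$ be a constant such that for each $g\in\widetilde{L^1}+L^\infty$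 there is an operator $M:(L^1,L^\infty)\to(\widetilde{L^1},L^\infty)$ of norm at most $m$ with $M\tilde g=g$, and let $n\ge0$ be a constant such that for each $f\in L^1+(L^\infty)^o$ there is an operator $N:(L^1,(L^\infty)^o)\to(L^1,L^\infty)$ of norm at most $n$ with $Nf=f^o$. **Theorem.** Let $\mu,\nu$ be Borel measures on $\mathbb R$ with $\mu((-\infty,x])<\infty$ and $\nu((-\infty,x])<\infty$ for all $x\in\mathbb R$, and let $m$, $n$ be constants as above. Then: (a) $(\widetilde{L^1_\mu},L^\infty_\mu)$ is an exact Calderón–Mityagin couple. (b) $(\widetilde{L^1_\mu},L^\infty_\mu)$ and $(\widetilde{L^1_\nu},L^\infty_\nu)$ form an exact relative Calderón–Mityagin pair. (c) $(\widetilde{L^1_\mu},L^\infty_\mu)$ and $(L^1_\nu,L^\infty_\nu)$ form an exact relative Calderón–Mityagin pair. (d) $(L^1_\mu,L^\infty_\mu)$ and $(\widetilde{L^1_\nu},L^\infty_\nu)$ form an $m$-uniform relative Calderón–Mityagin pair. (e) $(L^1_\mu,(L^\infty_\mu)^o)$ is an exact Calderón–Mityagin couple. (f) $(L^1_\mu,(L^\infty_\mu)^o)$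 and $(L^1_\nu,(L^\infty_\nu)^o)$ form an exact relative Calderón–Mityagin pair. (g) $(L^1_\mu,L^\infty_\mu)$ and $(L^1_\nu,(L^\infty_\nu)^o)$ form an exact relative Calderón–Mityagin pair. (h) $(L^1_\mu,(L^\infty_\mu)^o)$ and $(L^1_\nu,L^\infty_\nu)$ form an $n$-uniform relative Calderón–Mityagin pair. -/

import Mathlib

open MeasureTheory Set
open scoped ENNReal NNReal

noncomputable section

namespace CalderonMityagin

/-! ### Couples, K-functional, Calderón–Mityagin pairs -/

/-- A couple `(X₀, X₁)` of spaces inside a common real vector space `V`, given by extended norms: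
`X_j` consists of the elements with `norm_j < ∞`. -/
structure Couple (V : Type*) where
  norm₀ : V → ℝ≥0∞
  norm₁ : V → ℝ≥0∞

namespace Couple

variable {V W : Type*} [AddCommGroup V] [Module ℝ V] [AddCommGroup W] [Module ℝ W]

/-- The space `X₀`. (For a norm, the elements of finite norm already form a subspace; the span
makes this a `Submodule` by definition.) -/
def space₀ (X : Couple V) : Submodule ℝ V := Submodule.span ℝ {x | X.norm₀ x < ∞}

/-- The space `X₁`. -/
def space₁ (X : Couple V) : Submodule ℝ V := Submodule.span ℝ {x | X.norm₁ x < ∞}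

/-- The space `X₀ + X₁`. -/
def sum (X : Couple V) : Submodule ℝ V := X.space₀ ⊔ X.space₁

/-- `K(t, x; X₀, X₁) = inf {‖x₀‖ + t ‖x₁‖ : x₀ ∈ X₀, x₁ ∈ X₁, x₀ + x₁ = x}`. -/
def K (X : Couple V) (t : ℝ≥0) (x : V) : ℝ≥0∞ :=
  ⨅ (x₀ ∈ X.space₀) (x₁ ∈ X.space₁) (_ : x₀ + x₁ = x), X.norm₀ x₀ + t * X.norm₁ x₁

/-- The linear operator `T : X₀ + X₁ → Y₀ + Y₁` maps `X_j` boundedly into `Y_j` with norm at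
most `c`, for `j = 0, 1`. -/
def OpNormLE (X : Couple V) (Y : Couple W) (c : ℝ≥0) (T : X.sum →ₗ[ℝ] Y.sum) : Prop :=
  (∀ x : X.sum, (x : V) ∈ X.space₀ →
    (T x : W) ∈ Y.space₀ ∧ Y.norm₀ (T x : W) ≤ c * X.norm₀ (x : V)) ∧
  (∀ x : X.sum, (x : V) ∈ X.space₁ →
    (T x : W) ∈ Y.space₁ ∧ Y.norm₁ (T x : W) ≤ c * X.norm₁ (x : V))

/-- `[(X₀, X₁), (Y₀, Y₁)]` is a `c`-uniform relative Calderón–Mityagin pair. -/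
def IsUniformRelCM (c : ℝ≥0) (X : Couple V) (Y : Couple W) : Prop :=
  ∀ (x : X.sum) (y : Y.sum), (∀ t : ℝ≥0, 0 < t → Y.K t (y : W) ≤ X.K t (x : V)) →
    ∃ T : X.sum →ₗ[ℝ] Y.sum, OpNormLE X Y c T ∧ T x = y

/-- Exact relative Calderón–Mityagin pair. -/
def IsExactRelCM (X : Couple V) (Y : Couple W) : Prop := IsUniformRelCM 1 X Y

/-- Exact Calderón–Mityagin couple. -/
def IsExactCM (X : Couple V) : Prop := IsExactRelCM X X

end Couple

/-! ### Least decreasing majorant -/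

/-- The least decreasing majorant `x ↦ ess sup_ρ {|f y| : y ≥ x}`. -/
def ldm (ρ : Measure ℝ) (f : ℝ → ℝ) (x : ℝ) : ℝ≥0∞ :=
  essSup (fun y => ‖f y‖ₑ) (ρ.restrict (Ici x))

theorem ldm_antitone (ρ : Measure ℝ) (f : ℝ → ℝ) : Antitone (ldm ρ f) := fun _ _ h =>
  essSup_mono_measure (Measure.absolutelyContinuous_of_le
    (Measure.restrict_mono (Ici_subset_Ici.2 h) le_rfl))

/-- The least decreasing majorant as a class of real-valued functions. -/
def ldmClass (ρ : Measure ℝ) (f : ℝ →ₘ[ρ] ℝ) : ℝ →ₘ[ρ] ℝ :=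
  AEEqFun.mk (fun x => (ldm ρ f x).toReal)
    (ldm_antitone ρ f).measurable.ennreal_toReal.aestronglyMeasurable

/-! ### Level function -/

/-- `F` is non-negative and `ρ`-concave, with `Λ x = ρ (-∞, x]`. -/
structure IsConcaveWrt (ρ : Measure ℝ) (F : ℝ → ℝ) : Prop where
  nonneg : ∀ x, 0 ≤ F x
  aemeasurable : AEMeasurable F ρ
  concave : ∀ a x b, a ≤ x → x ≤ b →
    (F b - F x) * (ρ.real (Iic x) - ρ.real (Iic a)) ≤
      (ρ.real (Iic b) - ρ.real (Iic x)) * (F x - F a)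

/-- The (finite) `ρ`-concave majorants of `x ↦ ∫_{(-∞, x)} u dρ`. -/
def concaveMajorants (ρ : Measure ℝ) (u : ℝ → ℝ≥0∞) : Set (ℝ → ℝ) :=
  {G | IsConcaveWrt ρ G ∧ ∀ x, ∫⁻ y in Iio x, u y ∂ρ ≤ ENNReal.ofReal (G x)}

/-- `g` is the Radon–Nikodym derivative with respect to `ρ` of the least `ρ`-concave majorant `G`
of `x ↦ ∫_{(-∞, x)} u dρ`, that is, `g dρ` is the measure with distribution function `G`. -/
def IsLevelOf (ρ : Measure ℝ) (u g : ℝ → ℝ≥0∞) : Prop :=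
  Measurable g ∧ ∃ G, IsLeast (concaveMajorants ρ u) G ∧
    ∀ x, ∫⁻ y in Iic x, g y ∂ρ = ENNReal.ofReal (G x)

open Classical in
/-- A version of the (`ρ`-a.e. unique) function `g` with `IsLevelOf ρ u g`, used when `u` has a
finite `ρ`-concave majorant. -/
def levelAux (ρ : Measure ℝ) (u : ℝ → ℝ≥0∞) : ℝ → ℝ≥0∞ :=
  if h : ∃ g, IsLevelOf ρ u g then h.choose else fun _ => ∞

open Classical in
/-- The level function of `f`. If there is no finite `ρ`-concave majorant, it is defined by
monotonicity from the bounded functions `min |f| k ↑ |f|`. -/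
def level (ρ : Measure ℝ) (f : ℝ → ℝ) : ℝ → ℝ≥0∞ :=
  if (concaveMajorants ρ fun y => ‖f y‖ₑ).Nonempty then levelAux ρ fun y => ‖f y‖ₑ
  else fun x => ⨆ k : ℕ, levelAux ρ (fun y => min ‖f y‖ₑ k) x

/-! ### The three couples over a measure on `ℝ` -/

/-- `(L¹, L^∞)`. -/
def coupleL (ρ : Measure ℝ) : Couple (ℝ →ₘ[ρ] ℝ) where
  norm₀ f := eLpNorm f 1 ρ
  norm₁ f := eLpNorm f ∞ ρ

/-- `(L̃¹, L^∞)`, where the norm of `f` in `L̃¹` is the `L¹` norm of its least decreasing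
majorant. -/
def coupleTilde (ρ : Measure ℝ) : Couple (ℝ →ₘ[ρ] ℝ) where
  norm₀ f := eLpNorm (ldm ρ f) 1 ρ
  norm₁ f := eLpNorm f ∞ ρ

/-- `(L¹, (L^∞)ᵒ)`, where the norm of `f` in `(L^∞)ᵒ` is the `L^∞` norm of its level function. -/
def coupleLevel (ρ : Measure ℝ) : Couple (ℝ →ₘ[ρ] ℝ) where
  norm₀ f := eLpNorm f 1 ρ
  norm₁ f := eLpNorm (level ρ f) ∞ ρ

/-! ### The constants `m` and `n` (half line, Lebesgue measure) -/

/-- Lebesgue measure on `(0, ∞)`. -/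
def halfLine : Measure ℝ := volume.restrict (Ioi 0)

/-- For each `g ∈ L̃¹ + L^∞` on the half line there is a linear `M : (L¹, L^∞) → (L̃¹, L^∞)` of norm
at most `m` which maps the least decreasing majorant of `g` to `g`. -/
def IsMConst (m : ℝ≥0) : Prop :=
  ∀ g : (coupleTilde halfLine).sum, ∃ h : (coupleL halfLine).sum,
    (h : ℝ →ₘ[halfLine] ℝ) = ldmClass halfLine g ∧
    ∃ M : (coupleL halfLine).sum →ₗ[ℝ] (coupleTilde halfLine).sum,
      Couple.OpNormLE _ _ m M ∧ M h = g

/-- For each `f ∈ L¹ + (L^∞)ᵒ` on the half line there is a linear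
`N : (L¹, (L^∞)ᵒ) → (L¹, L^∞)` of norm at most `n` which maps `f` to its level function. -/
def IsNConst (n : ℝ≥0) : Prop :=
  ∀ f : (coupleLevel halfLine).sum,
    ∃ N : (coupleLevel halfLine).sum →ₗ[ℝ] (coupleL halfLine).sum,
      Couple.OpNormLE _ _ n N ∧
      ∀ᵐ x ∂halfLine, (N f : ℝ →ₘ[halfLine] ℝ) x = (level halfLine f x).toReal

end CalderonMityagin

end

set_option linter.unusedSectionVars false

open MeasureTheory Set Filter Topology
open scoped ENNReal NNReal

/-! Everything is reduced to Lebesgue measure on the half line. With `Λ` the distribution function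
of `ρ`, `pull` composes with the generalized inverse of `Λ`, and `push` averages over the fibres of
that inverse, the fibre of an atom being the interval over which `Λ` jumps. Both maps are
contractions for all the norms involved, and `push` after `pull` is the identity (`push_pull`).
Hence a relative Calderón–Mityagin property passes from the half line to arbitrary measures with the
same constant (`IsTransfer.isUniformRelCM`). For the level function this uses `level_norm_le_iff`:
`‖fᵒ‖_∞ ≤ C` holds exactly when `∫_{(-∞,x]} |f| ≤ C Λ(x)` for all `x`.

On the half line, `K(t, x)` is governed by the integral over `(0, t]` of a decreasing function
attached to `x`: the decreasing rearrangement for `(L¹, L^∞)`, the least decreasing majorant for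
`(L̃¹, L^∞)`, the level function for `(L¹, (L^∞)ᵒ)`. The argument is a duality on dyadic step
functions. The vectors of block averages of `T x`, with `T` a contraction, form a convex set. By
Hahn–Banach the vector of `y` belongs to its closure as soon as every linear functional `φ` takes,
up to `ε`, at least as large a value at some `T x` as at `y` (`exists_op_avg_near`).

Such a `T` is composed of two matrices, with the inclusion of the first couple in the second between
them. A source matrix (`IsSource`) is a contraction of the first couple and maps `|x|` to a step
function whose primitive reaches `K(t, x)` at the grid points, up to `ε`. It is a sorting
permutation for `(L¹, L^∞)`, the selection of the maximum to the right for `(L̃¹, L^∞)`, and an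
averaging of neighbouring entries for `(L¹, (L^∞)ᵒ)`. A target matrix (`IsTarget`) is a contraction
of the second couple, chosen for `φ`, and gives at least the value of `φ` at `y` on every vector
whose partial sums dominate `K(t, y)`. The three constructions reappear in dual roles: a signed
permutation sorting `|φ|` for `(L¹, L^∞)`, moves to the right for `(L¹, (L^∞)ᵒ)`, a transposed
averaging for `(L̃¹, L^∞)`. The comparison of functionals is Hardy's lemma,
`sum_mul_le_sum_mul_of_antitone`.

It remains to pass to the limit in the mesh. The primitives of `T n f` have limits along an
ultrafilter, these limits are differentiable almost everywhere, and the derivative is the value of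
the limit operator at `f` (`exists_op_of_avg_tendsto`). The Fatou property keeps the norm at most
one.

When the target is `(L̃¹, L^∞)`, the scheme reaches the least decreasing majorant of `y`, and `y` is
that majorant times a function bounded by one. The pairs with constants factor through `(L¹, L^∞)`:
for `m` via the least decreasing majorant of `y`, for `n` via the level function of `x`, using the
comparisons `K_coupleL_ldmClass_le` and `K_coupleLevel_le_setLIntegral_level`. -/

namespace CalderonMityagin

/-! ### Couples of extended seminorms, their K-functionals and operators. -/

namespace Couple

variable {V W Z : Type*} [AddCommGroup V] [Module ℝ V] [AddCommGroup W] [Module ℝ W]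
  [AddCommGroup Z] [Module ℝ Z]

/-- Both extended norms of the couple are subadditive and homogeneous. -/
structure IsSeminorm (X : Couple V) : Prop where
  add₀ : ∀ f g, X.norm₀ (f + g) ≤ X.norm₀ f + X.norm₀ g
  smul₀ : ∀ (c : ℝ) f, X.norm₀ (c • f) ≤ ‖c‖ₑ * X.norm₀ f
  add₁ : ∀ f g, X.norm₁ (f + g) ≤ X.norm₁ f + X.norm₁ g
  smul₁ : ∀ (c : ℝ) f, X.norm₁ (c • f) ≤ ‖c‖ₑ * X.norm₁ f

theorem mem_span_lt_top_iff {p : V → ℝ≥0∞} (hadd : ∀ f g, p (f + g) ≤ p f + p g)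
    (hsmul : ∀ (c : ℝ) f, p (c • f) ≤ ‖c‖ₑ * p f) {f : V} :
    f ∈ Submodule.span ℝ {x | p x < ∞} ↔ p f < ∞ := by
  refine ⟨fun h => ?_, fun h => Submodule.subset_span h⟩
  induction h using Submodule.span_induction with
  | mem x hx => exact hx
  | zero =>
    have := hsmul 0 0
    simp only [zero_smul, enorm_zero, zero_mul] at this
    exact this.trans_lt ENNReal.zero_lt_top
  | add x y _ _ hx hy => exact (hadd x y).trans_lt (ENNReal.add_lt_top.2 ⟨hx, hy⟩)
  | smul a x _ hx => exact (hsmul a x).trans_lt (ENNReal.mul_lt_top enorm_lt_top hx)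

theorem IsSeminorm.mem_space₀ {X : Couple V} (hX : X.IsSeminorm) {f : V} :
    f ∈ X.space₀ ↔ X.norm₀ f < ∞ := mem_span_lt_top_iff hX.add₀ hX.smul₀

theorem IsSeminorm.mem_space₁ {X : Couple V} (hX : X.IsSeminorm) {f : V} :
    f ∈ X.space₁ ↔ X.norm₁ f < ∞ := mem_span_lt_top_iff hX.add₁ hX.smul₁

theorem mem_sum_of_norm₀ {X : Couple V} {f : V} (h : X.norm₀ f < ∞) : f ∈ X.sum :=
  Submodule.mem_sup_left (Submodule.subset_span h)

theorem mem_sum_of_norm₁ {X : Couple V} {f : V} (h : X.norm₁ f < ∞) : f ∈ X.sum :=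
  Submodule.mem_sup_right (Submodule.subset_span h)

theorem IsSeminorm.exists_add_eq {X : Couple V} (hX : X.IsSeminorm) {f : V} (hf : f ∈ X.sum) :
    ∃ f₀ f₁, X.norm₀ f₀ < ∞ ∧ X.norm₁ f₁ < ∞ ∧ f₀ + f₁ = f := by
  obtain ⟨f₀, h₀, f₁, h₁, h⟩ := Submodule.mem_sup.1 hf
  exact ⟨f₀, f₁, hX.mem_space₀.1 h₀, hX.mem_space₁.1 h₁, h⟩

/-- No membership is required: if one of the norms is infinite, so is the right side, and `0 < t`
excludes the product `0 * ∞`. -/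
theorem K_le {X : Couple V} {t : ℝ≥0} (ht : 0 < t) {f₀ f₁ f : V} (h : f₀ + f₁ = f) :
    X.K t f ≤ X.norm₀ f₀ + t * X.norm₁ f₁ := by
  by_cases h₀ : X.norm₀ f₀ < ∞
  · by_cases h₁ : X.norm₁ f₁ < ∞
    · exact iInf₂_le_of_le f₀ (Submodule.subset_span h₀)
        (iInf₂_le_of_le f₁ (Submodule.subset_span h₁) (iInf_le_of_le h le_rfl))
    · have : X.norm₁ f₁ = ∞ := not_lt_top_iff.1 h₁
      rw [this, ENNReal.mul_top (by positivity)]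
      simp
  · have : X.norm₀ f₀ = ∞ := not_lt_top_iff.1 h₀
    rw [this]
    simp

theorem IsSeminorm.le_K {X : Couple V} (hX : X.IsSeminorm) {t : ℝ≥0} {f : V} {a : ℝ≥0∞}
    (h : ∀ f₀ f₁, X.norm₀ f₀ < ∞ → X.norm₁ f₁ < ∞ → f₀ + f₁ = f →
      a ≤ X.norm₀ f₀ + t * X.norm₁ f₁) : a ≤ X.K t f :=
  le_iInf₂ fun f₀ h₀ => le_iInf₂ fun f₁ h₁ => le_iInf fun e =>
    h f₀ f₁ (hX.mem_space₀.1 h₀) (hX.mem_space₁.1 h₁) e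

theorem IsSeminorm.K_lt_top {X : Couple V} (hX : X.IsSeminorm) {t : ℝ≥0} (ht : 0 < t) {f : V}
    (hf : f ∈ X.sum) : X.K t f < ∞ := by
  obtain ⟨f₀, f₁, h₀, h₁, h⟩ := hX.exists_add_eq hf
  exact (K_le ht h).trans_lt
    (ENNReal.add_lt_top.2 ⟨h₀, ENNReal.mul_lt_top ENNReal.coe_lt_top h₁⟩)

/-- Linearity is asked only on `X.sum`, because some of the maps used below are given on all classes
by integrals, which are additive only on locally integrable functions. -/
theorem exists_op {X : Couple V} {Y : Couple W} (hX : X.IsSeminorm) {c : ℝ≥0}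
    (τ : V → W) (hadd : ∀ f ∈ X.sum, ∀ g ∈ X.sum, τ (f + g) = τ f + τ g)
    (hsmul : ∀ (a : ℝ), ∀ f ∈ X.sum, τ (a • f) = a • τ f)
    (h₀ : ∀ f, X.norm₀ f < ∞ → Y.norm₀ (τ f) ≤ c * X.norm₀ f)
    (h₁ : ∀ f, X.norm₁ f < ∞ → Y.norm₁ (τ f) ≤ c * X.norm₁ f) :
    ∃ T : X.sum →ₗ[ℝ] Y.sum, OpNormLE X Y c T ∧ ∀ x, (T x : W) = τ x := by
  have h₀' : ∀ f, X.norm₀ f < ∞ → Y.norm₀ (τ f) < ∞ := fun f hf =>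
    (h₀ f hf).trans_lt (ENNReal.mul_lt_top ENNReal.coe_lt_top hf)
  have h₁' : ∀ f, X.norm₁ f < ∞ → Y.norm₁ (τ f) < ∞ := fun f hf =>
    (h₁ f hf).trans_lt (ENNReal.mul_lt_top ENNReal.coe_lt_top hf)
  have hmem : ∀ x : X.sum, τ x ∈ Y.sum := by
    rintro ⟨x, hx⟩
    obtain ⟨f₀, f₁, g₀, g₁, rfl⟩ := hX.exists_add_eq hx
    rw [hadd _ (mem_sum_of_norm₀ g₀) _ (mem_sum_of_norm₁ g₁)]
    exact Submodule.add_mem _ (mem_sum_of_norm₀ (h₀' _ g₀)) (mem_sum_of_norm₁ (h₁' _ g₁))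
  refine ⟨{ toFun := fun x => ⟨τ x, hmem x⟩, map_add' := ?_, map_smul' := ?_ }, ⟨?_, ?_⟩,
    fun x => rfl⟩
  · intro x y
    exact Subtype.ext (hadd x x.2 y y.2)
  · intro a x
    exact Subtype.ext (hsmul a x x.2)
  · intro x hx
    have := hX.mem_space₀.1 hx
    exact ⟨Submodule.subset_span (h₀' _ this), h₀ _ this⟩
  · intro x hx
    have := hX.mem_space₁.1 hx
    exact ⟨Submodule.subset_span (h₁' _ this), h₁ _ this⟩

theorem OpNormLE.comp {X : Couple V} {Y : Couple W} {U : Couple Z} {c d : ℝ≥0}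
    {T : X.sum →ₗ[ℝ] Y.sum} {S : Y.sum →ₗ[ℝ] U.sum} (hS : OpNormLE Y U d S)
    (hT : OpNormLE X Y c T) : OpNormLE X U (d * c) (S ∘ₗ T) := by
  constructor
  · intro x hx
    obtain ⟨h1, h2⟩ := hT.1 x hx
    obtain ⟨h3, h4⟩ := hS.1 (T x) h1
    refine ⟨h3, h4.trans ?_⟩
    push_cast
    rw [mul_assoc]
    gcongr
  · intro x hx
    obtain ⟨h1, h2⟩ := hT.2 x hx
    obtain ⟨h3, h4⟩ := hS.2 (T x) h1
    refine ⟨h3, h4.trans ?_⟩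
    push_cast
    rw [mul_assoc]
    gcongr

theorem OpNormLE.K_le {X : Couple V} {Y : Couple W} (hX : X.IsSeminorm)
    {T : X.sum →ₗ[ℝ] Y.sum} (hT : OpNormLE X Y 1 T) {t : ℝ≥0} (ht : 0 < t) (x : X.sum) :
    Y.K t (T x : W) ≤ X.K t (x : V) := by
  refine hX.le_K fun f₀ f₁ h₀ h₁ h => ?_
  have e : x = ⟨f₀, mem_sum_of_norm₀ h₀⟩ + ⟨f₁, mem_sum_of_norm₁ h₁⟩ := Subtype.ext h.symm
  rw [e, map_add]
  refine (Couple.K_le ht rfl).trans ?_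
  have a := (hT.1 ⟨f₀, mem_sum_of_norm₀ h₀⟩ (hX.mem_space₀.2 h₀)).2
  have b := (hT.2 ⟨f₁, mem_sum_of_norm₁ h₁⟩ (hX.mem_space₁.2 h₁)).2
  simp only [ENNReal.coe_one, one_mul] at a b
  gcongr

theorem OpNormLE.norm₀_le {X : Couple V} {Y : Couple W} {T : X.sum →ₗ[ℝ] Y.sum}
    (hT : OpNormLE X Y 1 T) {x : X.sum} (hx : X.norm₀ (x : V) < ∞) :
    Y.norm₀ (T x : W) ≤ X.norm₀ (x : V) := by
  simpa using (hT.1 x (Submodule.subset_span hx)).2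

theorem OpNormLE.norm₁_le {X : Couple V} {Y : Couple W} {T : X.sum →ₗ[ℝ] Y.sum}
    (hT : OpNormLE X Y 1 T) {x : X.sum} (hx : X.norm₁ (x : V) < ∞) :
    Y.norm₁ (T x : W) ≤ X.norm₁ (x : V) := by
  simpa using (hT.2 x (Submodule.subset_span hx)).2

/-- Contractions form a convex set, as the Hahn–Banach argument requires. -/
theorem OpNormLE.convex {X : Couple V} {Y : Couple W} (hX : X.IsSeminorm) (hY : Y.IsSeminorm)
    {S T : X.sum →ₗ[ℝ] Y.sum} (hS : OpNormLE X Y 1 S) (hT : OpNormLE X Y 1 T) {a b : ℝ}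
    (ha : 0 ≤ a) (hb : 0 ≤ b) (hab : a + b = 1) : OpNormLE X Y 1 (a • S + b • T) := by
  have e : ‖a‖ₑ + ‖b‖ₑ = 1 := by
    rw [Real.enorm_of_nonneg ha, Real.enorm_of_nonneg hb, ← ENNReal.ofReal_add ha hb, hab,
      ENNReal.ofReal_one]
  constructor
  · intro x hx
    have hx' := hX.mem_space₀.1 hx
    have h : Y.norm₀ ((a • S + b • T) x : W) ≤ X.norm₀ (x : V) := by
      calc Y.norm₀ (a • (S x : W) + b • (T x : W))
          ≤ ‖a‖ₑ * X.norm₀ (x : V) + ‖b‖ₑ * X.norm₀ (x : V) :=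
            (hY.add₀ _ _).trans (add_le_add
              ((hY.smul₀ _ _).trans (by gcongr; exact hS.norm₀_le hx'))
              ((hY.smul₀ _ _).trans (by gcongr; exact hT.norm₀_le hx')))
        _ = X.norm₀ (x : V) := by rw [← add_mul, e, one_mul]
    exact ⟨hY.mem_space₀.2 (h.trans_lt hx'), by simpa using h⟩
  · intro x hx
    have hx' := hX.mem_space₁.1 hx
    have h : Y.norm₁ ((a • S + b • T) x : W) ≤ X.norm₁ (x : V) := by
      calc Y.norm₁ (a • (S x : W) + b • (T x : W))
          ≤ ‖a‖ₑ * X.norm₁ (x : V) + ‖b‖ₑ * X.norm₁ (x : V) :=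
            (hY.add₁ _ _).trans (add_le_add
              ((hY.smul₁ _ _).trans (by gcongr; exact hS.norm₁_le hx'))
              ((hY.smul₁ _ _).trans (by gcongr; exact hT.norm₁_le hx')))
        _ = X.norm₁ (x : V) := by rw [← add_mul, e, one_mul]
    exact ⟨hY.mem_space₁.2 (h.trans_lt hx'), by simpa using h⟩

end Couple

/-! ### Least decreasing majorants and seminorm properties. -/

theorem ldm_le_of_ae_le {ρ : Measure ℝ} {f : ℝ → ℝ} {w : ℝ → ℝ≥0∞} (hw : Antitone w)
    (h : ∀ᵐ y ∂ρ, ‖f y‖ₑ ≤ w y) (x : ℝ) : ldm ρ f x ≤ w x := by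
  refine essSup_le_of_ae_le _ ?_
  filter_upwards [ae_restrict_of_ae h, ae_restrict_mem measurableSet_Ici] with y hy hxy
  exact hy.trans (hw hxy)

/-- For a fixed `x` the bound by the value at `x` holds almost everywhere on `[x, ∞)`. Countably
many `x` suffice: the rationals, and the discontinuities of the monotone function `ldm ρ f`. -/
theorem ae_enorm_le_ldm (ρ : Measure ℝ) (f : ℝ → ℝ) : ∀ᵐ y ∂ρ, ‖f y‖ₑ ≤ ldm ρ f y := by
  have h : ∀ x, ∀ᵐ y ∂ρ, x ≤ y → ‖f y‖ₑ ≤ ldm ρ f x := fun x => by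
    have := ae_le_essSup (μ := ρ.restrict (Ici x)) (f := fun y => ‖f y‖ₑ)
    rwa [ae_restrict_iff' measurableSet_Ici] at this
  have hq : ∀ᵐ y ∂ρ, ∀ q : ℚ, (q : ℝ) ≤ y → ‖f y‖ₑ ≤ ldm ρ f q :=
    ae_all_iff.2 fun q => h q
  have hD : ∀ᵐ y ∂ρ, ∀ x ∈ {x | ¬ ContinuousAt (ldm ρ f) x}, x ≤ y → ‖f y‖ₑ ≤ ldm ρ f x :=
    (ae_ball_iff (ldm_antitone ρ f).countable_not_continuousAt).2 fun x _ => h x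
  filter_upwards [hq, hD] with y h1 h2
  by_cases hc : ContinuousAt (ldm ρ f) y
  -- At a point of continuity, some rational slightly to the left would already have a value below
  -- `‖f y‖ₑ`.
  · by_contra! hlt
    obtain ⟨δ, hδ, hb⟩ := Metric.eventually_nhds_iff.1 (hc.eventually_lt_const hlt)
    obtain ⟨q, hq1, hq2⟩ := exists_rat_btwn (sub_lt_self y hδ)
    have := hb (y := (q : ℝ)) (by rw [Real.dist_eq, abs_lt]; constructor <;> linarith)
    exact absurd (h1 q hq2.le) (not_le.2 this)
  · exact h2 y hc le_rfl

theorem ldm_le_essSup (ρ : Measure ℝ) (f : ℝ → ℝ) (x : ℝ) : ldm ρ f x ≤ eLpNorm f ∞ ρ := by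
  rw [eLpNorm_exponent_top]
  exact essSup_mono_measure (Measure.absolutelyContinuous_of_le Measure.restrict_le_self)

theorem eLpNorm_ldm_one (ρ : Measure ℝ) (f : ℝ → ℝ) :
    eLpNorm (ldm ρ f) 1 ρ = ∫⁻ x, ldm ρ f x ∂ρ := by
  simp [eLpNorm_one_eq_lintegral_enorm]

theorem measurable_ldm (ρ : Measure ℝ) (f : ℝ → ℝ) : Measurable (ldm ρ f) :=
  (ldm_antitone ρ f).measurable

theorem ldm_add_le (ρ : Measure ℝ) (f g : ℝ →ₘ[ρ] ℝ) (x : ℝ) :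
    ldm ρ (f + g : ℝ →ₘ[ρ] ℝ) x ≤ ldm ρ f x + ldm ρ g x := by
  refine ldm_le_of_ae_le (w := fun x => ldm ρ f x + ldm ρ g x)
    (fun a b h => add_le_add (ldm_antitone ρ f h) (ldm_antitone ρ g h)) ?_ x
  filter_upwards [AEEqFun.coeFn_add f g, ae_enorm_le_ldm ρ f, ae_enorm_le_ldm ρ g] with y h1 h2 h3
  rw [h1]
  exact (enorm_add_le _ _).trans (add_le_add h2 h3)

theorem ldm_smul_le (ρ : Measure ℝ) (c : ℝ) (f : ℝ →ₘ[ρ] ℝ) (x : ℝ) :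
    ldm ρ (c • f : ℝ →ₘ[ρ] ℝ) x ≤ ‖c‖ₑ * ldm ρ f x := by
  refine ldm_le_of_ae_le (w := fun x => ‖c‖ₑ * ldm ρ f x)
    (fun a b h => by dsimp only; gcongr; exact ldm_antitone ρ f h) ?_ x
  filter_upwards [AEEqFun.coeFn_smul c f, ae_enorm_le_ldm ρ f] with y h1 h2
  rw [h1, Pi.smul_apply, smul_eq_mul, enorm_mul]
  gcongr

theorem eLpNorm_coeFn_add_le {ρ : Measure ℝ} {p : ℝ≥0∞} (hp : 1 ≤ p) (f g : ℝ →ₘ[ρ] ℝ) :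
    eLpNorm (f + g : ℝ →ₘ[ρ] ℝ) p ρ ≤ eLpNorm f p ρ + eLpNorm g p ρ := by
  rw [eLpNorm_congr_ae (AEEqFun.coeFn_add f g)]
  exact eLpNorm_add_le f.aestronglyMeasurable g.aestronglyMeasurable hp

theorem eLpNorm_coeFn_smul_le {ρ : Measure ℝ} {p : ℝ≥0∞} (c : ℝ) (f : ℝ →ₘ[ρ] ℝ) :
    eLpNorm (c • f : ℝ →ₘ[ρ] ℝ) p ρ ≤ ‖c‖ₑ * eLpNorm f p ρ := by
  rw [eLpNorm_congr_ae (AEEqFun.coeFn_smul c f)]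
  exact eLpNorm_const_smul_le

theorem isSeminorm_coupleL (ρ : Measure ℝ) : (coupleL ρ).IsSeminorm where
  add₀ := eLpNorm_coeFn_add_le le_rfl
  smul₀ := eLpNorm_coeFn_smul_le
  add₁ := eLpNorm_coeFn_add_le le_top
  smul₁ c f := eLpNorm_coeFn_smul_le (p := ∞) c f

theorem coupleTilde_norm₀ (ρ : Measure ℝ) (f : ℝ →ₘ[ρ] ℝ) :
    (coupleTilde ρ).norm₀ f = ∫⁻ x, ldm ρ f x ∂ρ := eLpNorm_ldm_one ρ f

theorem coupleL_norm₀ (ρ : Measure ℝ) (f : ℝ →ₘ[ρ] ℝ) :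
    (coupleL ρ).norm₀ f = ∫⁻ x, ‖f x‖ₑ ∂ρ := eLpNorm_one_eq_lintegral_enorm

theorem coupleLevel_norm₀ (ρ : Measure ℝ) (f : ℝ →ₘ[ρ] ℝ) :
    (coupleLevel ρ).norm₀ f = ∫⁻ x, ‖f x‖ₑ ∂ρ := eLpNorm_one_eq_lintegral_enorm

theorem isSeminorm_coupleTilde (ρ : Measure ℝ) : (coupleTilde ρ).IsSeminorm where
  add₀ f g := by
    simp only [coupleTilde_norm₀]
    rw [← lintegral_add_left (measurable_ldm ρ f)]
    exact lintegral_mono (ldm_add_le ρ f g)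
  smul₀ c f := by
    simp only [coupleTilde_norm₀]
    rw [← lintegral_const_mul _ (measurable_ldm ρ f)]
    exact lintegral_mono (ldm_smul_le ρ c f)
  add₁ := eLpNorm_coeFn_add_le le_top
  smul₁ c f := eLpNorm_coeFn_smul_le (p := ∞) c f

/-! ### Distribution function, quantile function and splitting of atoms. -/

/-- The measure is finite on all half lines `(-∞, x]`. -/
class FiniteIic (ρ : Measure ℝ) : Prop where
  lt_top : ∀ x, ρ (Iic x) < ∞

instance (ρ : Measure ℝ) [FiniteIic ρ] : SigmaFinite ρ := by
  refine ⟨⟨⟨fun n : ℕ => Iic (n : ℝ), fun _ => trivial, fun n => FiniteIic.lt_top _, ?_⟩⟩⟩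
  refine eq_univ_of_forall fun x => ?_
  obtain ⟨n, hn⟩ := exists_nat_ge x
  exact mem_iUnion.2 ⟨n, hn⟩

/-- The distribution function of `ρ`. -/
noncomputable def distr (ρ : Measure ℝ) (x : ℝ) : ℝ := ρ.real (Iic x)

/-- The left limit of the distribution function of `ρ`. -/
noncomputable def distrLeft (ρ : Measure ℝ) (x : ℝ) : ℝ := ρ.real (Iio x)

/-- The positive numbers that do not exceed some value of the distribution function. -/
def distrRange (ρ : Measure ℝ) : Set ℝ := {s | 0 < s ∧ ∃ x, s ≤ distr ρ x}

open Classical in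
/-- The generalized inverse of the distribution function. -/
noncomputable def quantile (ρ : Measure ℝ) (s : ℝ) : ℝ :=
  if s ∈ distrRange ρ then sInf {x | s ≤ distr ρ x} else 0

/-- The distribution function, interpolated linearly across the atoms. -/
noncomputable def distrSplit (ρ : Measure ℝ) (p : ℝ × ℝ) : ℝ :=
  distrLeft ρ p.1 + p.2 * (distr ρ p.1 - distrLeft ρ p.1)

/-- Lebesgue measure on the unit interval. -/
noncomputable def unitMeasure : Measure ℝ := volume.restrict (Ioo 0 1)

instance : IsProbabilityMeasure unitMeasure := ⟨by simp [unitMeasure]⟩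

section distr

variable (ρ : Measure ℝ) [FiniteIic ρ]

theorem ofReal_distr (x : ℝ) : ENNReal.ofReal (distr ρ x) = ρ (Iic x) :=
  ENNReal.ofReal_toReal (FiniteIic.lt_top x).ne

theorem measure_Iio_lt_top (x : ℝ) : ρ (Iio x) < ∞ :=
  (measure_mono Iio_subset_Iic_self).trans_lt (FiniteIic.lt_top x)

theorem ofReal_distrLeft (x : ℝ) : ENNReal.ofReal (distrLeft ρ x) = ρ (Iio x) :=
  ENNReal.ofReal_toReal (measure_Iio_lt_top ρ x).ne

theorem distr_nonneg (x : ℝ) : 0 ≤ distr ρ x := measureReal_nonneg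

theorem distrLeft_nonneg (x : ℝ) : 0 ≤ distrLeft ρ x := measureReal_nonneg

theorem distr_mono : Monotone (distr ρ) := fun _ y h =>
  measureReal_mono (Iic_subset_Iic.2 h) (FiniteIic.lt_top y).ne

theorem distrLeft_mono : Monotone (distrLeft ρ) := fun _ y h =>
  measureReal_mono (Iio_subset_Iio h) (measure_Iio_lt_top ρ y).ne

theorem distrLeft_le_distr (x : ℝ) : distrLeft ρ x ≤ distr ρ x :=
  measureReal_mono Iio_subset_Iic_self (FiniteIic.lt_top x).ne

theorem distr_le_distrLeft {x y : ℝ} (h : x < y) : distr ρ x ≤ distrLeft ρ y :=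
  measureReal_mono (Iic_subset_Iio.2 h) (measure_Iio_lt_top ρ y).ne

theorem measure_singleton_eq (x : ℝ) :
    ρ {x} = ENNReal.ofReal (distr ρ x - distrLeft ρ x) := by
  rw [ENNReal.ofReal_sub _ (distrLeft_nonneg ρ x), ofReal_distr, ofReal_distrLeft,
    ← measure_sdiff Iio_subset_Iic_self measurableSet_Iio.nullMeasurableSet
      (measure_Iio_lt_top ρ x).ne, Iic_sdiff_Iio, Icc_self]

theorem exists_distr_lt {s : ℝ} (hs : 0 < s) : ∃ x, distr ρ x < s := by
  have h := tendsto_measure_iInter_atTop (μ := ρ) (s := fun n : ℕ => Iic (-(n : ℝ)))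
    (fun n => measurableSet_Iic.nullMeasurableSet)
    (fun m n h => Iic_subset_Iic.2 (by simpa using h)) ⟨0, (FiniteIic.lt_top _).ne⟩
  have e : ⋂ n : ℕ, Iic (-(n : ℝ)) = ∅ := by
    refine eq_empty_of_forall_notMem fun x hx => ?_
    obtain ⟨n, hn⟩ := exists_nat_gt (-x)
    have := mem_iInter.1 hx n
    simp only [mem_Iic] at this
    linarith
  rw [e, measure_empty] at h
  obtain ⟨n, hn⟩ := (h.eventually_lt_const (ENNReal.ofReal_pos.2 hs)).exists
  refine ⟨-n, ?_⟩
  rw [Function.comp_apply, ← ofReal_distr] at hn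
  exact (ENNReal.ofReal_lt_ofReal_iff hs).1 hn

/-- Right continuity of the distribution function, from continuity from above of the measure;
finiteness on half lines enters here. -/
theorem le_distr_of_forall_gt {s x : ℝ} (h : ∀ y, x < y → s ≤ distr ρ y) : s ≤ distr ρ x := by
  have ht := tendsto_measure_iInter_atTop (μ := ρ) (s := fun n : ℕ => Iic (x + 1 / ((n : ℝ) + 1)))
    (fun n => measurableSet_Iic.nullMeasurableSet)
    (fun m n h => Iic_subset_Iic.2 (by gcongr)) ⟨0, (FiniteIic.lt_top _).ne⟩
  have e : ⋂ n : ℕ, Iic (x + 1 / ((n : ℝ) + 1)) = Iic x := by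
    ext y
    simp only [mem_iInter, mem_Iic]
    refine ⟨fun hy => ?_, fun hy n => hy.trans (by simp; positivity)⟩
    refine le_of_forall_pos_le_add fun ε hε => ?_
    obtain ⟨n, hn⟩ := exists_nat_one_div_lt hε
    exact (hy n).trans (by gcongr)
  rw [e] at ht
  have := ge_of_tendsto' (b := ENNReal.ofReal s) ht fun n => by
    rw [Function.comp_apply, ← ofReal_distr]
    exact ENNReal.ofReal_le_ofReal (h _ (by simp; positivity))
  rw [← ofReal_distr] at this
  exact (ENNReal.ofReal_le_ofReal_iff (distr_nonneg ρ x)).1 this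

theorem measurableSet_distrRange : MeasurableSet (distrRange ρ) := by
  refine OrdConnected.measurableSet ⟨fun a ha b hb c hc => ⟨ha.1.trans_le hc.1, ?_⟩⟩
  obtain ⟨x, hx⟩ := hb.2
  exact ⟨x, hc.2.trans hx⟩

/-- The infimum is attained by right continuity, so quantile and distribution function form a Galois
connection. -/
theorem quantile_le_iff {s : ℝ} (hs : s ∈ distrRange ρ) {x : ℝ} :
    quantile ρ s ≤ x ↔ s ≤ distr ρ x := by
  rw [quantile, if_pos hs]
  obtain ⟨a, ha⟩ := exists_distr_lt ρ hs.1
  have hb : BddBelow {x | s ≤ distr ρ x} := ⟨a, fun y hy => by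
    by_contra! h
    exact absurd (hy.trans (distr_mono ρ h.le)) (not_le.2 ha)⟩
  refine ⟨fun h => ?_, fun h => csInf_le hb h⟩
  refine le_distr_of_forall_gt ρ fun y hy => ?_
  obtain ⟨z, hz, hzy⟩ := exists_lt_of_csInf_lt (s := {x | s ≤ distr ρ x}) hs.2 (h.trans_lt hy)
  exact le_trans hz (distr_mono ρ hzy.le)

theorem measurable_quantile : Measurable (quantile ρ) := by
  refine measurable_of_Iic fun x => ?_
  have : quantile ρ ⁻¹' Iic x =
      (distrRange ρ ∩ Iic (distr ρ x)) ∪ ((distrRange ρ)ᶜ ∩ {_s | (0 : ℝ) ≤ x}) := by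
    ext s
    by_cases hs : s ∈ distrRange ρ
    · simp [hs, quantile_le_iff ρ hs]
    · simp [hs, quantile]
  rw [this]
  exact ((measurableSet_distrRange ρ).inter measurableSet_Iic).union
    ((measurableSet_distrRange ρ).compl.inter (MeasurableSet.const _))

theorem distrRange_inter_Iic {s : ℝ} (h : s ≤ 0 ∨ ∃ x, s ≤ distr ρ x) :
    distrRange ρ ∩ Iic s = Ioc 0 s := by
  ext r
  simp only [distrRange, mem_inter_iff, mem_ofPred_eq, mem_Iic, mem_Ioc]
  refine ⟨fun h => ⟨h.1.1, h.2⟩, fun hr => ⟨⟨hr.1, ?_⟩, hr.2⟩⟩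
  rcases h with h | ⟨x, hx⟩
  · exact absurd (hr.1.trans_le (hr.2.trans h)) (lt_irrefl _)
  · exact ⟨x, hr.2.trans hx⟩

theorem ext_of_Iic_of_lt_top {μ₁ μ₂ : Measure ℝ} (h₁ : ∀ x, μ₁ (Iic x) < ∞)
    (h : ∀ x, μ₁ (Iic x) = μ₂ (Iic x)) : μ₁ = μ₂ := by
  refine Measure.ext_of_generateFrom_of_iUnion (range Iic) (fun n : ℕ => Iic (n : ℝ))
    (BorelSpace.measurable_eq.trans (borel_eq_generateFrom_Iic ℝ)) isPiSystem_Iic ?_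
    (fun n => mem_range_self _) (fun n => (h₁ n).ne) ?_
  · refine eq_univ_of_forall fun x => ?_
    obtain ⟨n, hn⟩ := exists_nat_ge x
    exact mem_iUnion.2 ⟨n, hn⟩
  · rintro _ ⟨x, rfl⟩
    exact h x

theorem map_quantile : (volume.restrict (distrRange ρ)).map (quantile ρ) = ρ := by
  refine (ext_of_Iic_of_lt_top FiniteIic.lt_top fun x => ?_).symm
  rw [Measure.map_apply (measurable_quantile ρ) measurableSet_Iic,
    Measure.restrict_apply (measurable_quantile ρ measurableSet_Iic)]
  have : quantile ρ ⁻¹' Iic x ∩ distrRange ρ = distrRange ρ ∩ Iic (distr ρ x) := by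
    ext s
    simp only [mem_inter_iff, mem_preimage, mem_Iic]
    refine ⟨fun h => ⟨h.2, (quantile_le_iff ρ h.2).1 h.1⟩,
      fun h => ⟨(quantile_le_iff ρ h.1).2 h.2, h.1⟩⟩
  rw [this, distrRange_inter_Iic ρ (Or.inr ⟨x, le_rfl⟩), Real.volume_Ioc, sub_zero, ofReal_distr]

/-- Almost every `x` is a value of the quantile function, hence the least point at which the
distribution function reaches some `s`; to the left of `x` it is below `s`. Comparison with rational
points is enough. -/
theorem ae_distr_lt : ∀ᵐ x ∂ρ, ∀ y, y < x → distr ρ y < distr ρ x := by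
  have h : ∀ q : ℚ, ∀ᵐ x ∂ρ, (q : ℝ) < x → distr ρ q < distr ρ x := fun q => by
    have hm : MeasurableSet {x | (q : ℝ) < x → distr ρ q < distr ρ x} := by
      have : {x | (q : ℝ) < x → distr ρ q < distr ρ x} =
          (Ioi (q : ℝ))ᶜ ∪ (distr ρ) ⁻¹' (Ioi (distr ρ q)) := by
        ext x
        simp only [mem_ofPred_eq, mem_union, mem_compl_iff, mem_Ioi, mem_preimage]
        tauto
      rw [this]
      exact measurableSet_Ioi.compl.union ((distr_mono ρ).measurable measurableSet_Ioi)
    conv => enter [2]; rw [← map_quantile ρ]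
    rw [ae_map_iff (measurable_quantile ρ).aemeasurable hm]
    filter_upwards [ae_restrict_mem (measurableSet_distrRange ρ)] with s hs hq
    by_contra! hle
    have h1 := (quantile_le_iff ρ hs).1 le_rfl
    exact absurd ((quantile_le_iff ρ hs).2 (h1.trans hle)) (not_le.2 hq)
  filter_upwards [ae_all_iff.2 h] with x hx y hy
  obtain ⟨q, hq1, hq2⟩ := exists_rat_btwn hy
  exact (distr_mono ρ hq1.le).trans_lt (hx q hq2)

theorem measurable_distrSplit : Measurable (distrSplit ρ) := by
  have h1 := (distr_mono ρ).measurable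
  have h2 := (distrLeft_mono ρ).measurable
  unfold distrSplit
  fun_prop

theorem distrSplit_le_distr {x θ : ℝ} (h1 : θ < 1) : distrSplit ρ (x, θ) ≤ distr ρ x := by
  have := distrLeft_le_distr ρ x
  simp only [distrSplit]
  nlinarith

theorem distrLeft_le_distrSplit {x θ : ℝ} (h0 : 0 < θ) :
    distrLeft ρ x ≤ distrSplit ρ (x, θ) := by
  have := distrLeft_le_distr ρ x
  simp only [distrSplit]
  nlinarith

/-- At an atom the interpolated value strictly exceeds the left limit; elsewhere the strict increase
up to `x` takes over. -/
theorem lt_distrSplit {x θ : ℝ} (hx : ∀ y, y < x → distr ρ y < distr ρ x) (h0 : 0 < θ) {y : ℝ}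
    (hy : y < x) : distr ρ y < distrSplit ρ (x, θ) := by
  rcases (distrLeft_le_distr ρ x).eq_or_lt with h | h
  · simpa [distrSplit, h] using hx y hy
  · refine (distr_le_distrLeft ρ hy).trans_lt ?_
    simp only [distrSplit]
    nlinarith

theorem distrSplit_mem {x θ : ℝ} (hx : ∀ y, y < x → distr ρ y < distr ρ x) (h0 : 0 < θ)
    (h1 : θ < 1) : distrSplit ρ (x, θ) ∈ distrRange ρ :=
  ⟨(distr_nonneg ρ (x - 1)).trans_lt (lt_distrSplit ρ hx h0 (by linarith)),
    x, distrSplit_le_distr ρ h1⟩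

theorem quantile_distrSplit {x θ : ℝ} (hx : ∀ y, y < x → distr ρ y < distr ρ x) (h0 : 0 < θ)
    (h1 : θ < 1) : quantile ρ (distrSplit ρ (x, θ)) = x := by
  have hm := distrSplit_mem ρ hx h0 h1
  refine le_antisymm ((quantile_le_iff ρ hm).2 (distrSplit_le_distr ρ h1)) ?_
  by_contra! h
  exact absurd ((quantile_le_iff ρ hm).1 le_rfl) (not_le.2 (lt_distrSplit ρ hx h0 h))

theorem ae_prod_unit {p : ℝ → Prop} (h : ∀ᵐ x ∂ρ, p x) :
    ∀ᵐ z ∂(ρ.prod unitMeasure), p z.1 ∧ 0 < z.2 ∧ z.2 < 1 := by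
  have h1 : ∀ᵐ z ∂(ρ.prod unitMeasure), p z.1 :=
    Measure.quasiMeasurePreserving_fst.ae h
  have h2 : ∀ᵐ z ∂(ρ.prod unitMeasure), z.2 ∈ Ioo (0 : ℝ) 1 :=
    Measure.quasiMeasurePreserving_snd.ae (p := fun θ => θ ∈ Ioo (0 : ℝ) 1)
      (ae_restrict_mem measurableSet_Ioo)
  filter_upwards [h1, h2] with z h1 h2 using ⟨h1, h2.1, h2.2⟩

/-- With `q` the quantile of `s`, the preimage is, up to a null set, everything over points left of
`q` and a portion of the fibre over `q`. Their masses are `distrLeft ρ q` and `s - distrLeft ρ q`.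
-/
theorem measure_distrSplit_le {s : ℝ} (hs : s ∈ distrRange ρ) :
    (ρ.prod unitMeasure) (distrSplit ρ ⁻¹' Iic s) = ENNReal.ofReal s := by
  set q := quantile ρ s with hq
  have hsq : s ≤ distr ρ q := (quantile_le_iff ρ hs).1 le_rfl
  have hlt : ∀ y, y < q → distr ρ y < s := fun y hy => by
    by_contra! h
    exact absurd ((quantile_le_iff ρ hs).2 h) (not_le.2 hy)
  have hle : distrLeft ρ q ≤ s := by
    have ht := tendsto_measure_iUnion_atTop (μ := ρ)
      (s := fun n : ℕ => Iic (q - 1 / ((n : ℝ) + 1)))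
      (fun m n h => Iic_subset_Iic.2 (by gcongr))
    have e : ⋃ n : ℕ, Iic (q - 1 / ((n : ℝ) + 1)) = Iio q := by
      ext y
      simp only [mem_iUnion, mem_Iic, mem_Iio]
      refine ⟨fun ⟨n, hn⟩ => hn.trans_lt (by simp; positivity), fun hy => ?_⟩
      obtain ⟨n, hn⟩ := exists_nat_one_div_lt (sub_pos.2 hy)
      exact ⟨n, by linarith⟩
    rw [e] at ht
    have := le_of_tendsto' (b := ENNReal.ofReal s) ht fun n => by
      rw [Function.comp_apply, ← ofReal_distr]
      exact ENNReal.ofReal_le_ofReal (hlt _ (by simp; positivity)).le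
    rw [← ofReal_distrLeft] at this
    exact (ENNReal.ofReal_le_ofReal_iff hs.1.le).1 this
  set a := distr ρ q - distrLeft ρ q with ha
  have hE : distrSplit ρ ⁻¹' Iic s =ᵐ[ρ.prod unitMeasure]
      ((Iio q ×ˢ univ) ∪ ({q} ×ˢ {θ | θ * a ≤ s - distrLeft ρ q}) : Set (ℝ × ℝ)) := by
    rw [Filter.eventuallyEq_set]
    filter_upwards [ae_prod_unit ρ (ae_distr_lt ρ)] with ⟨x, θ⟩ ⟨hx, h0, h1⟩
    simp only at hx h0 h1
    simp only [mem_preimage, mem_Iic, mem_union, mem_prod, mem_Iio, mem_univ, and_true,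
      mem_singleton_iff, mem_ofPred_eq]
    rcases lt_trichotomy x q with h | h | h
    · simp only [h, true_or, iff_true]
      exact (distrSplit_le_distr ρ h1).trans (hlt x h).le
    · subst h
      simp only [lt_irrefl, false_or, true_and, distrSplit, ← ha]
      constructor <;> intro h <;> linarith
    · simp only [not_lt.2 h.le, h.ne', false_or, false_and, iff_false, not_le]
      exact hsq.trans_lt (lt_distrSplit ρ hx h0 h)
  have hm : MeasurableSet {θ : ℝ | θ * a ≤ s - distrLeft ρ q} :=
    measurableSet_le (by fun_prop) (by fun_prop)
  rw [measure_congr hE, measure_union _ ((measurableSet_singleton q).prod hm),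
    Measure.prod_prod, Measure.prod_prod, measure_univ, mul_one, measure_singleton_eq,
    ← ofReal_distrLeft, ← ha]
  · have ha0 : 0 ≤ a := sub_nonneg.2 (distrLeft_le_distr ρ q)
    have key : ENNReal.ofReal a * unitMeasure {θ | θ * a ≤ s - distrLeft ρ q} =
        ENNReal.ofReal (s - distrLeft ρ q) := by
      -- Without an atom at `q` the number `s` equals `distrLeft ρ q` and the fibre contributes
      -- nothing.
      rcases ha0.eq_or_lt with h | h
      · rw [← h, show s - distrLeft ρ q = 0 by linarith]
        simp
      · have h1 : (s - distrLeft ρ q) / a ≤ 1 := by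
          rw [div_le_one h]; linarith
        have h2 : 0 ≤ (s - distrLeft ρ q) / a := div_nonneg (by linarith) h.le
        have e : unitMeasure {θ | θ * a ≤ s - distrLeft ρ q} =
            ENNReal.ofReal ((s - distrLeft ρ q) / a) := by
          have e1 : {θ | θ * a ≤ s - distrLeft ρ q} = Iic ((s - distrLeft ρ q) / a) := by
            ext θ
            simp only [mem_ofPred_eq, mem_Iic, le_div_iff₀ h]
          rw [e1, unitMeasure, Measure.restrict_congr_set Ioo_ae_eq_Ioc,
            Measure.restrict_apply measurableSet_Iic, Iic_inter_Ioc_of_le h1, Real.volume_Ioc,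
            sub_zero]
        rw [e, ← ENNReal.ofReal_mul h.le]
        congr 1
        field_simp
    rw [key, ← ENNReal.ofReal_add (distrLeft_nonneg ρ q) (by linarith)]
    congr 1
    ring
  · rw [Set.disjoint_left]
    rintro ⟨x, θ⟩ h1 h2
    simp only [mem_prod, mem_Iio, mem_singleton_iff] at h1 h2
    exact absurd h1.1 (by simp [h2.1])

/-- Spreading each atom uniformly over its jump turns `ρ` into Lebesgue measure; this disintegrates
Lebesgue measure along the quantile function. -/
theorem map_distrSplit :
    (ρ.prod unitMeasure).map (distrSplit ρ) = volume.restrict (distrRange ρ) := by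
  have hfin : ∀ s, volume.restrict (distrRange ρ) (Iic s) ≤ ENNReal.ofReal s := fun s => by
    rw [Measure.restrict_apply measurableSet_Iic]
    refine (measure_mono (t := Ioc 0 s) fun r hr => ⟨hr.2.1, hr.1⟩).trans ?_
    simp
  refine (ext_of_Iic_of_lt_top (fun s => (hfin s).trans_lt ENNReal.ofReal_lt_top) fun s => ?_).symm
  rw [Measure.map_apply (measurable_distrSplit ρ) measurableSet_Iic]
  rcases le_or_gt s 0 with h0 | h0
  · have h1 : volume.restrict (distrRange ρ) (Iic s) = 0 :=
      le_antisymm ((hfin s).trans (by simp [h0])) (zero_le)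
    rw [h1]
    refine (measure_eq_zero_iff_ae_notMem.2 ?_).symm
    filter_upwards [ae_prod_unit ρ (ae_distr_lt ρ)] with ⟨x, θ⟩ ⟨hx, h2, h3⟩ h
    exact absurd ((distrSplit_mem ρ hx h2 h3).1.trans_le (h.trans h0)) (lt_irrefl _)
  · by_cases hs : s ∈ distrRange ρ
    · rw [measure_distrSplit_le ρ hs, Measure.restrict_apply measurableSet_Iic, inter_comm,
        distrRange_inter_Iic ρ (Or.inr hs.2), Real.volume_Ioc, sub_zero]
    -- Above the range of the distribution function both sides are the total mass of `ρ`.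
    · have hlt : ∀ x, distr ρ x < s := fun x => by
        by_contra! h
        exact hs ⟨h0, x, h⟩
      have h1 : (ρ.prod unitMeasure) (distrSplit ρ ⁻¹' Iic s) = (ρ.prod unitMeasure) univ := by
        refine measure_congr ?_
        rw [Filter.eventuallyEq_set]
        filter_upwards [ae_prod_unit ρ (ae_distr_lt ρ)] with ⟨x, θ⟩ ⟨hx, h2, h3⟩
        simpa using (distrSplit_le_distr ρ h3).trans (hlt x).le
      have h2 : ρ univ = volume.restrict (distrRange ρ) univ := by
        conv_lhs => rw [← map_quantile ρ]
        rw [Measure.map_apply (measurable_quantile ρ) MeasurableSet.univ, preimage_univ]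
      rw [h1, ← univ_prod_univ, Measure.prod_prod, measure_univ (μ := unitMeasure), mul_one, h2,
        Measure.restrict_apply measurableSet_Iic, Measure.restrict_apply_univ]
      congr 1
      ext r
      refine ⟨fun h => h.2, fun h => ⟨?_, h⟩⟩
      obtain ⟨x, hx⟩ := h.2
      exact hx.trans (hlt x).le

end distr

/-! ### Affine majorants and the concave hull. -/

/-- The coefficients `(α, β)` of the non-decreasing affine functions `α + β s`, `α ≥ 0`, that
dominate `∫_{(-∞, x]} u dρ` at `s = ρ (-∞, x]`. -/
def affineMajorants (ρ : Measure ℝ) (u : ℝ → ℝ≥0∞) : Set (ℝ × ℝ) :=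
  {p | 0 ≤ p.1 ∧ 0 ≤ p.2 ∧ ∀ x, ∫⁻ y in Iic x, u y ∂ρ ≤ ENNReal.ofReal (p.1 + p.2 * distr ρ x)}

/-- The infimum of the affine majorants. -/
noncomputable def hull (ρ : Measure ℝ) (u : ℝ → ℝ≥0∞) (t : ℝ) : ℝ :=
  sInf ((fun p : ℝ × ℝ => p.1 + p.2 * t) '' affineMajorants ρ u)

section hull

variable {ρ : Measure ℝ} {u : ℝ → ℝ≥0∞}

theorem hull_le {p : ℝ × ℝ} (hp : p ∈ affineMajorants ρ u) {t : ℝ} (ht : 0 ≤ t) :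
    hull ρ u t ≤ p.1 + p.2 * t := by
  refine csInf_le ⟨0, ?_⟩ (mem_image_of_mem _ hp)
  rintro _ ⟨q, hq, rfl⟩
  exact add_nonneg hq.1 (mul_nonneg hq.2.1 ht)

theorem le_hull (h : (affineMajorants ρ u).Nonempty) {t c : ℝ}
    (hc : ∀ p ∈ affineMajorants ρ u, c ≤ p.1 + p.2 * t) : c ≤ hull ρ u t := by
  refine le_csInf (h.image _) ?_
  rintro _ ⟨q, hq, rfl⟩
  exact hc q hq

theorem hull_nonneg (h : (affineMajorants ρ u).Nonempty) {t : ℝ} (ht : 0 ≤ t) :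
    0 ≤ hull ρ u t :=
  le_hull h fun _ hp => add_nonneg hp.1 (mul_nonneg hp.2.1 ht)

theorem hull_mono (h : (affineMajorants ρ u).Nonempty) {s t : ℝ} (hs : 0 ≤ s) (hst : s ≤ t) :
    hull ρ u s ≤ hull ρ u t :=
  le_hull h fun p hp => (hull_le hp hs).trans
    (by have := mul_le_mul_of_nonneg_left hst hp.2.1; linarith)

theorem convexOn_neg_hull (h : (affineMajorants ρ u).Nonempty) :
    ConvexOn ℝ (Ici 0) fun t => -hull ρ u t := by
  refine ⟨convex_Ici 0, fun s hs t ht a b ha hb hab => ?_⟩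
  simp only [smul_eq_mul]
  have : a * hull ρ u s + b * hull ρ u t ≤ hull ρ u (a * s + b * t) := by
    refine le_hull h fun p hp => ?_
    have h1 := mul_le_mul_of_nonneg_left (hull_le hp hs) ha
    have h2 := mul_le_mul_of_nonneg_left (hull_le hp ht) hb
    have h3 : p.1 * (a + b) = p.1 := by rw [hab, mul_one]
    nlinarith
  linarith

variable [FiniteIic ρ]

theorem setLIntegral_Iic_le_hull (h : (affineMajorants ρ u).Nonempty) (x : ℝ) :
    ∫⁻ y in Iic x, u y ∂ρ ≤ ENNReal.ofReal (hull ρ u (distr ρ x)) := by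
  obtain ⟨p, hp⟩ := h
  have hfin : ∫⁻ y in Iic x, u y ∂ρ ≠ ∞ :=
    ((hp.2.2 x).trans_lt ENNReal.ofReal_lt_top).ne
  rw [← ENNReal.ofReal_toReal hfin]
  refine ENNReal.ofReal_le_ofReal (le_hull ⟨p, hp⟩ fun q hq => ?_)
  exact ENNReal.toReal_le_of_le_ofReal
    (add_nonneg hq.1 (mul_nonneg hq.2.1 (distr_nonneg ρ x))) (hq.2.2 x)

theorem setLIntegral_Iic_eq_zero {x : ℝ} (hx : distr ρ x = 0) : ∫⁻ y in Iic x, u y ∂ρ = 0 :=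
  setLIntegral_measure_zero _ _ (by rw [← ofReal_distr, hx, ENNReal.ofReal_zero])

/-- By absolute continuity of the integral, half lines of measure at most some `s` contribute less
than `ε`. On larger ones the additional slope `p.1 / s` pays for the old constant term. This makes
the hull vanish continuously at zero. -/
theorem exists_affineMajorant_fst_le (h : (affineMajorants ρ u).Nonempty) {ε : ℝ} (hε : 0 < ε) :
    ∃ p ∈ affineMajorants ρ u, p.1 = ε := by
  obtain ⟨p, hp⟩ := h
  by_cases h0 : ∃ x, 0 < distr ρ x
  · obtain ⟨x₀, hx₀⟩ := h0
    have hfin : ∫⁻ y, u y ∂(ρ.restrict (Iic x₀)) ≠ ∞ :=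
      ((hp.2.2 x₀).trans_lt ENNReal.ofReal_lt_top).ne
    obtain ⟨δ, hδ, hb⟩ := exists_pos_setLIntegral_lt_of_measure_lt hfin
      (ENNReal.ofReal_pos.2 hε).ne'
    have hm : 0 < min δ (ρ (Iic x₀)) := lt_min hδ (by rw [← ofReal_distr]; simpa using hx₀)
    obtain ⟨s, hs, hs'⟩ := ENNReal.lt_iff_exists_real_btwn.1 hm
    have hs0 : 0 < s := ENNReal.ofReal_pos.1 hs'.1
    refine ⟨(ε, p.1 / s + p.2), ⟨hε.le, add_nonneg (div_nonneg hp.1 hs0.le) hp.2.1, fun x => ?_⟩,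
      rfl⟩
    have hd := distr_nonneg ρ x
    rcases le_or_gt (distr ρ x) s with hx | hx
    · have hlt : ρ (Iic x) < min δ (ρ (Iic x₀)) := by
        rw [← ofReal_distr]
        exact (ENNReal.ofReal_le_ofReal hx).trans_lt hs'.2
      have hxx : Iic x ⊆ Iic x₀ := by
        refine Iic_subset_Iic.2 (le_of_not_ge fun h => ?_)
        exact absurd (measure_mono (μ := ρ) (Iic_subset_Iic.2 h))
          (not_le.2 (hlt.trans_le (min_le_right _ _)))
      have := hb (Iic x) ((Measure.restrict_le_self _).trans_lt (hlt.trans_le (min_le_left _ _)))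
      rw [Measure.restrict_restrict measurableSet_Iic, inter_eq_left.2 hxx] at this
      refine this.le.trans (ENNReal.ofReal_le_ofReal ?_)
      have : 0 ≤ (p.1 / s + p.2) * distr ρ x :=
        mul_nonneg (add_nonneg (div_nonneg hp.1 hs0.le) hp.2.1) hd
      linarith
    · refine (hp.2.2 x).trans (ENNReal.ofReal_le_ofReal ?_)
      have : p.1 ≤ p.1 / s * distr ρ x := by
        rw [div_mul_eq_mul_div, le_div_iff₀ hs0]
        exact mul_le_mul_of_nonneg_left hx.le hp.1
      dsimp only
      linarith
  · push Not at h0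
    refine ⟨(ε, 0), ⟨hε.le, le_rfl, fun x => ?_⟩, rfl⟩
    rw [setLIntegral_Iic_eq_zero (le_antisymm (h0 x) (distr_nonneg ρ x))]
    exact zero_le

theorem hull_zero (h : (affineMajorants ρ u).Nonempty) : hull ρ u 0 = 0 := by
  refine le_antisymm (le_of_forall_pos_le_add fun ε hε => ?_) (hull_nonneg h le_rfl)
  obtain ⟨p, hp, rfl⟩ := exists_affineMajorant_fst_le h hε
  simpa using hull_le hp le_rfl

theorem exists_hull_lt (h : (affineMajorants ρ u).Nonempty) {ε : ℝ} (hε : 0 < ε) :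
    ∃ δ > 0, ∀ t, 0 ≤ t → t < δ → hull ρ u t < ε := by
  obtain ⟨p, hp, hp1⟩ := exists_affineMajorant_fst_le h (half_pos hε)
  refine ⟨ε / (2 * (p.2 + 1)), div_pos hε (by have := hp.2.1; positivity), fun t h0 ht => ?_⟩
  refine (hull_le hp h0).trans_lt ?_
  have h2 := hp.2.1
  rw [lt_div_iff₀ (by positivity)] at ht
  rw [hp1]
  nlinarith

/-- The right derivative of the hull. -/
noncomputable def hullDeriv (ρ : Measure ℝ) (u : ℝ → ℝ≥0∞) (t : ℝ) : ℝ :=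
  -derivWithin (fun t => -hull ρ u t) (Ioi t) t

theorem measurable_hullDeriv : Measurable (hullDeriv ρ u) :=
  (measurable_derivWithin_Ioi _).neg

theorem hasDerivWithinAt_hull (h : (affineMajorants ρ u).Nonempty) {t : ℝ} (ht : 0 < t) :
    HasDerivWithinAt (hull ρ u) (hullDeriv ρ u t) (Ioi t) t := by
  have := ((convexOn_neg_hull h).hasDerivWithinAt_rightDeriv_of_mem_interior
    (x := t) (by simpa using ht)).neg
  rw [show (-fun t => -hull ρ u t) = hull ρ u by ext; simp] at this
  exact this

theorem hullDeriv_nonneg (h : (affineMajorants ρ u).Nonempty) {t : ℝ} (ht : 0 < t) :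
    0 ≤ hullDeriv ρ u t := by
  have h1 := (convexOn_neg_hull h).rightDeriv_le_slope_of_mem_interior (x := t) (y := t + 1)
    (by simpa using ht) (by simp; linarith) (by linarith)
  have h2 := hull_mono h ht.le (by linarith : t ≤ t + 1)
  rw [slope_def_field] at h1
  simp only [add_sub_cancel_left, div_one] at h1
  simp only [hullDeriv]
  linarith

/-- The hull is concave and zero at zero, so its right derivative is at most the slope of the chord
from zero. -/
theorem hullDeriv_mul_le (h : (affineMajorants ρ u).Nonempty) {t : ℝ} (ht : 0 < t) :
    hullDeriv ρ u t * t ≤ hull ρ u t := by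
  have hi : t ∈ interior (Ici (0 : ℝ)) := by simpa using ht
  have h1 := ((convexOn_neg_hull h).slope_le_leftDeriv_of_mem_interior (x := 0) (y := t)
    (by simp) hi ht).trans ((convexOn_neg_hull h).leftDeriv_le_rightDeriv_of_mem_interior hi)
  rw [slope_def_field, hull_zero h, sub_zero, neg_zero, sub_zero, div_le_iff₀ ht] at h1
  simp only [hullDeriv]
  linarith

theorem antitoneOn_hullDeriv (h : (affineMajorants ρ u).Nonempty) :
    AntitoneOn (hullDeriv ρ u) (Ioi 0) := by
  have := (convexOn_neg_hull h).monotoneOn_rightDeriv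
  rw [interior_Ici] at this
  exact fun s hs t ht hst => neg_le_neg (this hs ht hst)

theorem setLIntegral_hullDeriv_Ioc (h : (affineMajorants ρ u).Nonempty) {a t : ℝ} (ha : 0 < a)
    (hat : a ≤ t) : ∫⁻ s in Ioc a t, ENNReal.ofReal (hullDeriv ρ u s) =
      ENNReal.ofReal (hull ρ u t - hull ρ u a) := by
  have hintegrable : IntervalIntegrable (hullDeriv ρ u) volume a t := by
    refine AntitoneOn.intervalIntegrable ((antitoneOn_hullDeriv h).mono ?_)
    rw [uIcc_of_le hat]
    exact fun s hs => ha.trans_le hs.1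
  have hcont : ContinuousOn (hull ρ u) (Icc a t) := by
    have := (convexOn_neg_hull h).continuousOn_interior.neg
    rw [interior_Ici] at this
    refine ContinuousOn.mono (s := Ioi 0) ?_ fun s hs => ha.trans_le hs.1
    exact this.congr fun x _ => by simp
  rw [← intervalIntegral.integral_eq_sub_of_hasDeriv_right_of_le hat hcont
    (fun s hs => hasDerivWithinAt_hull h (ha.trans hs.1)) hintegrable,
    intervalIntegral.integral_of_le hat,
    ofReal_integral_eq_lintegral_ofReal ((intervalIntegrable_iff_integrableOn_Ioc_of_le hat).1 hintegrable)]
  filter_upwards [ae_restrict_mem measurableSet_Ioc] with s hs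
  exact hullDeriv_nonneg h (ha.trans hs.1)

/-- The fundamental theorem of calculus is available on `(a, t]` for `a > 0`; continuity of the hull
at zero allows `a → 0`. -/
theorem setLIntegral_hullDeriv (h : (affineMajorants ρ u).Nonempty) {t : ℝ} (ht : 0 ≤ t) :
    ∫⁻ s in Ioc 0 t, ENNReal.ofReal (hullDeriv ρ u s) = ENNReal.ofReal (hull ρ u t) := by
  rcases ht.eq_or_lt with rfl | ht
  · simp [hull_zero h]
  have hmono : Monotone fun n : ℕ => Ioc (t / ((n : ℝ) + 1)) t := fun m n hmn =>
    Ioc_subset_Ioc_left (by gcongr)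
  have hU : ⋃ n : ℕ, Ioc (t / ((n : ℝ) + 1)) t = Ioc 0 t := by
    ext s
    simp only [mem_iUnion, mem_Ioc]
    refine ⟨fun ⟨n, h1, h2⟩ => ⟨lt_trans (by positivity) h1, h2⟩, fun hs => ?_⟩
    obtain ⟨n, hn⟩ := exists_nat_gt (t / s)
    refine ⟨n, ?_, hs.2⟩
    rw [div_lt_iff₀ hs.1] at hn
    rw [div_lt_iff₀ (by positivity)]
    nlinarith [hs.1]
  have h1 := tendsto_measure_iUnion_atTop
    (μ := volume.withDensity fun s => ENNReal.ofReal (hullDeriv ρ u s)) hmono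
  rw [hU, withDensity_apply _ measurableSet_Ioc] at h1
  refine tendsto_nhds_unique h1 ?_
  have h2 : ∀ n : ℕ, ((volume.withDensity fun s => ENNReal.ofReal (hullDeriv ρ u s)) ∘
      fun n : ℕ => Ioc (t / ((n : ℝ) + 1)) t) n =
      ENNReal.ofReal (hull ρ u t - hull ρ u (t / ((n : ℝ) + 1))) := fun n => by
    rw [Function.comp_apply, withDensity_apply _ measurableSet_Ioc,
      setLIntegral_hullDeriv_Ioc h (by positivity) (div_le_self ht.le (by simp))]
  rw [funext h2]
  refine ENNReal.tendsto_ofReal ?_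
  have h3 : Filter.Tendsto (fun n : ℕ => hull ρ u (t / ((n : ℝ) + 1))) Filter.atTop
      (nhds 0) := by
    rw [Metric.tendsto_atTop]
    intro ε hε
    obtain ⟨δ, hδ, hb⟩ := exists_hull_lt h hε
    obtain ⟨N, hN⟩ := exists_nat_gt (t / δ)
    refine ⟨N, fun n hn => ?_⟩
    have hp : 0 ≤ t / ((n : ℝ) + 1) := by positivity
    rw [Real.dist_eq, sub_zero, abs_of_nonneg (hull_nonneg h hp)]
    refine hb _ hp ?_
    rw [div_lt_iff₀ hδ] at hN
    rw [div_lt_iff₀ (by positivity)]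
    have : (N : ℝ) ≤ n := by exact_mod_cast hn
    nlinarith
  simpa using h3.const_sub (hull ρ u t)

end hull

/-! ### The level function and its supremum norm. -/

section level

variable {ρ : Measure ℝ} [FiniteIic ρ] {u : ℝ → ℝ≥0∞}

theorem measurable_lintegral_distrSplit {H : ℝ → ℝ≥0∞} (hH : Measurable H) :
    Measurable fun x => ∫⁻ θ, H (distrSplit ρ (x, θ)) ∂unitMeasure :=
  Measurable.lintegral_prod_right' (f := fun z => H (distrSplit ρ z))
    (hH.comp (measurable_distrSplit ρ))

theorem distrRange_inter_quantile_Iic (x : ℝ) :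
    distrRange ρ ∩ quantile ρ ⁻¹' Iic x = Ioc 0 (distr ρ x) := by
  rw [← distrRange_inter_Iic ρ (Or.inr ⟨x, le_rfl⟩)]
  ext s
  simp only [mem_inter_iff, mem_preimage, mem_Iic]
  exact and_congr_right fun h => quantile_le_iff ρ h

/-- A weight depending on `x` alone is constant along fibres, so after the substitution `s =
distrSplit ρ (x, θ)` it is read off at `quantile ρ s`. -/
theorem lintegral_mul_lintegral_distrSplit {w H : ℝ → ℝ≥0∞} (hw : Measurable w)
    (hH : Measurable H) :
    ∫⁻ x, w x * ∫⁻ θ, H (distrSplit ρ (x, θ)) ∂unitMeasure ∂ρ =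
      ∫⁻ s in distrRange ρ, w (quantile ρ s) * H s := by
  have h1 : ∀ x, w x * ∫⁻ θ, H (distrSplit ρ (x, θ)) ∂unitMeasure =
      ∫⁻ θ, w x * H (distrSplit ρ (x, θ)) ∂unitMeasure := fun x =>
    (lintegral_const_mul _ (hH.comp ((measurable_distrSplit ρ).comp measurable_prodMk_left))).symm
  simp_rw [h1]
  rw [← lintegral_prod (fun z : ℝ × ℝ => w z.1 * H (distrSplit ρ z))
    ((hw.comp measurable_fst).mul (hH.comp (measurable_distrSplit ρ))).aemeasurable,
    ← map_distrSplit ρ, lintegral_map (f := fun s => w (quantile ρ s) * H s)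
      ((hw.comp (measurable_quantile ρ)).mul hH) (measurable_distrSplit ρ)]
  refine lintegral_congr_ae ?_
  filter_upwards [ae_prod_unit ρ (ae_distr_lt ρ)] with ⟨x, θ⟩ ⟨hx, h0, h1⟩
  rw [quantile_distrSplit ρ hx h0 h1]

theorem setLIntegral_lintegral_distrSplit {H : ℝ → ℝ≥0∞} (hH : Measurable H) (x : ℝ) :
    ∫⁻ y in Iic x, ∫⁻ θ, H (distrSplit ρ (y, θ)) ∂unitMeasure ∂ρ =
      ∫⁻ s in Ioc 0 (distr ρ x), H s := by
  have h := lintegral_mul_lintegral_distrSplit (ρ := ρ)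
    (w := (Iic x).indicator fun _ => 1) (measurable_const.indicator measurableSet_Iic) hH
  rw [← distrRange_inter_quantile_Iic (ρ := ρ) x, inter_comm, ← Measure.restrict_restrict
    (measurable_quantile ρ measurableSet_Iic), ← lintegral_indicator
    (measurable_quantile ρ measurableSet_Iic), ← lintegral_indicator measurableSet_Iic]
  refine Eq.trans (lintegral_congr fun y => ?_) (h.trans (lintegral_congr fun y => ?_))
  · by_cases hy : y ∈ Iic x
    · rw [indicator_of_mem hy, indicator_of_mem hy, one_mul]
    · rw [indicator_of_notMem hy, indicator_of_notMem hy, zero_mul]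
  · by_cases hy : quantile ρ y ∈ Iic x
    · rw [indicator_of_mem hy, indicator_of_mem (show y ∈ quantile ρ ⁻¹' Iic x from hy), one_mul]
    · rw [indicator_of_notMem hy, indicator_of_notMem (show y ∉ quantile ρ ⁻¹' Iic x from hy),
        zero_mul]

/-- Majorants are tested on open half lines only. Concavity bounds the increase of `G` to the right
of `x` by that of the distribution function, which is right continuous, so `G x` also dominates the
integral over the closed half line. -/
theorem setLIntegral_Iic_le_of_concaveMajorant {G : ℝ → ℝ} (hG : G ∈ concaveMajorants ρ u)
    (x : ℝ) : ∫⁻ y in Iic x, u y ∂ρ ≤ ENNReal.ofReal (G x) := by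
  by_cases h0 : distr ρ x = 0
  · rw [setLIntegral_Iic_eq_zero h0]
    exact zero_le
  obtain ⟨a, ha⟩ := exists_distr_lt ρ (lt_of_le_of_ne (distr_nonneg ρ x) (Ne.symm h0))
  have hax : a ≤ x := by
    by_contra! h
    exact absurd (distr_mono ρ h.le) (not_le.2 ha)
  have hy : ∀ y, x < y → ∫⁻ y in Iic x, u y ∂ρ ≤ ENNReal.ofReal (G y) := fun y hy =>
    (lintegral_mono_set (Iic_subset_Iio.2 hy)).trans (hG.2 y)
  have hfin : ∫⁻ y in Iic x, u y ∂ρ ≠ ∞ :=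
    ((hy (x + 1) (by linarith)).trans_lt ENNReal.ofReal_lt_top).ne
  rw [← ENNReal.ofReal_toReal hfin]
  refine ENNReal.ofReal_le_ofReal (le_of_forall_pos_le_add fun ε hε => ?_)
  set d := distr ρ x - distr ρ a with hd
  have hd0 : 0 < d := sub_pos.2 ha
  set D := |G x - G a| + 1 with hD
  have hD0 : 0 < D := by positivity
  obtain ⟨y, hxy, hy2⟩ : ∃ y, x < y ∧ distr ρ y < distr ρ x + ε * d / D := by
    by_contra! h
    have := le_distr_of_forall_gt ρ h
    have h2 : 0 < ε * d / D := by positivity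
    linarith
  have h1 := ENNReal.toReal_le_of_le_ofReal (hG.1.nonneg y) (hy y hxy)
  have h2 := hG.1.concave a x y hax hxy.le
  change (G y - G x) * d ≤ (distr ρ y - distr ρ x) * (G x - G a) at h2
  have h3 : (distr ρ y - distr ρ x) * (G x - G a) ≤ (ε * d / D) * D := by
    have h4 := distr_mono ρ hxy.le
    have h5 : G x - G a ≤ D := (le_abs_self _).trans (by simp [hD])
    calc _ ≤ (distr ρ y - distr ρ x) * D := mul_le_mul_of_nonneg_left h5 (by linarith)
      _ ≤ _ := mul_le_mul_of_nonneg_right (by linarith) hD0.le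
  rw [div_mul_cancel₀ _ hD0.ne'] at h3
  have : G y - G x ≤ ε := le_of_mul_le_mul_right (h2.trans h3) hd0
  linarith

/-- A supporting line at `x`, in the variable `distr ρ`. Its slope is the supremum of zero and the
slopes of `G` to the right of `x`. By concavity the slopes to the left are no smaller; they are
formed with the integral `F ≤ G`, whose monotonicity compares them with zero too. -/
theorem exists_affineMajorant_eq {G : ℝ → ℝ} (hG : G ∈ concaveMajorants ρ u) {x : ℝ}
    (hx : 0 < distr ρ x) : ∃ p ∈ affineMajorants ρ u, p.1 + p.2 * distr ρ x = G x := by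
  have hF := setLIntegral_Iic_le_of_concaveMajorant hG
  have hfin : ∀ y, ∫⁻ z in Iic y, u z ∂ρ ≠ ∞ := fun y =>
    ((hF y).trans_lt ENNReal.ofReal_lt_top).ne
  set F : ℝ → ℝ := fun y => (∫⁻ z in Iic y, u z ∂ρ).toReal with hFdef
  have hFG : ∀ y, F y ≤ G y := fun y => ENNReal.toReal_le_of_le_ofReal (hG.1.nonneg y) (hF y)
  have hFm : Monotone F := fun y z h =>
    ENNReal.toReal_mono (hfin z) (lintegral_mono_set (Iic_subset_Iic.2 h))
  have hF0 : ∀ y, 0 ≤ F y := fun y => ENNReal.toReal_nonneg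
  have hlt : ∀ {y z}, distr ρ y < distr ρ z → y < z := fun {y z} h => by
    by_contra! h'
    exact absurd (distr_mono ρ h') (not_le.2 h)
  set B : Set ℝ := insert 0 ((fun b => (G b - G x) / (distr ρ b - distr ρ x)) ''
    {b | distr ρ x < distr ρ b}) with hB
  have hub : ∀ a, distr ρ a < distr ρ x → ∀ σ ∈ B,
      σ ≤ (G x - F a) / (distr ρ x - distr ρ a) := by
    intro a ha σ hσ
    have hd := sub_pos.2 ha
    rcases hσ with rfl | ⟨b, hb, rfl⟩
    · exact div_nonneg (sub_nonneg.2 ((hFm (hlt ha).le).trans (hFG x))) hd.le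
    · have hd' : 0 < distr ρ b - distr ρ x := sub_pos.2 hb
      rw [div_le_div_iff₀ hd' hd]
      have := hG.1.concave a x b (hlt ha).le (hlt hb).le
      change (G b - G x) * (distr ρ x - distr ρ a) ≤ (distr ρ b - distr ρ x) * (G x - G a) at this
      refine this.trans ?_
      rw [mul_comm]
      exact mul_le_mul_of_nonneg_right (by linarith [hFG a]) hd'.le
  obtain ⟨a₀, ha₀⟩ := exists_distr_lt ρ hx
  have hbdd : BddAbove B := ⟨_, hub a₀ ha₀⟩
  set β := sSup B with hβ
  have hβ0 : 0 ≤ β := le_csSup hbdd (mem_insert _ _)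
  have hleft : ∀ a, distr ρ a < distr ρ x → F a + β * (distr ρ x - distr ρ a) ≤ G x :=
    fun a ha => by
      have := csSup_le ⟨0, mem_insert _ _⟩ (hub a ha)
      rw [le_div_iff₀ (sub_pos.2 ha)] at this
      linarith
  refine ⟨(G x - β * distr ρ x, β), ⟨?_, hβ0, fun y => ?_⟩, by ring⟩
  -- Letting `distr ρ a` tend to zero in `hleft` shows that the line is non-negative at zero.
  · refine sub_nonneg.2 (le_of_forall_pos_le_add fun ε hε => ?_)
    obtain ⟨a, ha⟩ := exists_distr_lt ρ
      (lt_min hx (show 0 < ε / (β + 1) by positivity))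
    have h1 := hleft a (ha.trans_le (min_le_left _ _))
    have h2 := ha.trans_le (min_le_right _ _)
    rw [lt_div_iff₀ (by positivity)] at h2
    have := hF0 a
    have := distr_nonneg ρ a
    nlinarith
  · rw [← ENNReal.ofReal_toReal (hfin y)]
    refine ENNReal.ofReal_le_ofReal ?_
    change F y ≤ G x - β * distr ρ x + β * distr ρ y
    rcases lt_trichotomy (distr ρ y) (distr ρ x) with h | h | h
    · linarith [hleft y h]
    -- Where the distribution function takes equal values, the half lines differ by a null set.
    · have e : F y ≤ F x := by
        rcases le_total y x with h' | h'
        · exact hFm h'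
        · refine le_of_eq ?_
          simp only [hFdef]
          congr 1
          refine setLIntegral_congr ?_
          refine (ae_eq_of_subset_of_measure_ge (Iic_subset_Iic.2 h') ?_
            measurableSet_Iic.nullMeasurableSet (FiniteIic.lt_top y).ne).symm
          rw [← ofReal_distr, ← ofReal_distr, h]
      rw [h]
      linarith [hFG x]
    · have h1 : (G y - G x) / (distr ρ y - distr ρ x) ≤ β :=
        le_csSup hbdd (mem_insert_of_mem _ ⟨y, h, rfl⟩)
      rw [div_le_iff₀ (sub_pos.2 h)] at h1
      linarith [hFG y]

theorem isConcaveWrt_hull (h : (affineMajorants ρ u).Nonempty) :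
    IsConcaveWrt ρ fun x => hull ρ u (distr ρ x) where
  nonneg x := hull_nonneg h (distr_nonneg ρ x)
  aemeasurable := by
    have : Monotone fun x => hull ρ u (distr ρ x) := fun x y hxy =>
      hull_mono h (distr_nonneg ρ x) (distr_mono ρ hxy)
    exact this.measurable.aemeasurable
  concave a x b hax hxb := by
    change _ * (distr ρ x - distr ρ a) ≤ (distr ρ b - distr ρ x) * _
    rcases (distr_mono ρ (hax.trans hxb)).eq_or_lt with he | hlt
    · have h1 : distr ρ a = distr ρ x := le_antisymm (distr_mono ρ hax)
        (he ▸ distr_mono ρ hxb)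
      have h2 : distr ρ b = distr ρ x := he ▸ h1
      simp [h1, h2]
    · have hd := sub_pos.2 hlt
      have := (convexOn_neg_hull h).2 (distr_nonneg ρ a) (distr_nonneg ρ b)
        (div_nonneg (sub_nonneg.2 (distr_mono ρ hxb)) hd.le)
        (div_nonneg (sub_nonneg.2 (distr_mono ρ hax)) hd.le)
        (show (distr ρ b - distr ρ x) / (distr ρ b - distr ρ a) +
          (distr ρ x - distr ρ a) / (distr ρ b - distr ρ a) = 1 by field_simp; ring)
      simp only [smul_eq_mul] at this
      rw [show (distr ρ b - distr ρ x) / (distr ρ b - distr ρ a) * distr ρ a +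
        (distr ρ x - distr ρ a) / (distr ρ b - distr ρ a) * distr ρ b = distr ρ x by
          field_simp; ring] at this
      have h3 := mul_le_mul_of_nonneg_left this hd.le
      have e : (distr ρ b - distr ρ a) *
          ((distr ρ b - distr ρ x) / (distr ρ b - distr ρ a) * -hull ρ u (distr ρ a) +
          (distr ρ x - distr ρ a) / (distr ρ b - distr ρ a) * -hull ρ u (distr ρ b)) =
          -((distr ρ b - distr ρ x) * hull ρ u (distr ρ a) +
            (distr ρ x - distr ρ a) * hull ρ u (distr ρ b)) := by
        field_simp
        ring
      rw [e] at h3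
      nlinarith

/-- The density, with respect to `ρ`, of the hull. -/
noncomputable def hullDensity (ρ : Measure ℝ) (u : ℝ → ℝ≥0∞) (x : ℝ) : ℝ≥0∞ :=
  ∫⁻ θ, ENNReal.ofReal (hullDeriv ρ u (distrSplit ρ (x, θ))) ∂unitMeasure

theorem measurable_hullDensity : Measurable (hullDensity ρ u) :=
  measurable_lintegral_distrSplit measurable_hullDeriv.ennreal_ofReal

theorem setLIntegral_hullDensity (h : (affineMajorants ρ u).Nonempty) (x : ℝ) :
    ∫⁻ y in Iic x, hullDensity ρ u y ∂ρ = ENNReal.ofReal (hull ρ u (distr ρ x)) := by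
  simp only [hullDensity]
  rw [setLIntegral_lintegral_distrSplit measurable_hullDeriv.ennreal_ofReal,
    setLIntegral_hullDeriv h (distr_nonneg ρ x)]

theorem isLeast_hull (h : (affineMajorants ρ u).Nonempty) :
    IsLeast (concaveMajorants ρ u) fun x => hull ρ u (distr ρ x) := by
  refine ⟨⟨isConcaveWrt_hull h, fun x => (lintegral_mono_set Iio_subset_Iic_self).trans
    (setLIntegral_Iic_le_hull h x)⟩, fun G hG x => ?_⟩
  rcases (distr_nonneg ρ x).eq_or_lt with h0 | h0
  · simp only [← h0, hull_zero h]
    exact hG.1.nonneg x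
  · obtain ⟨p, hp, he⟩ := exists_affineMajorant_eq hG h0
    exact (hull_le hp h0.le).trans he.le

theorem isLevelOf_hullDensity (h : (affineMajorants ρ u).Nonempty) :
    IsLevelOf ρ u (hullDensity ρ u) :=
  ⟨measurable_hullDensity, _, isLeast_hull h, setLIntegral_hullDensity h⟩

theorem concaveMajorants_nonempty_iff :
    (concaveMajorants ρ u).Nonempty ↔ (affineMajorants ρ u).Nonempty := by
  refine ⟨fun ⟨G, hG⟩ => ?_, fun h => ⟨_, (isLeast_hull h).1⟩⟩
  by_cases h0 : ∃ x, 0 < distr ρ x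
  · obtain ⟨x, hx⟩ := h0
    obtain ⟨p, hp, -⟩ := exists_affineMajorant_eq hG hx
    exact ⟨p, hp⟩
  · push Not at h0
    refine ⟨(0, 0), le_rfl, le_rfl, fun x => ?_⟩
    rw [setLIntegral_Iic_eq_zero (le_antisymm (h0 x) (distr_nonneg ρ x))]
    exact zero_le

/-- Densities with the same finite distribution function agree almost everywhere, so the choice made
in `levelAux` is immaterial and `hullDensity` computes it. -/
theorem IsLevelOf.ae_eq {g g' : ℝ → ℝ≥0∞} (h : IsLevelOf ρ u g) (h' : IsLevelOf ρ u g') :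
    g =ᵐ[ρ] g' := by
  obtain ⟨hg, G, hG, hi⟩ := h
  obtain ⟨hg', G', hG', hi'⟩ := h'
  rw [← withDensity_eq_iff_of_sigmaFinite hg.aemeasurable hg'.aemeasurable]
  refine ext_of_Iic_of_lt_top (fun x => ?_) fun x => ?_
  · rw [withDensity_apply _ measurableSet_Iic, hi]
    exact ENNReal.ofReal_lt_top
  · rw [withDensity_apply _ measurableSet_Iic, withDensity_apply _ measurableSet_Iic, hi, hi',
      hG.unique hG']

theorem levelAux_ae_eq (h : (affineMajorants ρ u).Nonempty) :
    levelAux ρ u =ᵐ[ρ] hullDensity ρ u := by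
  have he : ∃ g, IsLevelOf ρ u g := ⟨_, isLevelOf_hullDensity h⟩
  rw [levelAux, dif_pos he]
  exact he.choose_spec.ae_eq (isLevelOf_hullDensity h)

theorem setLIntegral_levelAux (h : (affineMajorants ρ u).Nonempty) (x : ℝ) :
    ∫⁻ y in Iic x, levelAux ρ u y ∂ρ = ENNReal.ofReal (hull ρ u (distr ρ x)) := by
  rw [← setLIntegral_hullDensity h]
  exact lintegral_congr_ae (ae_restrict_of_ae (levelAux_ae_eq h))

/-- The line of slope `C` through the origin is a majorant, so the hull lies below it; the right
derivative, being at most the chord slope from zero, is then at most `C`. -/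
theorem hullDensity_ae_le (h : (affineMajorants ρ u).Nonempty) {C : ℝ} (hC : 0 ≤ C)
    (hu : ∀ x, ∫⁻ y in Iic x, u y ∂ρ ≤ ENNReal.ofReal (C * distr ρ x)) :
    ∀ᵐ x ∂ρ, hullDensity ρ u x ≤ ENNReal.ofReal C := by
  have hp : ((0, C) : ℝ × ℝ) ∈ affineMajorants ρ u := ⟨le_rfl, hC, by simpa using hu⟩
  filter_upwards [ae_distr_lt ρ] with x hx
  calc hullDensity ρ u x ≤ ∫⁻ _θ, ENNReal.ofReal C ∂unitMeasure := by
        refine lintegral_mono_ae ?_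
        filter_upwards [show ∀ᵐ θ ∂unitMeasure, θ ∈ Ioo (0 : ℝ) 1 from
          ae_restrict_mem measurableSet_Ioo] with θ hθ
        have hs := (distrSplit_mem ρ hx hθ.1 hθ.2).1
        refine ENNReal.ofReal_le_ofReal ?_
        have h1 := (hullDeriv_mul_le h hs).trans (hull_le hp hs.le)
        simp only [zero_add] at h1
        exact le_of_mul_le_mul_right h1 hs
    _ = ENNReal.ofReal C := by simp

theorem affineMajorants_nonempty_of_le {C : ℝ≥0∞} (hC : C ≠ ∞)
    (hu : ∀ x, ∫⁻ y in Iic x, u y ∂ρ ≤ C * ρ (Iic x)) : (affineMajorants ρ u).Nonempty := by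
  refine ⟨(0, C.toReal), le_rfl, ENNReal.toReal_nonneg, fun x => (hu x).trans (le_of_eq ?_)⟩
  rw [zero_add, ENNReal.ofReal_mul ENNReal.toReal_nonneg, ENNReal.ofReal_toReal hC, ofReal_distr]

theorem setLIntegral_le_of_levelAux_le (h : (affineMajorants ρ u).Nonempty) {C : ℝ≥0∞}
    (hC : ∀ᵐ x ∂ρ, levelAux ρ u x ≤ C) (x : ℝ) :
    ∫⁻ y in Iic x, u y ∂ρ ≤ C * ρ (Iic x) := by
  refine (setLIntegral_Iic_le_hull h x).trans ?_
  rw [← setLIntegral_levelAux h, ← setLIntegral_const]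
  exact lintegral_mono_ae (ae_restrict_of_ae hC)

/-- This turns the norm of `(L^∞)ᵒ` into bounds for integrals over half lines. A bound for the level
function bounds its primitive and therefore that of `|f|`; in the absence of a concave majorant the
truncations of `|f|` are treated instead, followed by monotone convergence. Conversely, the integral
bounds say that a line of slope `C` through the origin is a majorant. -/
theorem level_norm_le_iff {f : ℝ → ℝ} (hf : AEMeasurable f ρ) {C : ℝ≥0∞} :
    eLpNorm (level ρ f) ∞ ρ ≤ C ↔ ∀ x, ∫⁻ y in Iic x, ‖f y‖ₑ ∂ρ ≤ C * ρ (Iic x) := by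
  rcases eq_or_ne C ∞ with rfl | hC
  · refine iff_of_true le_top fun x => ?_
    rcases eq_or_ne (ρ (Iic x)) 0 with h0 | h0
    · rw [setLIntegral_measure_zero _ _ h0]
      exact zero_le
    · rw [ENNReal.top_mul h0]
      exact le_top
  have hess : essSup (fun x => ‖level ρ f x‖ₑ) ρ ≤ C ↔ ∀ᵐ x ∂ρ, ‖level ρ f x‖ₑ ≤ C :=
    ⟨fun h => (ae_le_essSup (f := fun x => ‖level ρ f x‖ₑ)).mono fun x hx => hx.trans h,
      fun h => essSup_le_of_ae_le _ h⟩
  rw [eLpNorm_exponent_top, eLpNormEssSup, hess]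
  simp only [enorm_eq_self]
  constructor
  · intro h x
    by_cases hn : (concaveMajorants ρ fun y => ‖f y‖ₑ).Nonempty
    · rw [level, if_pos hn] at h
      exact setLIntegral_le_of_levelAux_le (concaveMajorants_nonempty_iff.1 hn) h x
    · rw [level, if_neg hn] at h
      have hk : ∀ k : ℕ, ∫⁻ y in Iic x, min ‖f y‖ₑ k ∂ρ ≤ C * ρ (Iic x) := fun k => by
        refine setLIntegral_le_of_levelAux_le ?_ ?_ x
        · refine affineMajorants_nonempty_of_le (ENNReal.natCast_ne_top k) fun x => ?_
          rw [← setLIntegral_const]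
          exact lintegral_mono fun y => min_le_right _ _
        · filter_upwards [h] with y hy
          exact (le_iSup (fun k : ℕ => levelAux ρ (fun y => min ‖f y‖ₑ k) y) k).trans hy
      have hs : ∀ y, ‖f y‖ₑ = ⨆ k : ℕ, min ‖f y‖ₑ k := fun y => by
        rw [← inf_iSup_eq, ENNReal.iSup_natCast, inf_top_eq]
      rw [lintegral_congr hs]
      rw [lintegral_iSup' (fun k => (hf.restrict.enorm.min aemeasurable_const))]
      · exact iSup_le hk
      · refine Filter.Eventually.of_forall fun y k l hkl => ?_
        exact min_le_min le_rfl (by exact_mod_cast hkl)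
  · intro h
    have ha := affineMajorants_nonempty_of_le hC h
    rw [level, if_pos (concaveMajorants_nonempty_iff.2 ha)]
    have := hullDensity_ae_le ha (C := C.toReal) ENNReal.toReal_nonneg fun x => by
      rw [ENNReal.ofReal_mul ENNReal.toReal_nonneg, ENNReal.ofReal_toReal hC, ofReal_distr]
      exact h x
    filter_upwards [this, levelAux_ae_eq ha] with x h1 h2
    rw [h2]
    exact h1.trans ENNReal.ofReal_toReal_le

end level


section level

variable {ρ : Measure ℝ} [FiniteIic ρ]

theorem coupleLevel_norm₁_le_iff {f : ℝ →ₘ[ρ] ℝ} {C : ℝ≥0∞} :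
    (coupleLevel ρ).norm₁ f ≤ C ↔ ∀ x, ∫⁻ y in Iic x, ‖f y‖ₑ ∂ρ ≤ C * ρ (Iic x) :=
  level_norm_le_iff f.aemeasurable

theorem setLIntegral_le_coupleLevel_norm₁ (f : ℝ →ₘ[ρ] ℝ) (x : ℝ) :
    ∫⁻ y in Iic x, ‖f y‖ₑ ∂ρ ≤ (coupleLevel ρ).norm₁ f * ρ (Iic x) :=
  coupleLevel_norm₁_le_iff.1 le_rfl x

theorem isSeminorm_coupleLevel (ρ : Measure ℝ) [FiniteIic ρ] : (coupleLevel ρ).IsSeminorm where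
  add₀ := eLpNorm_coeFn_add_le le_rfl
  smul₀ c f := eLpNorm_coeFn_smul_le (p := 1) c f
  add₁ f g := by
    refine coupleLevel_norm₁_le_iff.2 fun x => ?_
    rw [add_mul]
    refine le_trans ?_ (add_le_add (setLIntegral_le_coupleLevel_norm₁ f x)
      (setLIntegral_le_coupleLevel_norm₁ g x))
    rw [← lintegral_add_left f.measurable.enorm]
    refine lintegral_mono_ae (ae_restrict_of_ae ?_)
    filter_upwards [AEEqFun.coeFn_add f g] with y hy
    rw [hy]
    exact enorm_add_le _ _
  smul₁ c f := by
    refine coupleLevel_norm₁_le_iff.2 fun x => ?_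
    rw [mul_assoc]
    refine le_trans (le_of_eq ?_) (mul_le_mul_right (setLIntegral_le_coupleLevel_norm₁ f x) _)
    rw [← lintegral_const_mul _ f.measurable.enorm]
    refine lintegral_congr_ae (ae_restrict_of_ae ?_)
    filter_upwards [AEEqFun.coeFn_smul c f] with y hy
    rw [hy, Pi.smul_apply, smul_eq_mul, enorm_mul]

end level

theorem halfLine_Iic (x : ℝ) : halfLine (Iic x) = ENNReal.ofReal x := by
  rw [halfLine, Measure.restrict_apply measurableSet_Iic, inter_comm, Ioi_inter_Iic,
    Real.volume_Ioc, sub_zero]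

instance : FiniteIic halfLine := ⟨fun x => by rw [halfLine_Iic]; exact ENNReal.ofReal_lt_top⟩

theorem halfLine_restrict_Iic (x : ℝ) : halfLine.restrict (Iic x) = volume.restrict (Ioc 0 x) := by
  rw [halfLine, Measure.restrict_restrict measurableSet_Iic, inter_comm, Ioi_inter_Iic]

theorem halfLine_restrict_of_subset {s : Set ℝ} (hs : MeasurableSet s) (h : s ⊆ Ioi 0) :
    halfLine.restrict s = volume.restrict s := by
  rw [halfLine, Measure.restrict_restrict hs, inter_eq_left.2 h]

/-! ### Hardy's lemma for measures and decreasing weights. -/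

section dominance

variable {A B : Measure ℝ}

/-- A lower set is a closed half line or the directed union of the rational closed half lines that
it contains. -/
theorem measure_le_of_isLowerSet (h : ∀ x, A (Iic x) ≤ B (Iic x)) {s : Set ℝ}
    (hs : IsLowerSet s) : A s ≤ B s := by
  by_cases hg : ∃ a, IsGreatest s a
  · obtain ⟨a, ha⟩ := hg
    have : s = Iic a := Subset.antisymm (fun x hx => ha.2 hx) fun x hx => hs hx ha.1
    rw [this]
    exact h a
  · have : s = ⋃ q : {q : ℚ // (q : ℝ) ∈ s}, Iic ((q : ℚ) : ℝ) := by
      refine Subset.antisymm (fun x hx => ?_) (iUnion_subset fun q x hx => hs hx q.2)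
      obtain ⟨y, hy, hxy⟩ : ∃ y ∈ s, x < y := by
        by_contra! hc
        exact hg ⟨x, hx, hc⟩
      obtain ⟨q, hq1, hq2⟩ := exists_rat_btwn hxy
      exact mem_iUnion.2 ⟨⟨q, hs hq2.le hy⟩, hq1.le⟩
    have hd : Directed (· ⊆ ·) fun q : {q : ℚ // (q : ℝ) ∈ s} => Iic ((q : ℚ) : ℝ) := by
      refine Monotone.directed_le fun p q hpq => Iic_subset_Iic.2 ?_
      exact_mod_cast hpq
    calc A s = ⨆ q : {q : ℚ // (q : ℝ) ∈ s}, A (Iic ((q : ℚ) : ℝ)) := by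
          conv_lhs => rw [this]
          exact hd.measure_iUnion
      _ ≤ B s := iSup_le fun q => (h _).trans (measure_mono fun x hx => hs hx q.2)

/-- Layer cake formula: the superlevel sets of a decreasing function are lower sets. -/
theorem lintegral_antitone_le (h : ∀ x, A (Iic x) ≤ B (Iic x)) {w : ℝ → ℝ≥0∞} (hw : Antitone w)
    (hfin : ∀ x, w x ≠ ∞) : ∫⁻ x, w x ∂A ≤ ∫⁻ x, w x ∂B := by
  have e : ∀ μ : Measure ℝ, ∫⁻ x, w x ∂μ = ∫⁻ t in Ioi 0, μ {x | t < (w x).toReal} := fun μ => by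
    rw [← lintegral_eq_lintegral_meas_lt μ (Filter.Eventually.of_forall fun _ =>
      ENNReal.toReal_nonneg) hw.measurable.ennreal_toReal.aemeasurable]
    exact lintegral_congr fun x => (ENNReal.ofReal_toReal (hfin x)).symm
  rw [e, e]
  refine lintegral_mono fun t => measure_le_of_isLowerSet h fun x y hyx hx => ?_
  exact lt_of_lt_of_le hx (ENNReal.toReal_mono (hfin y) (hw hyx))

end dominance

/-! ### Composition with the quantile function and averaging over its fibres. -/

section transfer

variable (ρ : Measure ℝ) [FiniteIic ρ]

theorem distrRange_subset : distrRange ρ ⊆ Ioi 0 := fun _ hs => hs.1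

theorem ae_quantile {p : ℝ → Prop} (h : ∀ᵐ x ∂ρ, p x) :
    ∀ᵐ s ∂halfLine, s ∈ distrRange ρ → p (quantile ρ s) := by
  rw [← ae_restrict_iff' (measurableSet_distrRange ρ),
    halfLine_restrict_of_subset (measurableSet_distrRange ρ) (distrRange_subset ρ)]
  rw [← map_quantile ρ] at h
  exact ae_of_ae_map (measurable_quantile ρ).aemeasurable h

theorem ae_distrSplit {p : ℝ → Prop} (h : ∀ᵐ s ∂halfLine, p s) :
    ∀ᵐ x ∂ρ, ∀ᵐ θ ∂unitMeasure, p (distrSplit ρ (x, θ)) := by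
  have h1 : ∀ᵐ s ∂(volume.restrict (distrRange ρ)), p s := by
    rw [← halfLine_restrict_of_subset (measurableSet_distrRange ρ) (distrRange_subset ρ)]
    exact ae_restrict_of_ae h
  rw [← map_distrSplit ρ] at h1
  exact Measure.ae_ae_of_ae_prod (ae_of_ae_map (measurable_distrSplit ρ).aemeasurable h1)

/-- Composition with the quantile function, extended by zero. -/
noncomputable def pull (f : ℝ →ₘ[ρ] ℝ) : ℝ →ₘ[halfLine] ℝ :=
  AEEqFun.mk ((distrRange ρ).indicator (f ∘ quantile ρ))
    ((f.measurable.comp (measurable_quantile ρ)).indicator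
      (measurableSet_distrRange ρ)).aestronglyMeasurable

theorem coeFn_pull (f : ℝ →ₘ[ρ] ℝ) :
    pull ρ f =ᵐ[halfLine] (distrRange ρ).indicator (f ∘ quantile ρ) := AEEqFun.coeFn_mk _ _

theorem pull_add (f g : ℝ →ₘ[ρ] ℝ) : pull ρ (f + g) = pull ρ f + pull ρ g := by
  refine AEEqFun.ext ?_
  filter_upwards [coeFn_pull ρ (f + g), coeFn_pull ρ f, coeFn_pull ρ g,
    AEEqFun.coeFn_add (pull ρ f) (pull ρ g), ae_quantile ρ (AEEqFun.coeFn_add f g)]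
    with s h1 h2 h3 h4 h5
  rw [h1, h4, Pi.add_apply, h2, h3]
  by_cases hs : s ∈ distrRange ρ
  · simpa [hs] using h5 hs
  · simp [hs]

theorem pull_smul (c : ℝ) (f : ℝ →ₘ[ρ] ℝ) : pull ρ (c • f) = c • pull ρ f := by
  refine AEEqFun.ext ?_
  filter_upwards [coeFn_pull ρ (c • f), coeFn_pull ρ f,
    AEEqFun.coeFn_smul c (pull ρ f), ae_quantile ρ (AEEqFun.coeFn_smul c f)] with s h1 h2 h4 h5
  rw [h1, h4, Pi.smul_apply, h2]
  by_cases hs : s ∈ distrRange ρ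
  · simpa [hs] using h5 hs
  · simp [hs]

theorem lintegral_pull_mul (f : ℝ →ₘ[ρ] ℝ) {H : ℝ → ℝ≥0∞} (hH : Measurable H) :
    ∫⁻ s, ‖pull ρ f s‖ₑ * H s ∂halfLine =
      ∫⁻ x, ‖f x‖ₑ * ∫⁻ θ, H (distrSplit ρ (x, θ)) ∂unitMeasure ∂ρ := by
  rw [lintegral_mul_lintegral_distrSplit f.measurable.enorm hH,
    ← halfLine_restrict_of_subset (measurableSet_distrRange ρ) (distrRange_subset ρ),
    ← lintegral_indicator (measurableSet_distrRange ρ)]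
  refine lintegral_congr_ae ?_
  filter_upwards [coeFn_pull ρ f] with s hs
  rw [hs]
  by_cases h : s ∈ distrRange ρ <;> simp [h]

theorem lintegral_pull (f : ℝ →ₘ[ρ] ℝ) :
    ∫⁻ s, ‖pull ρ f s‖ₑ ∂halfLine = ∫⁻ x, ‖f x‖ₑ ∂ρ := by
  simpa using lintegral_pull_mul ρ f (H := fun _ => 1) measurable_const

theorem eLpNorm_top_pull_le (f : ℝ →ₘ[ρ] ℝ) :
    eLpNorm (pull ρ f) ∞ halfLine ≤ eLpNorm f ∞ ρ := by
  rw [eLpNorm_exponent_top, eLpNorm_exponent_top]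
  refine essSup_le_of_ae_le _ ?_
  filter_upwards [coeFn_pull ρ f, ae_quantile ρ (ae_le_eLpNormEssSup (f := f))] with s h1 h2
  rw [h1]
  by_cases hs : s ∈ distrRange ρ
  · simpa [hs] using h2 hs
  · simp [hs]

theorem quantile_mono {r s : ℝ} (hr : r ∈ distrRange ρ) (hs : s ∈ distrRange ρ) (h : r ≤ s) :
    quantile ρ r ≤ quantile ρ s :=
  (quantile_le_iff ρ hr).2 (h.trans ((quantile_le_iff ρ hs).1 le_rfl))

/-- Only `(0, ∞)` can be allowed, since the indicator vanishes on the negative axis; hence the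
variant `ldm_halfLine_le` of the minimality of `ldm`. -/
theorem antitone_indicator_quantile {w : ℝ → ℝ≥0∞} (hw : Antitone w) :
    AntitoneOn ((distrRange ρ).indicator (w ∘ quantile ρ)) (Ioi 0) := by
  intro r hr s hs hrs
  by_cases h : s ∈ distrRange ρ
  · obtain ⟨x, hx⟩ := h.2
    have h' : r ∈ distrRange ρ := ⟨hr, x, hrs.trans hx⟩
    simp only [indicator_of_mem h, indicator_of_mem h', Function.comp_apply]
    exact hw (quantile_mono ρ h' h hrs)
  · rw [indicator_of_notMem h]
    exact zero_le

theorem ldm_halfLine_le {f : ℝ → ℝ} {w : ℝ → ℝ≥0∞} (hw : AntitoneOn w (Ioi 0))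
    (h : ∀ᵐ y ∂halfLine, ‖f y‖ₑ ≤ w y) {x : ℝ} (hx : 0 < x) : ldm halfLine f x ≤ w x := by
  refine essSup_le_of_ae_le _ ?_
  filter_upwards [ae_restrict_of_ae h, ae_restrict_mem measurableSet_Ici] with y hy hxy
  exact hy.trans (hw hx (lt_of_lt_of_le hx hxy) hxy)

theorem ae_halfLine_pos : ∀ᵐ s ∂halfLine, 0 < s := ae_restrict_mem measurableSet_Ioi

theorem lintegral_ldm_pull_le (f : ℝ →ₘ[ρ] ℝ) :
    ∫⁻ s, ldm halfLine (pull ρ f) s ∂halfLine ≤ ∫⁻ x, ldm ρ f x ∂ρ := by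
  calc ∫⁻ s, ldm halfLine (pull ρ f) s ∂halfLine
      ≤ ∫⁻ s, (distrRange ρ).indicator (ldm ρ f ∘ quantile ρ) s ∂halfLine := by
        refine lintegral_mono_ae ?_
        filter_upwards [ae_halfLine_pos] with s hs
        refine ldm_halfLine_le (antitone_indicator_quantile ρ (ldm_antitone ρ f)) ?_ hs
        filter_upwards [coeFn_pull ρ f, ae_quantile ρ (ae_enorm_le_ldm ρ f)] with y h1 h2
        rw [h1]
        by_cases hy : y ∈ distrRange ρ
        · simpa [hy] using h2 hy
        · simp [hy]
    _ = ∫⁻ x, ldm ρ f x ∂ρ := by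
        rw [lintegral_indicator (measurableSet_distrRange ρ),
          halfLine_restrict_of_subset (measurableSet_distrRange ρ) (distrRange_subset ρ)]
        have := lintegral_mul_lintegral_distrSplit (ρ := ρ) (measurable_ldm ρ f)
          (H := fun _ => 1) measurable_const
        simpa using this.symm

theorem ae_unit : ∀ᵐ θ ∂unitMeasure, 0 < θ ∧ θ < 1 := ae_restrict_mem measurableSet_Ioo

/-- For `x < y` the number `distr ρ x` separates the fibre over `x` from the fibre over `y`. -/
theorem antitone_lintegral_distrSplit {w : ℝ → ℝ≥0∞} (hw : Antitone w) :
    Antitone fun x => ∫⁻ θ, w (distrSplit ρ (x, θ)) ∂unitMeasure := by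
  intro x y hxy
  rcases hxy.eq_or_lt with rfl | h
  · exact le_rfl
  calc ∫⁻ θ, w (distrSplit ρ (y, θ)) ∂unitMeasure
      ≤ ∫⁻ _θ, w (distr ρ x) ∂unitMeasure := lintegral_mono_ae (by
        filter_upwards [ae_unit] with θ hθ
        exact hw ((distr_le_distrLeft ρ h).trans (distrLeft_le_distrSplit ρ hθ.1)))
    _ = ∫⁻ _θ : ℝ, w (distr ρ x) ∂unitMeasure := rfl
    _ ≤ ∫⁻ θ, w (distrSplit ρ (x, θ)) ∂unitMeasure := lintegral_mono_ae (by
        filter_upwards [ae_unit] with θ hθ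
        exact hw (distrSplit_le_distr ρ hθ.2))

/-- The integral over `(-∞, s]` of the pulled back function is that of `|f| w`, where `w x` is the
proportion of the fibre over `x` lying below `s`. This weight decreases, so Hardy's lemma compares
`|f| dρ` with `C dρ`. -/
theorem level_pull_le (f : ℝ →ₘ[ρ] ℝ) :
    (coupleLevel halfLine).norm₁ (pull ρ f) ≤ (coupleLevel ρ).norm₁ f := by
  refine coupleLevel_norm₁_le_iff.2 fun s => ?_
  rcases eq_or_ne ((coupleLevel ρ).norm₁ f) ∞ with hC | hC
  · rw [hC]
    rcases eq_or_ne (halfLine (Iic s)) 0 with h0 | h0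
    · rw [setLIntegral_measure_zero _ _ h0]
      exact zero_le
    · rw [ENNReal.top_mul h0]
      exact le_top
  set C := (coupleLevel ρ).norm₁ f
  have hind : Measurable ((Iic s).indicator fun _ => (1 : ℝ≥0∞)) :=
    measurable_const.indicator measurableSet_Iic
  set w : ℝ → ℝ≥0∞ := fun x =>
    ∫⁻ θ, (Iic s).indicator (fun _ => (1 : ℝ≥0∞)) (distrSplit ρ (x, θ)) ∂unitMeasure with hw
  have hanti : Antitone w := by
    refine antitone_lintegral_distrSplit ρ fun a b hab => ?_
    by_cases hb : b ∈ Iic s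
    · rw [indicator_of_mem hb, indicator_of_mem (show a ∈ Iic s from le_trans hab hb)]
    · rw [indicator_of_notMem hb]
      exact zero_le
  have hw1 : ∀ x, w x ≠ ∞ := fun x => by
    refine ne_top_of_le_ne_top ENNReal.one_ne_top
      (b := 1) ((lintegral_mono (g := fun _ => 1) fun θ => ?_).trans (by simp))
    exact indicator_le_self' (fun _ _ => zero_le) _
  have hwm : Measurable w := hanti.measurable
  calc ∫⁻ r in Iic s, ‖pull ρ f r‖ₑ ∂halfLine
      = ∫⁻ r, ‖pull ρ f r‖ₑ * (Iic s).indicator (fun _ => 1) r ∂halfLine := by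
        rw [← lintegral_indicator measurableSet_Iic]
        refine lintegral_congr fun r => ?_
        by_cases hr : r ∈ Iic s
        · rw [indicator_of_mem hr, indicator_of_mem hr, mul_one]
        · rw [indicator_of_notMem hr, indicator_of_notMem hr, mul_zero]
    _ = ∫⁻ x, ‖f x‖ₑ * w x ∂ρ := lintegral_pull_mul ρ f hind
    _ = ∫⁻ x, w x ∂(ρ.withDensity fun x => ‖f x‖ₑ) := by
        rw [lintegral_withDensity_eq_lintegral_mul _ f.measurable.enorm hwm]
        rfl
    _ ≤ ∫⁻ x, w x ∂(C • ρ) := by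
        refine lintegral_antitone_le (fun x => ?_) hanti hw1
        rw [withDensity_apply _ measurableSet_Iic, Measure.smul_apply, smul_eq_mul]
        exact setLIntegral_le_coupleLevel_norm₁ f x
    _ = C * ∫⁻ x, w x ∂ρ := by rw [lintegral_smul_measure, smul_eq_mul]
    _ ≤ C * halfLine (Iic s) := by
        gcongr
        have := lintegral_mul_lintegral_distrSplit (ρ := ρ) (w := fun _ => 1)
          measurable_const hind
        simp only [one_mul] at this
        rw [this, lintegral_indicator measurableSet_Iic, lintegral_one,
          Measure.restrict_apply_univ,
          ← halfLine_restrict_of_subset (measurableSet_distrRange ρ) (distrRange_subset ρ)]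
        exact Measure.restrict_le_self _

/-- The conditional expectation with respect to the quantile function. -/
noncomputable def push (h : ℝ →ₘ[halfLine] ℝ) : ℝ →ₘ[ρ] ℝ :=
  AEEqFun.mk (fun x => ∫ θ, h (distrSplit ρ (x, θ)) ∂unitMeasure)
    (StronglyMeasurable.integral_prod_right' (f := fun z => h (distrSplit ρ z))
      (h.stronglyMeasurable.comp_measurable (measurable_distrSplit ρ))).aestronglyMeasurable

theorem coeFn_push (h : ℝ →ₘ[halfLine] ℝ) :
    push ρ h =ᵐ[ρ] fun x => ∫ θ, h (distrSplit ρ (x, θ)) ∂unitMeasure := AEEqFun.coeFn_mk _ _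

/-- Integrability on all intervals `(0, R]`. -/
def LocInt (h : ℝ → ℝ) : Prop := ∀ R : ℝ, ∫⁻ s in Iic R, ‖h s‖ₑ ∂halfLine < ∞

theorem ae_integrable_distrSplit {h : ℝ →ₘ[halfLine] ℝ} (hh : LocInt h) :
    ∀ᵐ x ∂ρ, Integrable (fun θ => h (distrSplit ρ (x, θ))) unitMeasure := by
  have h1 : ∀ n : ℕ, ∀ᵐ x ∂ρ, x ∈ Iic (n : ℝ) →
      ∫⁻ θ, ‖h (distrSplit ρ (x, θ))‖ₑ ∂unitMeasure < ∞ := fun n => by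
    rw [← ae_restrict_iff' measurableSet_Iic]
    refine ae_lt_top (measurable_lintegral_distrSplit (H := fun s => ‖h s‖ₑ) h.measurable.enorm) ?_
    rw [setLIntegral_lintegral_distrSplit (H := fun s => ‖h s‖ₑ) h.measurable.enorm,
      ← halfLine_restrict_Iic]
    exact (hh _).ne
  filter_upwards [ae_all_iff.2 h1] with x hx
  obtain ⟨n, hn⟩ := exists_nat_ge x
  exact ⟨(h.measurable.comp ((measurable_distrSplit ρ).comp
    measurable_prodMk_left)).aestronglyMeasurable, hx n hn⟩

/-- Local integrability cannot be dropped: the Bochner integral of a non-integrable function is zero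
by convention, which spoils additivity. -/
theorem push_add {g h : ℝ →ₘ[halfLine] ℝ} (hg : LocInt g) (hh : LocInt h) :
    push ρ (g + h) = push ρ g + push ρ h := by
  refine AEEqFun.ext ?_
  filter_upwards [coeFn_push ρ (g + h), coeFn_push ρ g, coeFn_push ρ h,
    AEEqFun.coeFn_add (push ρ g) (push ρ h), ae_distrSplit ρ (AEEqFun.coeFn_add g h),
    ae_integrable_distrSplit ρ hg, ae_integrable_distrSplit ρ hh] with x h1 h2 h3 h4 h5 h6 h7
  rw [h1, h4, Pi.add_apply, h2, h3, ← integral_add h6 h7]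
  exact integral_congr_ae h5

theorem push_smul (c : ℝ) (h : ℝ →ₘ[halfLine] ℝ) : push ρ (c • h) = c • push ρ h := by
  refine AEEqFun.ext ?_
  filter_upwards [coeFn_push ρ (c • h), coeFn_push ρ h,
    AEEqFun.coeFn_smul c (push ρ h), ae_distrSplit ρ (AEEqFun.coeFn_smul c h)] with x h1 h2 h4 h5
  rw [h1, h4, Pi.smul_apply, h2, ← integral_smul]
  exact integral_congr_ae h5

theorem push_pull (f : ℝ →ₘ[ρ] ℝ) : push ρ (pull ρ f) = f := by
  refine AEEqFun.ext ?_
  filter_upwards [coeFn_push ρ (pull ρ f), ae_distrSplit ρ (coeFn_pull ρ f), ae_distr_lt ρ]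
    with x h1 h2 h3
  rw [h1]
  have : ∀ᵐ θ ∂unitMeasure, pull ρ f (distrSplit ρ (x, θ)) = f x := by
    filter_upwards [h2, ae_unit] with θ h4 h5
    rw [h4, indicator_of_mem (distrSplit_mem ρ h3 h5.1 h5.2), Function.comp_apply,
      quantile_distrSplit ρ h3 h5.1 h5.2]
  rw [integral_congr_ae this]
  simp

theorem ae_enorm_push_le (h : ℝ →ₘ[halfLine] ℝ) :
    ∀ᵐ x ∂ρ, ‖push ρ h x‖ₑ ≤ ∫⁻ θ, ‖h (distrSplit ρ (x, θ))‖ₑ ∂unitMeasure := by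
  filter_upwards [coeFn_push ρ h] with x hx
  rw [hx]
  exact enorm_integral_le_lintegral_enorm _

theorem lintegral_lintegral_distrSplit_le {H : ℝ → ℝ≥0∞} (hH : Measurable H) :
    ∫⁻ x, ∫⁻ θ, H (distrSplit ρ (x, θ)) ∂unitMeasure ∂ρ ≤ ∫⁻ s, H s ∂halfLine := by
  have := lintegral_mul_lintegral_distrSplit (ρ := ρ) (w := fun _ => 1) measurable_const hH
  simp only [one_mul] at this
  rw [this, ← halfLine_restrict_of_subset (measurableSet_distrRange ρ) (distrRange_subset ρ)]
  exact lintegral_mono' Measure.restrict_le_self le_rfl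

theorem lintegral_push_le (h : ℝ →ₘ[halfLine] ℝ) :
    ∫⁻ x, ‖push ρ h x‖ₑ ∂ρ ≤ ∫⁻ s, ‖h s‖ₑ ∂halfLine :=
  (lintegral_mono_ae (ae_enorm_push_le ρ h)).trans
    (lintegral_lintegral_distrSplit_le ρ (H := fun s => ‖h s‖ₑ) h.measurable.enorm)

theorem eLpNorm_top_push_le (h : ℝ →ₘ[halfLine] ℝ) :
    eLpNorm (push ρ h) ∞ ρ ≤ eLpNorm h ∞ halfLine := by
  rw [eLpNorm_exponent_top, eLpNorm_exponent_top]
  refine essSup_le_of_ae_le _ ?_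
  filter_upwards [ae_enorm_push_le ρ h, ae_distrSplit ρ (ae_le_eLpNormEssSup (f := h))]
    with x h1 h2
  exact h1.trans ((lintegral_mono_ae h2).trans (by simp))

/-- Averaged over the fibres, the majorant of `h` is still decreasing, and it dominates the averages
of `h`. -/
theorem lintegral_ldm_push_le (h : ℝ →ₘ[halfLine] ℝ) :
    ∫⁻ x, ldm ρ (push ρ h) x ∂ρ ≤ ∫⁻ s, ldm halfLine h s ∂halfLine := by
  refine (lintegral_mono fun x => ?_).trans
    (lintegral_lintegral_distrSplit_le ρ (measurable_ldm halfLine h))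
  refine ldm_le_of_ae_le (antitone_lintegral_distrSplit ρ (ldm_antitone halfLine h)) ?_ x
  filter_upwards [ae_enorm_push_le ρ h, ae_distrSplit ρ (ae_enorm_le_ldm halfLine h)]
    with x h1 h2
  exact h1.trans (lintegral_mono_ae h2)

theorem level_push_le (h : ℝ →ₘ[halfLine] ℝ) :
    (coupleLevel ρ).norm₁ (push ρ h) ≤ (coupleLevel halfLine).norm₁ h := by
  refine coupleLevel_norm₁_le_iff.2 fun x => ?_
  refine (lintegral_mono_ae (ae_restrict_of_ae (ae_enorm_push_le ρ h))).trans ?_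
  rw [setLIntegral_lintegral_distrSplit (H := fun s => ‖h s‖ₑ) h.measurable.enorm,
    ← halfLine_restrict_Iic, ← ofReal_distr, ← halfLine_Iic]
  exact setLIntegral_le_coupleLevel_norm₁ h _

end transfer

/-! ### Dyadic step functions and operators given by matrices. -/

/-- The length of the dyadic intervals of order `n`. -/
noncomputable def mesh (n : ℕ) : ℝ := ((2 : ℝ) ^ n)⁻¹

/-- The `k`-th dyadic interval of order `n`. -/
def block (n k : ℕ) : Set ℝ := Ioc (k * mesh n) ((k + 1) * mesh n)

theorem mesh_pos (n : ℕ) : 0 < mesh n := by unfold mesh; positivity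

theorem pow_mul_mesh (n : ℕ) : (2 : ℝ) ^ n * mesh n = 1 := by
  unfold mesh; field_simp

theorem measurableSet_block (n k : ℕ) : MeasurableSet (block n k) := measurableSet_Ioc

theorem block_subset_Ioi (n k : ℕ) : block n k ⊆ Ioi 0 := fun _ hs =>
  lt_of_le_of_lt (mul_nonneg (Nat.cast_nonneg k) (mesh_pos n).le) hs.1

theorem block_subset_Iic (n k : ℕ) : block n k ⊆ Iic ((k + 1) * mesh n) := fun _ hs => hs.2

theorem halfLine_block (n k : ℕ) : halfLine (block n k) = ENNReal.ofReal (mesh n) := by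
  rw [halfLine, Measure.restrict_apply (measurableSet_block n k),
    inter_eq_left.2 (block_subset_Ioi n k), block, Real.volume_Ioc]
  congr 1
  ring

theorem pairwise_disjoint_block (n : ℕ) : Pairwise (Function.onFun Disjoint (block n)) := by
  have h : ∀ i j : ℕ, i < j → Disjoint (block n i) (block n j) := fun i j hij => by
    rw [Set.disjoint_left]
    intro s hi hj
    have : ((i : ℝ) + 1) * mesh n ≤ j * mesh n :=
      mul_le_mul_of_nonneg_right (by exact_mod_cast hij) (mesh_pos n).le
    exact absurd (hi.2.trans this) (not_le.2 hj.1)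
  intro i j hij
  rcases lt_or_gt_of_ne hij with h' | h'
  · exact h i j h'
  · exact (h j i h').symm

theorem exists_mem_block (n : ℕ) {s : ℝ} (hs : 0 < s) : ∃ k, s ∈ block n k := by
  have hp : 0 < ⌈s / mesh n⌉₊ := Nat.ceil_pos.2 (div_pos hs (mesh_pos n))
  refine ⟨⌈s / mesh n⌉₊ - 1, ?_, ?_⟩
  · rw [← lt_div_iff₀ (mesh_pos n)]
    exact Nat.lt_ceil.1 (by omega)
  · rw [← div_le_iff₀ (mesh_pos n)]
    have : ((⌈s / mesh n⌉₊ - 1 : ℕ) : ℝ) + 1 = ⌈s / mesh n⌉₊ := by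
      have : (⌈s / mesh n⌉₊ - 1) + 1 = ⌈s / mesh n⌉₊ := by omega
      exact_mod_cast this
    rw [this]
    exact Nat.le_ceil _

theorem biUnion_block (n k : ℕ) : ⋃ i ∈ Finset.range k, block n i = Ioc 0 (k * mesh n) := by
  ext s
  simp only [mem_iUnion, Finset.mem_range, exists_prop]
  constructor
  · rintro ⟨i, hi, hs⟩
    refine ⟨block_subset_Ioi n i hs, hs.2.trans ?_⟩
    exact mul_le_mul_of_nonneg_right (by exact_mod_cast hi) (mesh_pos n).le
  · intro hs
    obtain ⟨i, hi⟩ := exists_mem_block n hs.1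
    refine ⟨i, ?_, hi⟩
    have := hi.1.trans_le hs.2
    exact_mod_cast lt_of_mul_lt_mul_right this (mesh_pos n).le

theorem sum_lintegral_block (n k : ℕ) (H : ℝ → ℝ≥0∞) :
    ∑ i ∈ Finset.range k, ∫⁻ s in block n i, H s ∂halfLine =
      ∫⁻ s in Iic (k * mesh n), H s ∂halfLine := by
  rw [halfLine_restrict_Iic, ← biUnion_block, lintegral_biUnion_finset
    (fun i _ j _ hij => pairwise_disjoint_block n hij) (fun i _ => measurableSet_block n i)]
  refine Finset.sum_congr rfl fun i _ => ?_
  rw [halfLine_restrict_of_subset (measurableSet_block n i) (block_subset_Ioi n i)]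

theorem sum_lintegral_block_le (n k : ℕ) (H : ℝ → ℝ≥0∞) :
    ∑ i ∈ Finset.range k, ∫⁻ s in block n i, H s ∂halfLine ≤ ∫⁻ s, H s ∂halfLine := by
  rw [sum_lintegral_block]
  exact lintegral_mono' Measure.restrict_le_self le_rfl

theorem LocInt.integrableOn {f : ℝ →ₘ[halfLine] ℝ} (hf : LocInt f) (R : ℝ) :
    IntegrableOn f (Iic R) halfLine :=
  ⟨f.aestronglyMeasurable.restrict, hf R⟩

theorem LocInt.integrableOn_block {f : ℝ →ₘ[halfLine] ℝ} (hf : LocInt f) (n k : ℕ) :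
    IntegrableOn f (block n k) halfLine :=
  (hf.integrableOn _).mono_set (block_subset_Iic n k)

theorem sum_integral_block {f : ℝ →ₘ[halfLine] ℝ} (hf : LocInt f) (n k : ℕ) :
    ∑ i ∈ Finset.range k, ∫ s in block n i, f s ∂halfLine =
      ∫ s in Iic (k * mesh n), f s ∂halfLine := by
  rw [halfLine_restrict_Iic, ← biUnion_block, integral_biUnion_finset _
    (fun i _ => measurableSet_block n i) (fun i _ j _ hij => pairwise_disjoint_block n hij)]
  · refine Finset.sum_congr rfl fun i _ => ?_
    rw [halfLine_restrict_of_subset (measurableSet_block n i) (block_subset_Ioi n i)]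
  · intro i _
    have := hf.integrableOn_block n i
    rwa [IntegrableOn, halfLine_restrict_of_subset (measurableSet_block n i)
      (block_subset_Ioi n i)] at this

/-- The step function with value `v k` on the `k`-th dyadic interval of order `n`, for
`k < 4 ^ n`. -/
noncomputable def step {β : Type*} [AddCommMonoid β] (n : ℕ) (v : ℕ → β) (s : ℝ) : β :=
  ∑ k ∈ Finset.range (4 ^ n), (block n k).indicator (fun _ => v k) s

section step

variable {β : Type*} [AddCommMonoid β]

theorem step_apply {n k : ℕ} (hk : k < 4 ^ n) (v : ℕ → β) {s : ℝ} (hs : s ∈ block n k) :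
    step n v s = v k := by
  rw [step, Finset.sum_eq_single k]
  · exact indicator_of_mem hs _
  · intro i _ hik
    exact indicator_of_notMem (fun hi => Set.disjoint_left.1 (pairwise_disjoint_block n hik) hi hs) _
  · intro h
    exact absurd (Finset.mem_range.2 hk) h

theorem step_eq_zero {n k : ℕ} (hk : 4 ^ n ≤ k) (v : ℕ → β) {s : ℝ} (hs : s ∈ block n k) :
    step n v s = 0 := by
  refine Finset.sum_eq_zero fun i hi => ?_
  have hik : i ≠ k := by have := Finset.mem_range.1 hi; omega
  exact indicator_of_notMem (fun hi => Set.disjoint_left.1 (pairwise_disjoint_block n hik) hi hs) _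

end step

theorem measurable_step (n : ℕ) (v : ℕ → ℝ) : Measurable (step n v) := by
  unfold step
  exact Finset.measurable_sum _ fun i _ => measurable_const.indicator (measurableSet_block n i)

theorem enorm_step {n : ℕ} (v : ℕ → ℝ) {s : ℝ} (hs : 0 < s) :
    ‖step n v s‖ₑ = step n (fun k => ‖v k‖ₑ) s := by
  obtain ⟨k, hk⟩ := exists_mem_block n hs
  rcases lt_or_ge k (4 ^ n) with h | h
  · rw [step_apply h _ hk, step_apply h _ hk]
  · rw [step_eq_zero h _ hk, step_eq_zero h _ hk, enorm_zero]

theorem lintegral_step (n : ℕ) (v : ℕ → ℝ≥0∞) :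
    ∫⁻ s, step n v s ∂halfLine = ∑ k ∈ Finset.range (4 ^ n), ENNReal.ofReal (mesh n) * v k := by
  simp only [step]
  rw [lintegral_finsetSum _ fun i _ => measurable_const.indicator (measurableSet_block n i)]
  refine Finset.sum_congr rfl fun i _ => ?_
  rw [lintegral_indicator (measurableSet_block n i), setLIntegral_const, halfLine_block, mul_comm]

/-- The class of a step function. -/
noncomputable def stepClass (n : ℕ) (v : ℕ → ℝ) : ℝ →ₘ[halfLine] ℝ :=
  AEEqFun.mk (step n v) (measurable_step n v).aestronglyMeasurable

theorem coeFn_stepClass (n : ℕ) (v : ℕ → ℝ) : stepClass n v =ᵐ[halfLine] step n v :=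
  AEEqFun.coeFn_mk _ _

theorem integral_block_stepClass {n k : ℕ} (hk : k < 4 ^ n) (v : ℕ → ℝ) :
    ∫ s in block n k, stepClass n v s ∂halfLine = mesh n * v k := by
  rw [setIntegral_congr_ae (g := fun _ => v k) (measurableSet_block n k)]
  · rw [setIntegral_const, smul_eq_mul, Measure.real, halfLine_block,
      ENNReal.toReal_ofReal (mesh_pos n).le]
  · filter_upwards [coeFn_stepClass n v] with s hs hb
    rw [hs, step_apply hk _ hb]

theorem stepClass_add (n : ℕ) (v w : ℕ → ℝ) :
    stepClass n (fun k => v k + w k) = stepClass n v + stepClass n w := by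
  refine AEEqFun.ext ?_
  filter_upwards [coeFn_stepClass n v, coeFn_stepClass n w, coeFn_stepClass n fun k => v k + w k,
    AEEqFun.coeFn_add (stepClass n v) (stepClass n w)] with s h1 h2 h3 h4
  rw [h3, h4, Pi.add_apply, h1, h2, step, step, step, ← Finset.sum_add_distrib]
  refine Finset.sum_congr rfl fun k _ => ?_
  by_cases h : s ∈ block n k <;> simp [h]

theorem stepClass_smul (n : ℕ) (c : ℝ) (v : ℕ → ℝ) :
    stepClass n (fun k => c * v k) = c • stepClass n v := by
  refine AEEqFun.ext ?_
  filter_upwards [coeFn_stepClass n v, coeFn_stepClass n fun k => c * v k,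
    AEEqFun.coeFn_smul c (stepClass n v)] with s h1 h3 h4
  rw [h3, h4, Pi.smul_apply, h1, smul_eq_mul, step, step, Finset.mul_sum]
  refine Finset.sum_congr rfl fun k _ => ?_
  by_cases h : s ∈ block n k <;> simp [h]

/-- The averages over the dyadic intervals of order `n`. -/
noncomputable def avg (n : ℕ) (f : ℝ → ℝ) (k : ℕ) : ℝ :=
  2 ^ n * ∫ s in block n k, f s ∂halfLine

theorem mesh_mul_avg (n : ℕ) (f : ℝ → ℝ) (k : ℕ) :
    mesh n * avg n f k = ∫ s in block n k, f s ∂halfLine := by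
  rw [avg, ← mul_assoc, mul_comm (mesh n), pow_mul_mesh, one_mul]

theorem avg_add (n : ℕ) {f g : ℝ →ₘ[halfLine] ℝ} (hf : LocInt f) (hg : LocInt g) (k : ℕ) :
    avg n (f + g : ℝ →ₘ[halfLine] ℝ) k = avg n f k + avg n g k := by
  rw [avg, avg, avg, ← mul_add, ← integral_add (hf.integrableOn_block n k)
    (hg.integrableOn_block n k)]
  congr 1
  exact integral_congr_ae (ae_restrict_of_ae (AEEqFun.coeFn_add f g))

theorem avg_smul (n : ℕ) (c : ℝ) (f : ℝ →ₘ[halfLine] ℝ) (k : ℕ) :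
    avg n (c • f : ℝ →ₘ[halfLine] ℝ) k = c * avg n f k := by
  rw [avg, avg, mul_left_comm, ← integral_const_mul c]
  congr 1
  exact integral_congr_ae (ae_restrict_of_ae (AEEqFun.coeFn_smul c f))

theorem ofReal_mesh_mul_enorm_avg_le (n : ℕ) (f : ℝ → ℝ) (k : ℕ) :
    ENNReal.ofReal (mesh n) * ‖avg n f k‖ₑ ≤ ∫⁻ s in block n k, ‖f s‖ₑ ∂halfLine := by
  rw [← Real.enorm_of_nonneg (mesh_pos n).le, ← enorm_mul, mesh_mul_avg]
  exact enorm_integral_le_lintegral_enorm _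

theorem enorm_avg_le (n : ℕ) (f : ℝ → ℝ) (k : ℕ) :
    ‖avg n f k‖ₑ ≤ 2 ^ n * ∫⁻ s in block n k, ‖f s‖ₑ ∂halfLine := by
  rw [avg, enorm_mul]
  gcongr
  · rw [enorm_pow, Real.enorm_of_nonneg zero_le_two]
    simp
  · exact enorm_integral_le_lintegral_enorm _

theorem ofReal_mesh (n : ℕ) : ENNReal.ofReal (mesh n) = (2 ^ n)⁻¹ := by
  rw [mesh, ENNReal.ofReal_inv_of_pos (by positivity), ENNReal.ofReal_pow zero_le_two]
  simp

theorem pow_mul_ofReal_mesh (n : ℕ) : (2 : ℝ≥0∞) ^ n * ENNReal.ofReal (mesh n) = 1 := by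
  rw [ofReal_mesh]
  exact ENNReal.mul_inv_cancel (by positivity) (by simp)

theorem pow_mul_lintegral_block_le (n k : ℕ) {H : ℝ → ℝ≥0∞} {c : ℝ≥0∞}
    (h : ∀ᵐ s ∂halfLine, s ∈ block n k → H s ≤ c) :
    2 ^ n * ∫⁻ s in block n k, H s ∂halfLine ≤ c := by
  calc 2 ^ n * ∫⁻ s in block n k, H s ∂halfLine
      ≤ 2 ^ n * ∫⁻ _s in block n k, c ∂halfLine := by
        gcongr 1
        exact lintegral_mono_ae ((ae_restrict_iff' (measurableSet_block n k)).2 h)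
    _ = c := by
        rw [setLIntegral_const, halfLine_block, mul_left_comm, pow_mul_ofReal_mesh, mul_one]

theorem le_pow_mul_lintegral_block (n k : ℕ) {H : ℝ → ℝ≥0∞} {c : ℝ≥0∞}
    (h : ∀ s ∈ block n k, c ≤ H s) :
    c ≤ 2 ^ n * ∫⁻ s in block n k, H s ∂halfLine := by
  calc c = 2 ^ n * ∫⁻ _s in block n k, c ∂halfLine := by
        rw [setLIntegral_const, halfLine_block, mul_left_comm, pow_mul_ofReal_mesh, mul_one]
    _ ≤ _ := by
        gcongr 1
        exact setLIntegral_mono' (measurableSet_block n k) h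

/-- The matrix `U` applied to the averages, as a step function. -/
noncomputable def matOp (n : ℕ) (U : ℕ → ℕ → ℝ) (f : ℝ →ₘ[halfLine] ℝ) : ℝ →ₘ[halfLine] ℝ :=
  stepClass n fun i => ∑ j ∈ Finset.range (4 ^ n), U i j * avg n f j

theorem matOp_add (n : ℕ) (U : ℕ → ℕ → ℝ) {f g : ℝ →ₘ[halfLine] ℝ} (hf : LocInt f)
    (hg : LocInt g) : matOp n U (f + g) = matOp n U f + matOp n U g := by
  rw [matOp, matOp, matOp, ← stepClass_add]
  congr 1
  ext i
  rw [← Finset.sum_add_distrib]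
  exact Finset.sum_congr rfl fun j _ => by rw [avg_add n hf hg, mul_add]

theorem matOp_smul (n : ℕ) (U : ℕ → ℕ → ℝ) (c : ℝ) (f : ℝ →ₘ[halfLine] ℝ) :
    matOp n U (c • f) = c • matOp n U f := by
  rw [matOp, matOp, ← stepClass_smul]
  congr 1
  ext i
  rw [Finset.mul_sum]
  exact Finset.sum_congr rfl fun j _ => by rw [avg_smul, mul_left_comm]

theorem enorm_sum_mul_le (n : ℕ) (U : ℕ → ℕ → ℝ) (a : ℕ → ℝ) (i : ℕ) :
    ‖∑ j ∈ Finset.range (4 ^ n), U i j * a j‖ₑ ≤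
      ∑ j ∈ Finset.range (4 ^ n), ‖U i j‖ₑ * ‖a j‖ₑ := by
  refine (enorm_sum_le _ _).trans (le_of_eq ?_)
  exact Finset.sum_congr rfl fun j _ => enorm_mul _ _

theorem lintegral_enorm_stepClass (n : ℕ) (v : ℕ → ℝ) :
    ∫⁻ s, ‖stepClass n v s‖ₑ ∂halfLine =
      ∑ k ∈ Finset.range (4 ^ n), ENNReal.ofReal (mesh n) * ‖v k‖ₑ := by
  rw [← lintegral_step]
  refine lintegral_congr_ae ?_
  filter_upwards [coeFn_stepClass n v, ae_halfLine_pos] with s h1 h2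
  rw [h1, enorm_step v h2]

theorem lintegral_matOp_le (n : ℕ) {U : ℕ → ℕ → ℝ}
    (hU : ∀ j < 4 ^ n, ∑ i ∈ Finset.range (4 ^ n), ‖U i j‖ₑ ≤ 1) (f : ℝ →ₘ[halfLine] ℝ) :
    ∫⁻ s, ‖matOp n U f s‖ₑ ∂halfLine ≤ ∫⁻ s, ‖f s‖ₑ ∂halfLine := by
  rw [matOp, lintegral_enorm_stepClass]
  calc ∑ i ∈ Finset.range (4 ^ n), ENNReal.ofReal (mesh n) *
        ‖∑ j ∈ Finset.range (4 ^ n), U i j * avg n f j‖ₑ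
      ≤ ∑ i ∈ Finset.range (4 ^ n), ∑ j ∈ Finset.range (4 ^ n),
        ‖U i j‖ₑ * (ENNReal.ofReal (mesh n) * ‖avg n f j‖ₑ) := by
        refine Finset.sum_le_sum fun i _ => ?_
        refine (mul_le_mul_right (enorm_sum_mul_le n U (avg n f) i) _).trans (le_of_eq ?_)
        rw [Finset.mul_sum]
        exact Finset.sum_congr rfl fun j _ => by ring
    _ = ∑ j ∈ Finset.range (4 ^ n), (∑ i ∈ Finset.range (4 ^ n), ‖U i j‖ₑ) *
        (ENNReal.ofReal (mesh n) * ‖avg n f j‖ₑ) := by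
        rw [Finset.sum_comm]
        exact Finset.sum_congr rfl fun j _ => by rw [Finset.sum_mul]
    _ ≤ ∑ j ∈ Finset.range (4 ^ n), ∫⁻ s in block n j, ‖f s‖ₑ ∂halfLine := by
        refine Finset.sum_le_sum fun j hj => ?_
        calc _ ≤ 1 * (ENNReal.ofReal (mesh n) * ‖avg n f j‖ₑ) :=
              mul_le_mul_left (hU j (Finset.mem_range.1 hj)) _
          _ ≤ _ := by
              rw [one_mul]
              exact ofReal_mesh_mul_enorm_avg_le n f j
    _ ≤ _ := sum_lintegral_block_le n _ _

theorem ae_enorm_matOp_le (n : ℕ) {U : ℕ → ℕ → ℝ} (f : ℝ →ₘ[halfLine] ℝ) :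
    ∀ᵐ s ∂halfLine, ‖matOp n U f s‖ₑ ≤ step n (fun i =>
      ∑ j ∈ Finset.range (4 ^ n), ‖U i j‖ₑ * ‖avg n f j‖ₑ) s := by
  filter_upwards [coeFn_stepClass n fun i => ∑ j ∈ Finset.range (4 ^ n), U i j * avg n f j,
    ae_halfLine_pos] with s h1 h2
  rw [matOp, h1]
  obtain ⟨k, hk⟩ := exists_mem_block n h2
  rcases lt_or_ge k (4 ^ n) with h | h
  · rw [step_apply h _ hk, step_apply h _ hk]
    exact enorm_sum_mul_le n U (avg n f) k
  · rw [step_eq_zero h _ hk, enorm_zero]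
    exact zero_le

theorem eLpNorm_top_matOp_le (n : ℕ) {U : ℕ → ℕ → ℝ}
    (hU : ∀ i < 4 ^ n, ∑ j ∈ Finset.range (4 ^ n), ‖U i j‖ₑ ≤ 1) (f : ℝ →ₘ[halfLine] ℝ) :
    eLpNorm (matOp n U f) ∞ halfLine ≤ eLpNorm f ∞ halfLine := by
  rw [eLpNorm_exponent_top, eLpNorm_exponent_top]
  set C := eLpNormEssSup f halfLine
  have havg : ∀ j, ‖avg n f j‖ₑ ≤ C := fun j => (enorm_avg_le n f j).trans
    (pow_mul_lintegral_block_le n j ((ae_le_eLpNormEssSup (f := f)).mono fun s hs _ => hs))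
  refine essSup_le_of_ae_le _ ?_
  filter_upwards [ae_enorm_matOp_le n (U := U) f, ae_halfLine_pos] with s h1 h2
  refine h1.trans ?_
  obtain ⟨k, hk⟩ := exists_mem_block n h2
  rcases lt_or_ge k (4 ^ n) with h | h
  · rw [step_apply h _ hk]
    calc _ ≤ ∑ j ∈ Finset.range (4 ^ n), ‖U k j‖ₑ * C :=
          Finset.sum_le_sum fun j _ => mul_le_mul_right (havg j) _
      _ ≤ 1 * C := by
          rw [← Finset.sum_mul]
          exact mul_le_mul_left (hU k h) _
      _ = C := one_mul _
  · rw [step_eq_zero h _ hk]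
    exact zero_le

/-- A condition under which the operator given by the matrix is a contraction for the norm of
the least decreasing majorant. -/
def TildeContr (N : ℕ) (U : ℕ → ℕ → ℝ) : Prop :=
  ∀ c : ℕ → ℝ≥0∞, Antitone c → ∃ d : ℕ → ℝ≥0∞, AntitoneOn d (Iio N) ∧
    (∀ i < N, ∑ j ∈ Finset.range N, ‖U i j‖ₑ * c j ≤ d i) ∧
    ∑ i ∈ Finset.range N, d i ≤ ∑ i ∈ Finset.range N, c i

theorem antitoneOn_step {n : ℕ} {d : ℕ → ℝ≥0∞} (hd : AntitoneOn d (Iio (4 ^ n))) :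
    AntitoneOn (step n d) (Ioi 0) := by
  intro r hr s hs hrs
  obtain ⟨i, hi⟩ := exists_mem_block n hr
  obtain ⟨j, hj⟩ := exists_mem_block n hs
  rcases lt_or_ge j (4 ^ n) with h | h
  · have hij : i ≤ j := by
      have h1 := hi.1.trans_le (hrs.trans hj.2)
      have h2 := lt_of_mul_lt_mul_right h1 (mesh_pos n).le
      have : i < j + 1 := by exact_mod_cast h2
      omega
    rw [step_apply h _ hj, step_apply (hij.trans_lt h) _ hi]
    exact hd (hij.trans_lt h) h hij
  · rw [step_eq_zero h _ hj]
    exact zero_le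

/-- The block averages `c` of the majorant of `f` decrease and dominate those of `f`. The sequence
`d` that `TildeContr` attaches to `c` is a decreasing majorant of the image, with no larger sum. -/
theorem lintegral_ldm_matOp_le (n : ℕ) {U : ℕ → ℕ → ℝ} (hU : TildeContr (4 ^ n) U)
    (f : ℝ →ₘ[halfLine] ℝ) :
    ∫⁻ s, ldm halfLine (matOp n U f) s ∂halfLine ≤ ∫⁻ s, ldm halfLine f s ∂halfLine := by
  set c : ℕ → ℝ≥0∞ := fun j => 2 ^ n * ∫⁻ s in block n j, ldm halfLine f s ∂halfLine with hc
  have hle : ∀ j, ‖avg n f j‖ₑ ≤ c j := fun j => (enorm_avg_le n f j).trans (by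
    simp only [hc]
    gcongr 1
    exact lintegral_mono_ae (ae_restrict_of_ae (ae_enorm_le_ldm halfLine f)))
  have hanti : Antitone c := antitone_nat_of_succ_le fun j => by
    refine (pow_mul_lintegral_block_le n (j + 1) (c := ldm halfLine f ((j + 1) * mesh n))
      (Filter.Eventually.of_forall fun s hs => ldm_antitone halfLine f ?_)).trans
      (le_pow_mul_lintegral_block n j fun s hs => ldm_antitone halfLine f hs.2)
    have := hs.1
    push_cast at this
    exact this.le
  obtain ⟨d, hd1, hd2, hd3⟩ := hU c hanti
  calc ∫⁻ s, ldm halfLine (matOp n U f) s ∂halfLine ≤ ∫⁻ s, step n d s ∂halfLine := by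
        refine lintegral_mono_ae ?_
        filter_upwards [ae_halfLine_pos] with s hs
        refine ldm_halfLine_le (antitoneOn_step hd1) ?_ hs
        filter_upwards [ae_enorm_matOp_le n (U := U) f, ae_halfLine_pos] with r h1 h2
        refine h1.trans ?_
        obtain ⟨k, hk⟩ := exists_mem_block n h2
        rcases lt_or_ge k (4 ^ n) with h | h
        · rw [step_apply h _ hk, step_apply h _ hk]
          exact (Finset.sum_le_sum fun j _ => mul_le_mul_right (hle j) _).trans (hd2 k h)
        · rw [step_eq_zero h _ hk]
          exact zero_le
    _ = ENNReal.ofReal (mesh n) * ∑ k ∈ Finset.range (4 ^ n), d k := by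
        rw [lintegral_step, Finset.mul_sum]
    _ ≤ ENNReal.ofReal (mesh n) * ∑ k ∈ Finset.range (4 ^ n), c k := by gcongr
    _ = ∑ k ∈ Finset.range (4 ^ n), ∫⁻ s in block n k, ldm halfLine f s ∂halfLine := by
        rw [Finset.mul_sum]
        refine Finset.sum_congr rfl fun k _ => ?_
        rw [hc, ← mul_assoc, mul_comm (ENNReal.ofReal _), pow_mul_ofReal_mesh, one_mul]
    _ ≤ _ := sum_lintegral_block_le n _ _

/-- Hardy's lemma: summation by parts writes the difference as a combination of partial sums of `c -
b` with non-negative coefficients. -/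
theorem sum_mul_le_sum_mul_of_antitone {N : ℕ} {a b c : ℕ → ℝ}
    (ha : ∀ i j, i ≤ j → j < N → a j ≤ a i) (ha0 : ∀ i < N, 0 ≤ a i)
    (h : ∀ k ≤ N, ∑ i ∈ Finset.range k, b i ≤ ∑ i ∈ Finset.range k, c i) :
    ∑ i ∈ Finset.range N, a i * b i ≤ ∑ i ∈ Finset.range N, a i * c i := by
  -- The induction compares with the last weight times the whole partial sum; `M = 0` is set apart
  -- because there is no last weight.
  suffices H : ∀ M ≤ N, M = 0 ∨ ∃ m, M = m + 1 ∧
      a m * (∑ i ∈ Finset.range M, (c i - b i)) ≤ ∑ i ∈ Finset.range M, a i * (c i - b i) by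
    rcases H N le_rfl with h0 | ⟨m, hm, hle⟩
    · simp [h0]
    · have h1 : 0 ≤ a m * ∑ i ∈ Finset.range N, (c i - b i) := by
        refine mul_nonneg (ha0 m (by omega)) ?_
        rw [Finset.sum_sub_distrib]
        exact sub_nonneg.2 (h N le_rfl)
      have h2 := h1.trans hle
      simp only [mul_sub, Finset.sum_sub_distrib] at h2
      linarith
  intro M
  induction M with
  | zero => exact fun _ => Or.inl rfl
  | succ m ih =>
    intro hM
    refine Or.inr ⟨m, rfl, ?_⟩
    rw [Finset.sum_range_succ, Finset.sum_range_succ, mul_add]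
    refine add_le_add ?_ le_rfl
    rcases ih (by omega) with h0 | ⟨l, hl, hle⟩
    · simp [h0]
    · refine le_trans ?_ hle
      refine mul_le_mul_of_nonneg_right (ha l m (by omega) (by omega)) ?_
      rw [Finset.sum_sub_distrib]
      exact sub_nonneg.2 (h m (by omega))

/-- A condition under which the operator given by the matrix is a contraction for the norm of
the level function. -/
def LevelContr (N : ℕ) (U : ℕ → ℕ → ℝ) : Prop :=
  ∀ w : ℕ → ℝ, (∀ j, 0 ≤ w j) → ∀ C : ℝ, (∀ k ≤ N, ∑ j ∈ Finset.range k, w j ≤ C * k) →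
    ∀ k ≤ N, ∑ i ∈ Finset.range k, ∑ j ∈ Finset.range N, |U i j| * w j ≤ C * k

/-- The lengths `m i` of the parts of the blocks below `s` decrease in `i`, so Hardy's lemma carries
the bound from grid points to every `s`. -/
theorem setLIntegral_stepClass_le {n : ℕ} {v : ℕ → ℝ} {C : ℝ} (hC : 0 ≤ C)
    (h : ∀ k ≤ 4 ^ n, ∑ i ∈ Finset.range k, |v i| ≤ C * k) (s : ℝ) :
    ∫⁻ r in Iic s, ‖stepClass n v r‖ₑ ∂halfLine ≤ ENNReal.ofReal C * ENNReal.ofReal s := by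
  set m : ℕ → ℝ := fun i => halfLine.real (block n i ∩ Iic s) with hm
  have hmfin : ∀ i, halfLine (block n i ∩ Iic s) ≠ ∞ := fun i =>
    ((measure_mono inter_subset_left).trans_lt (by
      rw [halfLine_block]; exact ENNReal.ofReal_lt_top)).ne
  have hm' : ∀ i, ENNReal.ofReal (m i) = halfLine (block n i ∩ Iic s) := fun i =>
    ENNReal.ofReal_toReal (hmfin i)
  have hform : ∀ i, m i = max 0 (min ((i + 1) * mesh n) s - i * mesh n) := fun i => by
    have : block n i ∩ Iic s = Ioc (i * mesh n) (min ((i + 1) * mesh n) s) := by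
      rw [block, Ioc_inter_Iic]
    simp only [hm, Measure.real]
    rw [this, halfLine, Measure.restrict_apply measurableSet_Ioc, inter_eq_left.2,
      Real.volume_Ioc, ENNReal.toReal_ofReal', max_comm]
    exact fun r hr => lt_of_le_of_lt (mul_nonneg (Nat.cast_nonneg i) (mesh_pos n).le) hr.1
  have hanti : Antitone m := antitone_nat_of_succ_le fun i => by
    rw [hform, hform]
    push_cast
    have hp := mesh_pos n
    refine max_le_max le_rfl ?_
    rcases le_total ((i + 1) * mesh n) s with h1 | h1
    · rw [min_eq_left h1]
      have := min_le_left (((i : ℝ) + 1 + 1) * mesh n) s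
      linarith
    · rw [min_eq_right h1]
      have := min_le_right (((i : ℝ) + 1 + 1) * mesh n) s
      linarith
  have h1 : ∫⁻ r in Iic s, ‖stepClass n v r‖ₑ ∂halfLine =
      ∑ i ∈ Finset.range (4 ^ n), ENNReal.ofReal (m i * |v i|) := by
    calc ∫⁻ r in Iic s, ‖stepClass n v r‖ₑ ∂halfLine
        = ∫⁻ r in Iic s, step n (fun k => ‖v k‖ₑ) r ∂halfLine := by
          refine lintegral_congr_ae (ae_restrict_of_ae ?_)
          filter_upwards [coeFn_stepClass n v, ae_halfLine_pos] with r h1 h2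
          rw [h1, enorm_step v h2]
      _ = _ := by
          simp only [step]
          rw [lintegral_finsetSum _ fun i _ =>
            measurable_const.indicator (measurableSet_block n i)]
          refine Finset.sum_congr rfl fun i _ => ?_
          rw [lintegral_indicator (measurableSet_block n i), setLIntegral_const,
            Measure.restrict_apply (measurableSet_block n i), ← hm',
            ENNReal.ofReal_mul measureReal_nonneg, mul_comm, Real.enorm_eq_ofReal_abs]
  rw [h1, ← ENNReal.ofReal_sum_of_nonneg fun i _ => mul_nonneg measureReal_nonneg (abs_nonneg _)]
  have h2 := sum_mul_le_sum_mul_of_antitone (N := 4 ^ n) (a := m) (b := fun i => |v i|)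
    (c := fun _ => C) (fun i j hij _ => hanti hij) (fun i _ => measureReal_nonneg)
    (fun k hk => by simpa [mul_comm] using h k hk)
  refine (ENNReal.ofReal_le_ofReal h2).trans ?_
  rw [← Finset.sum_mul, mul_comm, ENNReal.ofReal_mul hC]
  gcongr 1
  rw [ENNReal.ofReal_sum_of_nonneg fun i _ => measureReal_nonneg]
  rw [Finset.sum_congr rfl fun i _ => hm' i, ← halfLine_Iic s, ← measure_biUnion_finset
    (fun i _ j _ hij => (pairwise_disjoint_block n hij).mono inter_subset_left inter_subset_left)
    (fun i _ => (measurableSet_block n i).inter measurableSet_Iic)]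
  exact measure_mono (iUnion₂_subset fun i _ => inter_subset_right)

theorem level_matOp_le (n : ℕ) {U : ℕ → ℕ → ℝ} (hU : LevelContr (4 ^ n) U)
    {f : ℝ →ₘ[halfLine] ℝ} (hf : (coupleLevel halfLine).norm₁ f < ∞) :
    (coupleLevel halfLine).norm₁ (matOp n U f) ≤ (coupleLevel halfLine).norm₁ f := by
  set C := (coupleLevel halfLine).norm₁ f with hC
  have hsum : ∀ k ≤ 4 ^ n, ∑ j ∈ Finset.range k, |avg n f j| ≤ C.toReal * k := fun k _ => by
    have h1 : ∑ j ∈ Finset.range k, ‖avg n f j‖ₑ ≤ C * k := by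
      calc ∑ j ∈ Finset.range k, ‖avg n f j‖ₑ
          ≤ ∑ j ∈ Finset.range k, 2 ^ n * ∫⁻ s in block n j, ‖f s‖ₑ ∂halfLine :=
            Finset.sum_le_sum fun j _ => enorm_avg_le n f j
        _ = 2 ^ n * ∫⁻ s in Iic (k * mesh n), ‖f s‖ₑ ∂halfLine := by
            rw [← Finset.mul_sum, sum_lintegral_block]
        _ ≤ 2 ^ n * (C * ENNReal.ofReal (k * mesh n)) := by
            rw [← halfLine_Iic]
            gcongr
            exact setLIntegral_le_coupleLevel_norm₁ f _
        _ = C * k := by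
            rw [ENNReal.ofReal_mul (Nat.cast_nonneg k), ENNReal.ofReal_natCast,
              show (2 : ℝ≥0∞) ^ n * (C * (k * ENNReal.ofReal (mesh n))) =
                C * k * (2 ^ n * ENNReal.ofReal (mesh n)) by ring, pow_mul_ofReal_mesh, mul_one]
    have h2 := ENNReal.toReal_mono (ENNReal.mul_ne_top hf.ne (ENNReal.natCast_ne_top k)) h1
    rw [ENNReal.toReal_sum fun _ _ => enorm_ne_top, ENNReal.toReal_mul,
      ENNReal.toReal_natCast] at h2
    simpa using h2
  refine coupleLevel_norm₁_le_iff.2 fun s => ?_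
  rw [halfLine_Iic, ← ENNReal.ofReal_toReal hf.ne]
  refine setLIntegral_stepClass_le ENNReal.toReal_nonneg (fun k hk => ?_) s
  refine le_trans (Finset.sum_le_sum fun i _ => ?_)
    (hU (fun j => |avg n f j|) (fun j => abs_nonneg _) _ hsum k hk)
  refine (Finset.abs_sum_le_sum_abs _ _).trans (le_of_eq ?_)
  exact Finset.sum_congr rfl fun j _ => abs_mul _ _

/-! ### Local bounds, Fatou property and block averaging for the three couples. -/

/-- Averaging over the dyadic intervals of order `n`. -/
noncomputable def blockAvg (n : ℕ) (g : ℝ →ₘ[halfLine] ℝ) : ℝ →ₘ[halfLine] ℝ :=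
  stepClass n (avg n g)

/-- The properties of a couple of function spaces on the half line that allow to pass from
approximating operators to a limit operator. -/
structure IsHalfLineCouple (Y : Couple (ℝ →ₘ[halfLine] ℝ)) : Prop where
  seminorm : Y.IsSeminorm
  loc₀ : ∀ g R, ∫⁻ s in Iic R, ‖g s‖ₑ ∂halfLine ≤ Y.norm₀ g
  loc₁ : ∀ g R, ∫⁻ s in Iic R, ‖g s‖ₑ ∂halfLine ≤ Y.norm₁ g * ENNReal.ofReal R
  fatou₀ : ∀ (g : ℕ → ℝ →ₘ[halfLine] ℝ) (g' : ℝ →ₘ[halfLine] ℝ) (C : ℝ≥0∞),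
    (∀ n, Y.norm₀ (g n) ≤ C) → (∀ᵐ s ∂halfLine, Tendsto (fun n => g n s) atTop (𝓝 (g' s))) →
    Y.norm₀ g' ≤ C
  fatou₁ : ∀ (g : ℕ → ℝ →ₘ[halfLine] ℝ) (g' : ℝ →ₘ[halfLine] ℝ) (C : ℝ≥0∞),
    (∀ n, Y.norm₁ (g n) ≤ C) → (∀ᵐ s ∂halfLine, Tendsto (fun n => g n s) atTop (𝓝 (g' s))) →
    Y.norm₁ g' ≤ C
  avg₀ : ∀ n g, Y.norm₀ g < ∞ → Y.norm₀ (blockAvg n g) ≤ Y.norm₀ g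
  avg₁ : ∀ n g, Y.norm₁ g < ∞ → Y.norm₁ (blockAvg n g) ≤ Y.norm₁ g

theorem locInt_add {f g : ℝ →ₘ[halfLine] ℝ} (hf : LocInt f) (hg : LocInt g) :
    LocInt (f + g : ℝ →ₘ[halfLine] ℝ) := fun R => by
  refine lt_of_le_of_lt ?_ (ENNReal.add_lt_top.2 ⟨hf R, hg R⟩)
  rw [← lintegral_add_left f.measurable.enorm]
  refine lintegral_mono_ae (ae_restrict_of_ae ?_)
  filter_upwards [AEEqFun.coeFn_add f g] with s hs
  rw [hs]
  exact enorm_add_le _ _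

theorem IsHalfLineCouple.locInt {Y : Couple (ℝ →ₘ[halfLine] ℝ)} (hY : IsHalfLineCouple Y)
    {g : ℝ →ₘ[halfLine] ℝ} (hg : g ∈ Y.sum) : LocInt g := by
  obtain ⟨g₀, g₁, h₀, h₁, rfl⟩ := hY.seminorm.exists_add_eq hg
  exact locInt_add (fun R => (hY.loc₀ g₀ R).trans_lt h₀) fun R =>
    (hY.loc₁ g₁ R).trans_lt (ENNReal.mul_lt_top h₁ ENNReal.ofReal_lt_top)

theorem stepClass_congr {n : ℕ} {v w : ℕ → ℝ} (h : ∀ k < 4 ^ n, v k = w k) :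
    stepClass n v = stepClass n w := by
  have : step n v = step n w := by
    ext s
    exact Finset.sum_congr rfl fun k hk => by rw [h k (Finset.mem_range.1 hk)]
  simp only [stepClass, this]

/-- Block averaging belongs to the identity matrix, so its norm bounds are instances of those for
matrices. -/
theorem matOp_ite (n : ℕ) (g : ℝ →ₘ[halfLine] ℝ) :
    matOp n (fun i j => if i = j then 1 else 0) g = blockAvg n g := by
  refine stepClass_congr fun k hk => ?_
  simp [hk]

theorem sum_enorm_ite_row {N i : ℕ} :
    ∑ j ∈ Finset.range N, ‖(if i = j then 1 else 0 : ℝ)‖ₑ ≤ 1 := by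
  have : ∀ j, ‖(if i = j then 1 else 0 : ℝ)‖ₑ = if i = j then 1 else 0 := fun j => by
    split_ifs <;> simp
  simp only [this, Finset.sum_ite_eq]
  split_ifs <;> simp

theorem sum_enorm_ite_col {N j : ℕ} :
    ∑ i ∈ Finset.range N, ‖(if i = j then 1 else 0 : ℝ)‖ₑ ≤ 1 := by
  simpa only [eq_comm] using sum_enorm_ite_row (N := N) (i := j)

theorem lintegral_fatou {ρ : Measure ℝ} {g : ℕ → ℝ → ℝ} (hg : ∀ n, Measurable (g n)) {g' : ℝ → ℝ}
    {C : ℝ≥0∞} (hC : ∀ n, ∫⁻ s, ‖g n s‖ₑ ∂ρ ≤ C)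
    (h : ∀ᵐ s ∂ρ, Tendsto (fun n => g n s) atTop (𝓝 (g' s))) : ∫⁻ s, ‖g' s‖ₑ ∂ρ ≤ C := by
  calc ∫⁻ s, ‖g' s‖ₑ ∂ρ = ∫⁻ s, liminf (fun n => ‖g n s‖ₑ) atTop ∂ρ := by
        refine lintegral_congr_ae ?_
        filter_upwards [h] with s hs
        exact hs.enorm.liminf_eq.symm
    _ ≤ liminf (fun n => ∫⁻ s, ‖g n s‖ₑ ∂ρ) atTop := lintegral_liminf_le fun n => (hg n).enorm
    _ ≤ C := liminf_le_of_frequently_le' (Frequently.of_forall hC)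

theorem eLpNorm_top_fatou {ρ : Measure ℝ} {g : ℕ → ℝ → ℝ} {g' : ℝ → ℝ}
    {C : ℝ≥0∞} (hC : ∀ n, eLpNorm (g n) ∞ ρ ≤ C)
    (h : ∀ᵐ s ∂ρ, Tendsto (fun n => g n s) atTop (𝓝 (g' s))) : eLpNorm g' ∞ ρ ≤ C := by
  rw [eLpNorm_exponent_top]
  refine essSup_le_of_ae_le _ ?_
  have h1 : ∀ᵐ s ∂ρ, ∀ n, ‖g n s‖ₑ ≤ C := ae_all_iff.2 fun n => by
    have := hC n
    rw [eLpNorm_exponent_top] at this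
    exact (ae_le_eLpNormEssSup (f := g n)).mono fun s hs => hs.trans this
  filter_upwards [h, h1] with s h2 h3
  exact le_of_tendsto' h2.enorm h3

/-- The lower limit of the majorants is itself decreasing and dominates the limit function almost
everywhere. -/
theorem ldm_le_liminf {ρ : Measure ℝ} {g : ℕ → ℝ → ℝ} {g' : ℝ → ℝ}
    (h : ∀ᵐ s ∂ρ, Tendsto (fun n => g n s) atTop (𝓝 (g' s))) (x : ℝ) :
    ldm ρ g' x ≤ liminf (fun n => ldm ρ (g n) x) atTop := by
  refine ldm_le_of_ae_le (w := fun x => liminf (fun n => ldm ρ (g n) x) atTop)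
    (fun a b hab => liminf_le_liminf (Eventually.of_forall fun n => ldm_antitone ρ (g n) hab)) ?_ x
  filter_upwards [h, ae_all_iff.2 fun n => ae_enorm_le_ldm ρ (g n)] with s h1 h2
  rw [← h1.enorm.liminf_eq]
  exact liminf_le_liminf (Eventually.of_forall h2)

theorem isHalfLineCouple_coupleL : IsHalfLineCouple (coupleL halfLine) where
  seminorm := isSeminorm_coupleL _
  loc₀ g R := by
    rw [coupleL_norm₀]
    exact lintegral_mono' Measure.restrict_le_self le_rfl
  loc₁ g R := by
    rw [← halfLine_Iic, ← setLIntegral_const]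
    exact lintegral_mono_ae (ae_restrict_of_ae (ae_le_eLpNormEssSup (f := g)))
  fatou₀ g g' C hC h := by
    simp only [coupleL_norm₀] at hC ⊢
    exact lintegral_fatou (fun n => (g n).measurable) hC h
  fatou₁ g g' C hC h := eLpNorm_top_fatou hC h
  avg₀ n g _ := by
    rw [← matOp_ite, coupleL_norm₀, coupleL_norm₀]
    exact lintegral_matOp_le n (fun j _ => sum_enorm_ite_col) g
  avg₁ n g _ := by
    rw [← matOp_ite]
    exact eLpNorm_top_matOp_le n (fun i _ => sum_enorm_ite_row) g

theorem isHalfLineCouple_coupleTilde : IsHalfLineCouple (coupleTilde halfLine) where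
  seminorm := isSeminorm_coupleTilde _
  loc₀ g R := by
    rw [coupleTilde_norm₀]
    exact (lintegral_mono' Measure.restrict_le_self le_rfl).trans
      (lintegral_mono_ae (ae_enorm_le_ldm halfLine g))
  loc₁ := isHalfLineCouple_coupleL.loc₁
  fatou₀ g g' C hC h := by
    simp only [coupleTilde_norm₀] at hC ⊢
    calc _ ≤ ∫⁻ s, liminf (fun n => ldm halfLine (g n) s) atTop ∂halfLine :=
          lintegral_mono (ldm_le_liminf h)
      _ ≤ liminf (fun n => ∫⁻ s, ldm halfLine (g n) s ∂halfLine) atTop :=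
          lintegral_liminf_le fun n => measurable_ldm _ _
      _ ≤ C := liminf_le_of_frequently_le' (Frequently.of_forall hC)
  fatou₁ := isHalfLineCouple_coupleL.fatou₁
  avg₀ n g _ := by
    rw [← matOp_ite, coupleTilde_norm₀, coupleTilde_norm₀]
    refine lintegral_ldm_matOp_le n (fun c hc => ⟨c, fun i _ j _ hij => hc hij, fun i hi => ?_,
      le_rfl⟩) g
    rw [Finset.sum_eq_single i]
    · simp
    · intro j _ hj
      simp [hj.symm]
    · intro h
      exact absurd (Finset.mem_range.2 hi) h
  avg₁ := isHalfLineCouple_coupleL.avg₁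

theorem isHalfLineCouple_coupleLevel : IsHalfLineCouple (coupleLevel halfLine) where
  seminorm := isSeminorm_coupleLevel _
  loc₀ := isHalfLineCouple_coupleL.loc₀
  loc₁ g R := by
    rw [← halfLine_Iic]
    exact setLIntegral_le_coupleLevel_norm₁ g R
  fatou₀ := isHalfLineCouple_coupleL.fatou₀
  fatou₁ g g' C hC h := coupleLevel_norm₁_le_iff.2 fun x =>
    lintegral_fatou (fun n => (g n).measurable)
      (fun n => coupleLevel_norm₁_le_iff.1 (hC n) x) (ae_restrict_of_ae h)
  avg₀ := isHalfLineCouple_coupleL.avg₀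
  avg₁ n g hg := by
    rw [← matOp_ite]
    refine level_matOp_le n (fun w _ C hC k hk => ?_) hg
    refine le_trans (Finset.sum_le_sum (g := w) fun i hi => le_of_eq ?_) (hC k hk)
    have hi' : i < 4 ^ n := (Finset.mem_range.1 hi).trans_le hk
    rw [Finset.sum_eq_single i]
    · simp
    · intro j _ hj
      simp [hj.symm]
    · intro h
      exact absurd (Finset.mem_range.2 hi') h

/-! ### Separation of block averages and limit operators along an ultrafilter. -/

/-- The limit of a bounded sequence along a free ultrafilter. -/
noncomputable def ulim (u : ℕ → ℝ) : ℝ := limUnder (hyperfilter ℕ : Filter ℕ) u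

theorem tendsto_ulim {u : ℕ → ℝ} {B : ℝ} (h : ∀ n, |u n| ≤ B) :
    Tendsto u (hyperfilter ℕ) (𝓝 (ulim u)) := by
  refine tendsto_nhds_limUnder ?_
  obtain ⟨l, -, hl⟩ := (isCompact_Icc (a := -B) (b := B)).ultrafilter_le_nhds
    ((hyperfilter ℕ).map u) (by
      rw [le_principal_iff]
      exact Filter.mem_map.2 (Filter.univ_mem' fun n => abs_le.1 (h n)))
  exact ⟨l, hl⟩

theorem tendsto_mesh : Tendsto mesh atTop (𝓝 0) := by
  have : mesh = fun n => (2⁻¹ : ℝ) ^ n := by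
    ext n
    simp [mesh, inv_pow]
  rw [this]
  exact tendsto_pow_atTop_nhds_zero_of_lt_one (by norm_num) (by norm_num)

/-- The first `4 ^ n` blocks fill `(0, 2 ^ n]`: as `n` grows the mesh tends to zero and the half
line is exhausted. -/
theorem four_pow_mul_mesh (n : ℕ) : (4 : ℝ) ^ n * mesh n = 2 ^ n := by
  rw [show (4 : ℝ) = 2 * 2 by norm_num, mul_pow, mul_assoc, pow_mul_mesh, mul_one]

/-- Since `s` lies in the interval of the difference quotient, the first-order errors at the two
endpoints sum to at most `ε / 2` times its length. -/
theorem tendsto_step_slope {F : ℝ → ℝ} {d s : ℝ} (hs : 0 < s) (h : HasDerivAt F d s) :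
    Tendsto (fun m => step m
      (fun k => 2 ^ m * (F ((k + 1) * mesh m) - F (k * mesh m))) s) atTop (𝓝 d) := by
  rw [Metric.tendsto_atTop]
  intro ε hε
  have h1 := (hasDerivAt_iff_isLittleO.1 h).def (half_pos hε)
  obtain ⟨δ, hδ, hb⟩ := Metric.eventually_nhds_iff.1 h1
  -- From then on the block containing `s` is one of the first `4 ^ m`, outside of which the step
  -- function is zero.
  have h2 : ∀ᶠ m : ℕ in atTop, s ≤ (2 : ℝ) ^ m :=
    (tendsto_pow_atTop_atTop_of_one_lt one_lt_two).eventually_ge_atTop s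
  obtain ⟨M, hM⟩ := eventually_atTop.1 ((tendsto_mesh.eventually_lt_const hδ).and h2)
  refine ⟨M, fun m hm => ?_⟩
  obtain ⟨h3, h4⟩ := hM m hm
  obtain ⟨k, hk⟩ := exists_mem_block m hs
  have hp := mesh_pos m
  have hk4 : k < 4 ^ m := by
    have : (k : ℝ) * mesh m < 4 ^ m * mesh m := by
      rw [four_pow_mul_mesh]
      exact hk.1.trans_le h4
    exact_mod_cast lt_of_mul_lt_mul_right this hp.le
  rw [step_apply hk4 _ hk, Real.dist_eq]
  obtain ⟨ha, hb'⟩ := hk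
  set a := (k : ℝ) * mesh m
  have hbe : ((k : ℝ) + 1) * mesh m = a + mesh m := by ring
  rw [hbe] at hb' ⊢
  have e1 := hb (y := a) (by rw [Real.dist_eq, abs_lt]; constructor <;> linarith)
  have e2 := hb (y := a + mesh m) (by rw [Real.dist_eq, abs_lt]; constructor <;> linarith)
  rw [Real.norm_eq_abs, Real.norm_eq_abs, smul_eq_mul, abs_of_neg (by linarith : a - s < 0)] at e1
  rw [Real.norm_eq_abs, Real.norm_eq_abs, smul_eq_mul,
    abs_of_nonneg (by linarith : 0 ≤ a + mesh m - s)] at e2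
  have e3 : 2 ^ m * (F (a + mesh m) - F a) - d = 2 ^ m *
      ((F (a + mesh m) - F s - (a + mesh m - s) * d) - (F a - F s - (a - s) * d)) := by
    have := pow_mul_mesh m
    linear_combination d * this
  rw [e3, abs_mul, abs_of_pos (by positivity : (0 : ℝ) < 2 ^ m)]
  calc _ ≤ 2 ^ m * (ε / 2 * (a + mesh m - s) + ε / 2 * -(a - s)) := by
        gcongr
        exact (abs_sub _ _).trans (add_le_add e2 e1)
    _ = ε / 2 * (2 ^ m * mesh m) := by ring
    _ < ε := by rw [pow_mul_mesh]; linarith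

theorem ae_hasDerivAt_setIntegral {y : ℝ →ₘ[halfLine] ℝ} (hy : LocInt y) :
    ∀ᵐ s ∂halfLine, HasDerivAt (fun s => ∫ r in Iic s, y r ∂halfLine) (y s) s := by
  have hloc : LocallyIntegrable ((Ioi (0 : ℝ)).indicator y) volume := by
    intro x
    refine ⟨Iic (x + 1), Iic_mem_nhds (by linarith), ?_⟩
    rw [IntegrableOn, integrable_indicator_iff measurableSet_Ioi, IntegrableOn,
      Measure.restrict_restrict measurableSet_Ioi, Ioi_inter_Iic, ← halfLine_restrict_Iic]
    exact hy.integrableOn _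
  have h := _root_.LocallyIntegrable.ae_hasDerivAt_integral hloc
  filter_upwards [ae_restrict_of_ae h, ae_halfLine_pos] with s hs h0
  have h1 := hs 0
  rw [indicator_of_mem (show s ∈ Ioi 0 from h0)] at h1
  refine h1.congr_of_eventuallyEq ?_
  filter_upwards [Ioi_mem_nhds h0] with r hr
  rw [intervalIntegral.integral_of_le (le_of_lt hr), setIntegral_indicator measurableSet_Ioi,
    inter_eq_left.2 (Ioc_subset_Ioi_self), halfLine_restrict_Iic]

variable {V : Type*} [AddCommGroup V] [Module ℝ V]

open Couple in
/-- If the block averages of `y` cannot be separated from those of the images of `x` under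
contractions, then they are approximated by the latter. -/
theorem exists_op_avg_near {X : Couple V} (hX : X.IsSeminorm) {Y : Couple (ℝ →ₘ[halfLine] ℝ)}
    (hY : IsHalfLineCouple Y) {x : X.sum} {y : ℝ →ₘ[halfLine] ℝ} {n : ℕ}
    (h : ∀ φ : ℕ → ℝ, ∀ ε > 0, ∃ T : X.sum →ₗ[ℝ] Y.sum, OpNormLE X Y 1 T ∧
      ∑ k ∈ Finset.range (4 ^ n), φ k * avg n y k ≤
        ∑ k ∈ Finset.range (4 ^ n), φ k * avg n (T x : ℝ →ₘ[halfLine] ℝ) k + ε)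
    {δ : ℝ} (hδ : 0 < δ) :
    ∃ T : X.sum →ₗ[ℝ] Y.sum, OpNormLE X Y 1 T ∧
      ∀ k < 4 ^ n, |avg n (T x : ℝ →ₘ[halfLine] ℝ) k - avg n y k| ≤ δ := by
  set vec : (ℝ →ₘ[halfLine] ℝ) → Fin (4 ^ n) → ℝ := fun g k => avg n g k with hvec
  set S : Set (Fin (4 ^ n) → ℝ) :=
    {v | ∃ T : X.sum →ₗ[ℝ] Y.sum, OpNormLE X Y 1 T ∧ vec (T x) = v} with hS
  have hconv : Convex ℝ S := by
    rintro _ ⟨T, hT, rfl⟩ _ ⟨T', hT', rfl⟩ a b ha hb hab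
    refine ⟨a • T + b • T', hT.convex hX hY.seminorm hT' ha hb hab, ?_⟩
    ext k
    have e : (((a • T + b • T') x : Y.sum) : ℝ →ₘ[halfLine] ℝ) =
      a • (T x : ℝ →ₘ[halfLine] ℝ) + b • (T' x : ℝ →ₘ[halfLine] ℝ) := rfl
    have l1 : LocInt (a • (T x : ℝ →ₘ[halfLine] ℝ) : ℝ →ₘ[halfLine] ℝ) :=
      hY.locInt (Y.sum.smul_mem a (T x).2)
    have l2 : LocInt (b • (T' x : ℝ →ₘ[halfLine] ℝ) : ℝ →ₘ[halfLine] ℝ) :=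
      hY.locInt (Y.sum.smul_mem b (T' x).2)
    simp only [hvec, e, avg_add n l1 l2, avg_smul, Pi.add_apply, Pi.smul_apply, smul_eq_mul]
  have hmem : vec y ∈ closure S := by
    by_contra hn
    obtain ⟨f, u, h1, h2⟩ := geometric_hahn_banach_closed_point hconv.closure isClosed_closure hn
    -- The coordinates of the separating functional, extended by zero.
    set φ : ℕ → ℝ := fun k => if hk : k < 4 ^ n then f (Pi.single ⟨k, hk⟩ 1) else 0 with hφ
    have hf : ∀ g : ℝ →ₘ[halfLine] ℝ,
        f (vec g) = ∑ k ∈ Finset.range (4 ^ n), φ k * avg n g k := fun g => by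
      rw [Finset.sum_range]
      conv_lhs => rw [pi_eq_sum_univ' (vec g)]
      rw [map_sum]
      refine Finset.sum_congr rfl fun i _ => ?_
      rw [map_smul, smul_eq_mul, mul_comm]
      congr 1
      simp only [hφ, i.2, dite_true, Fin.eta]
    obtain ⟨T, hT, h3⟩ := h φ _ (sub_pos.2 h2)
    have h4 := h1 _ (subset_closure ⟨T, hT, rfl⟩)
    rw [← hf, ← hf] at h3
    linarith
  obtain ⟨_, ⟨T, hT, rfl⟩, hd⟩ := Metric.mem_closure_iff.1 hmem δ hδ
  refine ⟨T, hT, fun k hk => ?_⟩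
  have := (dist_le_pi_dist (vec y) (vec (T x)) ⟨k, hk⟩).trans hd.le
  rwa [dist_comm, Real.dist_eq] at this

theorem setIntegral_sub_eq_avg {g : ℝ →ₘ[halfLine] ℝ} (hg : LocInt g) (m k : ℕ) :
    2 ^ m * (∫ r in Iic (((k : ℝ) + 1) * mesh m), g r ∂halfLine -
      ∫ r in Iic (k * mesh m), g r ∂halfLine) = avg m g k := by
  have h1 := sum_integral_block hg m (k + 1)
  have h2 := sum_integral_block hg m k
  rw [Finset.sum_range_succ, h2] at h1
  push_cast at h1
  rw [← h1, add_sub_cancel_left, avg]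

/-- The Fatou properties concern sequences; finitely many limits along the ultrafilter are realized
simultaneously by one sequence of indices. -/
theorem exists_seq_tendsto_of_hyperfilter {N : ℕ} {v : ℕ → ℕ → ℝ} {w : ℕ → ℝ}
    (h : ∀ k, Tendsto (fun n => v n k) (hyperfilter ℕ) (𝓝 (w k))) :
    ∃ a : ℕ → ℕ, ∀ k < N, Tendsto (fun i => v (a i) k) atTop (𝓝 (w k)) := by
  have h1 : ∀ i : ℕ, ∃ n, ∀ k ∈ Finset.range N, dist (v n k) (w k) < 1 / ((i : ℝ) + 1) :=
    fun i => by
      have : ∀ᶠ n in (hyperfilter ℕ : Filter ℕ), ∀ k ∈ Finset.range N,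
          dist (v n k) (w k) < 1 / ((i : ℝ) + 1) :=
        (Filter.eventually_all_finset _).2 fun k _ =>
          (h k).eventually (Metric.ball_mem_nhds _ (by positivity))
      exact this.exists
  choose a ha using h1
  refine ⟨a, fun k hk => ?_⟩
  rw [tendsto_iff_dist_tendsto_zero]
  exact squeeze_zero (fun _ => dist_nonneg) (fun i => (ha i k (Finset.mem_range.2 hk)).le)
    tendsto_one_div_add_atTop_nhds_zero_nat

/-- A norm bound for the derivative of the limit of the primitives. -/
theorem norm_le_of_hasDerivAt_of_tendsto {p : (ℝ →ₘ[halfLine] ℝ) → ℝ≥0∞} {C : ℝ≥0∞}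
    (hp : ∀ (g : ℕ → ℝ →ₘ[halfLine] ℝ) (g' : ℝ →ₘ[halfLine] ℝ), (∀ n, p (g n) ≤ C) →
      (∀ᵐ s ∂halfLine, Tendsto (fun n => g n s) atTop (𝓝 (g' s))) → p g' ≤ C)
    {g : ℕ → ℝ →ₘ[halfLine] ℝ} (hloc : ∀ n, LocInt (g n)) (hg : ∀ n m, p (blockAvg m (g n)) ≤ C)
    {F : ℝ → ℝ}
    (hF : ∀ s, Tendsto (fun n => ∫ r in Iic s, g n r ∂halfLine) (hyperfilter ℕ) (𝓝 (F s)))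
    {g' : ℝ →ₘ[halfLine] ℝ} (hd : ∀ᵐ s ∂halfLine, HasDerivAt F (g' s) s) : p g' ≤ C := by
  set w : ℕ → ℕ → ℝ := fun m k => 2 ^ m * (F (((k : ℝ) + 1) * mesh m) - F (k * mesh m)) with hw
  -- Fatou is used twice: at fixed mesh along indices realizing the limits of the averages, then for
  -- mesh tending to zero, where the slopes of `F` tend to its derivative.
  refine hp (fun m => stepClass m (w m)) g' (fun m => ?_) ?_
  · have h1 : ∀ k, Tendsto (fun n => avg m (g n) k) (hyperfilter ℕ) (𝓝 (w m k)) := fun k => by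
      refine Tendsto.congr (fun n => setIntegral_sub_eq_avg (hloc n) m k) ?_
      exact ((hF _).sub (hF _)).const_mul _
    obtain ⟨a, ha⟩ := exists_seq_tendsto_of_hyperfilter (N := 4 ^ m) h1
    refine hp (fun i => blockAvg m (g (a i))) _ (fun i => hg _ _) ?_
    have h2 : ∀ᵐ s ∂halfLine, ∀ i, blockAvg m (g (a i)) s = step m (avg m (g (a i))) s :=
      ae_all_iff.2 fun i => coeFn_stepClass _ _
    filter_upwards [h2, coeFn_stepClass m (w m), ae_halfLine_pos] with s h3 h4 h5
    simp only [h3, h4]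
    obtain ⟨k, hk⟩ := exists_mem_block m h5
    rcases lt_or_ge k (4 ^ m) with h | h
    · simp only [step_apply h _ hk]
      exact ha k h
    · simp only [step_eq_zero h _ hk]
      exact tendsto_const_nhds
  · have h2 : ∀ᵐ s ∂halfLine, ∀ m, stepClass m (w m) s = step m (w m) s :=
      ae_all_iff.2 fun i => coeFn_stepClass _ _
    filter_upwards [h2, hd, ae_halfLine_pos] with s h3 h4 h5
    simp only [h3]
    exact tendsto_step_slope h5 h4

theorem Couple.exists_op' {W : Type*} [AddCommGroup W] [Module ℝ W] {X : Couple V} {Y : Couple W}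
    (hX : X.IsSeminorm) {c : ℝ≥0} (τ : X.sum → W) (hadd : ∀ f g, τ (f + g) = τ f + τ g)
    (hsmul : ∀ (a : ℝ) f, τ (a • f) = a • τ f)
    (h₀ : ∀ f : X.sum, X.norm₀ f < ∞ → Y.norm₀ (τ f) ≤ c * X.norm₀ f)
    (h₁ : ∀ f : X.sum, X.norm₁ f < ∞ → Y.norm₁ (τ f) ≤ c * X.norm₁ f) :
    ∃ T : X.sum →ₗ[ℝ] Y.sum, OpNormLE X Y c T ∧ ∀ x, (T x : W) = τ x := by
  classical
  set σ : V → W := fun f => if h : f ∈ X.sum then τ ⟨f, h⟩ else 0 with hσ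
  have e : ∀ f (h : f ∈ X.sum), σ f = τ ⟨f, h⟩ := fun f h => by simp [hσ, h]
  obtain ⟨T, hT, h⟩ := exists_op (Y := Y) (c := c) hX σ
    (fun f hf g hg => by rw [e f hf, e g hg, e _ (X.sum.add_mem hf hg), ← hadd]; rfl)
    (fun a f hf => by rw [e f hf, e _ (X.sum.smul_mem a hf), ← hsmul]; rfl)
    (fun f hf => by rw [e f (mem_sum_of_norm₀ hf)]; exact h₀ _ hf)
    (fun f hf => by rw [e f (mem_sum_of_norm₁ hf)]; exact h₁ _ hf)
  exact ⟨T, hT, fun x => by rw [h x, e _ x.2]⟩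

theorem setIntegral_add_coeFn {f g : ℝ →ₘ[halfLine] ℝ} (hf : LocInt f) (hg : LocInt g) (s : ℝ) :
    ∫ r in Iic s, (f + g : ℝ →ₘ[halfLine] ℝ) r ∂halfLine =
      ∫ r in Iic s, f r ∂halfLine + ∫ r in Iic s, g r ∂halfLine := by
  rw [← integral_add (hf.integrableOn s) (hg.integrableOn s)]
  exact integral_congr_ae (ae_restrict_of_ae (AEEqFun.coeFn_add f g))

theorem setIntegral_smul_coeFn (c : ℝ) (f : ℝ →ₘ[halfLine] ℝ) (s : ℝ) :
    ∫ r in Iic s, (c • f : ℝ →ₘ[halfLine] ℝ) r ∂halfLine = c * ∫ r in Iic s, f r ∂halfLine := by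
  rw [← integral_const_mul c]
  exact integral_congr_ae (ae_restrict_of_ae (AEEqFun.coeFn_smul c f))

/-- Limits of the primitives of a locally bounded sequence are differentiable almost
everywhere. -/
theorem ae_differentiableAt_ulim {g : ℕ → ℝ →ₘ[halfLine] ℝ} {B : ℝ → ℝ}
    (hloc : ∀ n, LocInt (g n)) (hB : ∀ s n, ∫ r in Iic s, |g n r| ∂halfLine ≤ B s) :
    ∀ᵐ s, DifferentiableAt ℝ (fun s => ulim fun n => ∫ r in Iic s, g n r ∂halfLine) s := by
  set P : ℝ → ℝ := fun s => ulim fun n => ∫ r in Iic s, |g n r| ∂halfLine with hP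
  set F : ℝ → ℝ := fun s => ulim fun n => ∫ r in Iic s, g n r ∂halfLine with hF
  have tP : ∀ s, Tendsto (fun n => ∫ r in Iic s, |g n r| ∂halfLine) (hyperfilter ℕ) (𝓝 (P s)) :=
    fun s => tendsto_ulim (B := B s) fun n => by
      rw [abs_of_nonneg (integral_nonneg fun _ => abs_nonneg _)]
      exact hB s n
  have tF : ∀ s, Tendsto (fun n => ∫ r in Iic s, g n r ∂halfLine) (hyperfilter ℕ) (𝓝 (F s)) :=
    fun s => tendsto_ulim (B := B s) fun n => (abs_integral_le_integral_abs).trans (hB s n)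
  -- `F` is the difference of `P` and `P - F`, limits of the primitives of `|g n|` and `|g n| - g
  -- n`, both monotone.
  have mP : Monotone P := fun s t hst => le_of_tendsto_of_tendsto' (tP s) (tP t) fun n =>
    setIntegral_mono_set ((hloc n).integrableOn t).abs (Eventually.of_forall fun _ => abs_nonneg _)
      (Iic_subset_Iic.2 hst).eventuallyLE
  have mQ : Monotone fun s => P s - F s := fun s t hst =>
    le_of_tendsto_of_tendsto' ((tP s).sub (tF s)) ((tP t).sub (tF t)) fun n => by
      rw [← integral_sub ((hloc n).integrableOn s).abs ((hloc n).integrableOn s),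
        ← integral_sub ((hloc n).integrableOn t).abs ((hloc n).integrableOn t)]
      exact setIntegral_mono_set (((hloc n).integrableOn t).abs.sub ((hloc n).integrableOn t))
        (Eventually.of_forall fun _ => sub_nonneg.2 (le_abs_self _))
        (Iic_subset_Iic.2 hst).eventuallyLE
  filter_upwards [mP.ae_differentiableAt, mQ.ae_differentiableAt] with s h1 h2
  have := h1.sub h2
  refine this.congr_of_eventuallyEq (Eventually.of_forall fun t => ?_)
  simp

open Couple in
-- Primitives of `T n f` are bounded at each point uniformly in `n`, so they converge along the
-- ultrafilter to a function differentiable almost everywhere, whose derivative is the new operator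
-- at `f`. Uniqueness of derivatives gives linearity. A singular part of the limit may be lost for
-- general `f`, but at `x` the limit agrees with the primitive of `y` at the dyadic points, and
-- these determine the derivative.
theorem exists_op_of_avg_tendsto {X : Couple V} (hX : X.IsSeminorm)
    {Y : Couple (ℝ →ₘ[halfLine] ℝ)} (hY : IsHalfLineCouple Y) {x : X.sum} {y : ℝ →ₘ[halfLine] ℝ}
    (hy : LocInt y) (T : ℕ → X.sum →ₗ[ℝ] Y.sum) (hT : ∀ n, OpNormLE X Y 1 (T n))
    (hTx : ∀ m j : ℕ, j ≤ 4 ^ m → Tendsto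
      (fun n => ∫ r in Iic (j * mesh m), (T n x : ℝ →ₘ[halfLine] ℝ) r ∂halfLine) atTop
      (𝓝 (∫ r in Iic (j * mesh m), y r ∂halfLine))) :
    ∃ T : X.sum →ₗ[ℝ] Y.sum, OpNormLE X Y 1 T ∧ (T x : ℝ →ₘ[halfLine] ℝ) = y := by
  have hloc : ∀ n f, LocInt (T n f : ℝ →ₘ[halfLine] ℝ) := fun n f => hY.locInt (T n f).2
  have hbd : ∀ f : X.sum, ∃ B : ℝ → ℝ, ∀ s n,
      ∫ r in Iic s, |(T n f : ℝ →ₘ[halfLine] ℝ) r| ∂halfLine ≤ B s := fun f => by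
    obtain ⟨f₀, f₁, h₀, h₁, h⟩ := hX.exists_add_eq f.2
    have e : f = ⟨f₀, mem_sum_of_norm₀ h₀⟩ + ⟨f₁, mem_sum_of_norm₁ h₁⟩ := Subtype.ext h.symm
    refine ⟨fun s => (X.norm₀ f₀ + X.norm₁ f₁ * ENNReal.ofReal s).toReal, fun s n => ?_⟩
    have i₀ : X.norm₀ ((⟨f₀, mem_sum_of_norm₀ h₀⟩ : X.sum) : V) < ∞ := h₀
    have i₁ : X.norm₁ ((⟨f₁, mem_sum_of_norm₁ h₁⟩ : X.sum) : V) < ∞ := h₁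
    have h2 : ∫⁻ r in Iic s, ‖(T n f : ℝ →ₘ[halfLine] ℝ) r‖ₑ ∂halfLine ≤
        X.norm₀ f₀ + X.norm₁ f₁ * ENNReal.ofReal s := by
      set g₀ := (T n ⟨f₀, mem_sum_of_norm₀ h₀⟩ : ℝ →ₘ[halfLine] ℝ) with hg₀
      set g₁ := (T n ⟨f₁, mem_sum_of_norm₁ h₁⟩ : ℝ →ₘ[halfLine] ℝ) with hg₁
      have e2 : (T n f : ℝ →ₘ[halfLine] ℝ) = g₀ + g₁ := by rw [e, map_add]; rfl
      rw [e2]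
      calc _ ≤ ∫⁻ r in Iic s, ‖g₀ r‖ₑ + ‖g₁ r‖ₑ ∂halfLine := by
            refine lintegral_mono_ae (ae_restrict_of_ae ?_)
            filter_upwards [AEEqFun.coeFn_add g₀ g₁] with r hr
            rw [hr]
            exact enorm_add_le _ _
        _ = _ := lintegral_add_left g₀.measurable.enorm _
        _ ≤ _ := by
            refine add_le_add ((hY.loc₀ g₀ s).trans ((hT n).norm₀_le i₀)) ?_
            exact (hY.loc₁ g₁ s).trans (mul_le_mul_left ((hT n).norm₁_le i₁) _)
    have h3 : ∫ r in Iic s, |(T n f : ℝ →ₘ[halfLine] ℝ) r| ∂halfLine =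
        (∫⁻ r in Iic s, ‖(T n f : ℝ →ₘ[halfLine] ℝ) r‖ₑ ∂halfLine).toReal :=
      integral_norm_eq_lintegral_enorm
        (T n f : ℝ →ₘ[halfLine] ℝ).aestronglyMeasurable.restrict
    rw [h3]
    exact ENNReal.toReal_mono (ENNReal.add_lt_top.2
      ⟨h₀, ENNReal.mul_lt_top h₁ ENNReal.ofReal_lt_top⟩).ne h2
  choose B hB using hbd
  set F : X.sum → ℝ → ℝ := fun f s =>
    ulim fun n => ∫ r in Iic s, (T n f : ℝ →ₘ[halfLine] ℝ) r ∂halfLine with hF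
  have tF : ∀ f s, Tendsto (fun n => ∫ r in Iic s, (T n f : ℝ →ₘ[halfLine] ℝ) r ∂halfLine)
      (hyperfilter ℕ) (𝓝 (F f s)) :=
    fun f s => tendsto_ulim (B := B f s) fun n =>
      (abs_integral_le_integral_abs).trans (hB f s n)
  have dF : ∀ f, ∀ᵐ s ∂halfLine, DifferentiableAt ℝ (F f) s := fun f =>
    ae_restrict_of_ae (ae_differentiableAt_ulim (fun n => hloc n f) (hB f))
  set τ : X.sum → ℝ →ₘ[halfLine] ℝ := fun f =>
    AEEqFun.mk (deriv (F f)) (measurable_deriv _).aestronglyMeasurable with hτ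
  have hd : ∀ f, ∀ᵐ s ∂halfLine, HasDerivAt (F f) (τ f s) s := fun f => by
    filter_upwards [dF f, AEEqFun.coeFn_mk (deriv (F f))
      (measurable_deriv (F f)).aestronglyMeasurable] with s h1 h2
    simp only [hτ, h2]
    exact h1.hasDerivAt
  have Fadd : ∀ f g, F (f + g) = fun s => F f s + F g s := fun f g => by
    ext s
    refine tendsto_nhds_unique (tF (f + g) s) (((tF f s).add (tF g s)).congr fun n => ?_)
    rw [map_add]
    exact (setIntegral_add_coeFn (hloc n f) (hloc n g) s).symm
  have Fsmul : ∀ (a : ℝ) f, F (a • f) = fun s => a * F f s := fun a f => by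
    ext s
    refine tendsto_nhds_unique (tF (a • f) s) (((tF f s).const_mul a).congr fun n => ?_)
    rw [map_smul]
    exact (setIntegral_smul_coeFn a _ s).symm
  obtain ⟨S, hS, hSτ⟩ := exists_op' (Y := Y) (c := 1) hX τ
    (fun f g => by
      refine AEEqFun.ext ?_
      filter_upwards [hd f, hd g, hd (f + g), AEEqFun.coeFn_add (τ f) (τ g)] with s h1 h2 h3 h4
      rw [Fadd] at h3
      rw [h4]
      exact h3.unique (h1.add h2))
    (fun a f => by
      refine AEEqFun.ext ?_
      filter_upwards [hd f, hd (a • f), AEEqFun.coeFn_smul a (τ f)] with s h1 h2 h3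
      rw [Fsmul] at h2
      rw [h3]
      exact h2.unique (h1.const_mul a))
    (fun f hf => by
      rw [ENNReal.coe_one, one_mul]
      refine norm_le_of_hasDerivAt_of_tendsto (fun g g' => hY.fatou₀ g g' _)
        (fun n => hloc n f) (fun n m => ?_) (tF f) (hd f)
      have := (hT n).norm₀_le hf
      exact (hY.avg₀ m _ (this.trans_lt hf)).trans this)
    (fun f hf => by
      rw [ENNReal.coe_one, one_mul]
      refine norm_le_of_hasDerivAt_of_tendsto (fun g g' => hY.fatou₁ g g' _)
        (fun n => hloc n f) (fun n m => ?_) (tF f) (hd f)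
      have := (hT n).norm₁_le hf
      exact (hY.avg₁ m _ (this.trans_lt hf)).trans this)
  refine ⟨S, hS, ?_⟩
  rw [hSτ]
  have Fx : ∀ m j : ℕ, j ≤ 4 ^ m → F x (j * mesh m) = ∫ r in Iic (j * mesh m), y r ∂halfLine :=
    fun m j hj => tendsto_nhds_unique (tF x _)
      ((hTx m j hj).mono_left (Nat.hyperfilter_le_atTop))
  refine AEEqFun.ext ?_
  filter_upwards [hd x, ae_hasDerivAt_setIntegral hy, ae_halfLine_pos] with s h1 h2 h3
  refine tendsto_nhds_unique (tendsto_step_slope h3 h1)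
    ((tendsto_step_slope h3 h2).congr fun m => ?_)
  refine Finset.sum_congr rfl fun k hk => ?_
  have hk := Finset.mem_range.1 hk
  have e1 := Fx m (k + 1) hk
  push_cast at e1
  simp only [e1, Fx m k hk.le]

open Couple in
/-- The existence of operators follows if block averages cannot be separated. -/
theorem exists_op_of_forall_separated {X : Couple V} (hX : X.IsSeminorm)
    {Y : Couple (ℝ →ₘ[halfLine] ℝ)} (hY : IsHalfLineCouple Y) {x : X.sum} {y : ℝ →ₘ[halfLine] ℝ}
    (hy : LocInt y)
    (h : ∀ n, ∀ φ : ℕ → ℝ, ∀ ε > 0, ∃ T : X.sum →ₗ[ℝ] Y.sum, OpNormLE X Y 1 T ∧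
      ∑ k ∈ Finset.range (4 ^ n), φ k * avg n y k ≤
        ∑ k ∈ Finset.range (4 ^ n), φ k * avg n (T x : ℝ →ₘ[halfLine] ℝ) k + ε) :
    ∃ T : X.sum →ₗ[ℝ] Y.sum, OpNormLE X Y 1 T ∧ (T x : ℝ →ₘ[halfLine] ℝ) = y := by
  -- With tolerance `(4 ^ n)⁻¹` the errors of up to `4 ^ n` blocks, each weighted by `mesh n`, sum
  -- to at most `mesh n`.
  have h2 : ∀ n : ℕ, ∃ T : X.sum →ₗ[ℝ] Y.sum, OpNormLE X Y 1 T ∧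
      ∀ k < 4 ^ n, |avg n (T x : ℝ →ₘ[halfLine] ℝ) k - avg n y k| ≤ (4 ^ n)⁻¹ :=
    fun n => exists_op_avg_near hX hY (h n) (by positivity)
  choose T hT hTx using h2
  refine exists_op_of_avg_tendsto hX hY hy T hT fun m j hj => ?_
  rw [tendsto_iff_dist_tendsto_zero]
  refine squeeze_zero' (Eventually.of_forall fun _ => dist_nonneg) ?_ tendsto_mesh
  filter_upwards [eventually_ge_atTop m] with n hn
  obtain ⟨d, rfl⟩ := Nat.exists_eq_add_of_le hn
  have e : (j : ℝ) * mesh m = ((j * 2 ^ d : ℕ) : ℝ) * mesh (m + d) := by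
    simp only [mesh, pow_add]
    push_cast
    field_simp
  have hle : j * 2 ^ d ≤ 4 ^ (m + d) := by
    rw [pow_add]
    exact Nat.mul_le_mul hj (Nat.pow_le_pow_left (by norm_num) d)
  rw [e, ← sum_integral_block (hY.locInt (T (m + d) x).2), ← sum_integral_block hy, Real.dist_eq,
    ← Finset.sum_sub_distrib]
  calc _ ≤ ∑ i ∈ Finset.range (j * 2 ^ d), mesh (m + d) * (4 ^ (m + d))⁻¹ := by
        refine (Finset.abs_sum_le_sum_abs _ _).trans (Finset.sum_le_sum fun i hi => ?_)
        rw [← mesh_mul_avg, ← mesh_mul_avg, ← mul_sub, abs_mul, abs_of_pos (mesh_pos _)]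
        exact mul_le_mul_of_nonneg_left
          (hTx _ i ((Finset.mem_range.1 hi).trans_le hle)) (mesh_pos _).le
    _ ≤ mesh (m + d) := by
        rw [Finset.sum_const, Finset.card_range, nsmul_eq_mul, mul_left_comm]
        refine mul_le_of_le_one_right (mesh_pos _).le ?_
        rw [← div_eq_mul_inv, div_le_one (by positivity)]
        exact_mod_cast hle

/-! ### Matrices that make vectors decreasing. -/

/-- Nonnegative matrices with row and column sums at most one, for which the images of the unit
vectors have decreasing partial sums. -/
structure IsOrderContr (N : ℕ) (A : ℕ → ℕ → ℝ) : Prop where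
  nonneg : ∀ i j, 0 ≤ A i j
  le_one : ∀ i j, A i j ≤ 1
  row : ∀ i < N, ∑ j ∈ Finset.range N, A i j ≤ 1
  col : ∀ j < N, ∑ i ∈ Finset.range N, A i j ≤ 1
  anti : ∀ k ≤ N, ∀ j, j + 1 < N →
    ∑ i ∈ Finset.range k, A i (j + 1) ≤ ∑ i ∈ Finset.range k, A i j

theorem IsOrderContr.anti' {N : ℕ} {A : ℕ → ℕ → ℝ} (hA : IsOrderContr N A) {k : ℕ} (hk : k ≤ N)
    {i j : ℕ} (hij : i ≤ j) (hj : j < N) :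
    ∑ l ∈ Finset.range k, A l j ≤ ∑ l ∈ Finset.range k, A l i := by
  induction j, hij using Nat.le_induction with
  | base => exact le_rfl
  | succ m _ ih => exact (hA.anti k hk m hj).trans (ih (by omega))

theorem isOrderContr_one (N : ℕ) : IsOrderContr N fun i j => if i = j then 1 else 0 where
  nonneg i j := by split_ifs <;> norm_num
  le_one i j := by split_ifs <;> norm_num
  row i hi := by simp [hi]
  col j hj := by simp [hj]
  anti k _ j _ := by
    simp only [Finset.sum_ite_eq', Finset.mem_range]
    split_ifs <;> first | omega | norm_num

/-- Averaging of the rows `l` and `l + 1`. -/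
noncomputable def averageRows (l : ℕ) (A : ℕ → ℕ → ℝ) (i j : ℕ) : ℝ :=
  if i = l ∨ i = l + 1 then (A l j + A (l + 1) j) / 2 else A i j

/-- Only the partial sum of length `l + 1` changes; it becomes the mean of its two neighbours. -/
theorem sum_averageRows (l : ℕ) (A : ℕ → ℕ → ℝ) (j k : ℕ) :
    ∑ i ∈ Finset.range k, averageRows l A i j =
      if k = l + 1 then
        (∑ i ∈ Finset.range l, A i j + ∑ i ∈ Finset.range (l + 2), A i j) / 2
      else ∑ i ∈ Finset.range k, A i j := by
  have h0 : ∀ k ≤ l, ∑ i ∈ Finset.range k, averageRows l A i j = ∑ i ∈ Finset.range k, A i j :=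
    fun k hk => Finset.sum_congr rfl fun i hi => by
      have := Finset.mem_range.1 hi
      rw [averageRows, if_neg (by omega)]
  have h1 : averageRows l A l j = (A l j + A (l + 1) j) / 2 := by simp [averageRows]
  have h1' : averageRows l A (l + 1) j = (A l j + A (l + 1) j) / 2 := by simp [averageRows]
  have h2 : ∀ d, ∑ i ∈ Finset.range (l + 2 + d), averageRows l A i j =
      ∑ i ∈ Finset.range (l + 2 + d), A i j := fun d => by
    induction d with
    | zero =>
      rw [add_zero, Finset.sum_range_succ, Finset.sum_range_succ, Finset.sum_range_succ _ (l + 1),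
        Finset.sum_range_succ _ l, h0 l le_rfl, h1, h1']
      ring
    | succ d ih =>
      rw [← add_assoc, Finset.sum_range_succ, Finset.sum_range_succ, ih, averageRows,
        if_neg (by omega)]
  split_ifs with hk
  · rw [hk, Finset.sum_range_succ, h0 l le_rfl, h1, Finset.sum_range_succ _ (l + 1),
      Finset.sum_range_succ _ l]
    ring
  · rcases lt_or_ge k (l + 1) with h | h
    · exact h0 k (by omega)
    · obtain ⟨d, rfl⟩ := Nat.exists_eq_add_of_le (show l + 2 ≤ k by omega)
      exact h2 d

theorem IsOrderContr.averageRows {N : ℕ} {A : ℕ → ℕ → ℝ} (hA : IsOrderContr N A) {l : ℕ}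
    (hl : l + 1 < N) : IsOrderContr N (averageRows l A) where
  nonneg i j := by
    have h1 := hA.nonneg i j
    have h2 := hA.nonneg l j
    have h3 := hA.nonneg (l + 1) j
    rw [CalderonMityagin.averageRows]
    split_ifs <;> linarith
  le_one i j := by
    have h1 := hA.le_one i j
    have h2 := hA.le_one l j
    have h3 := hA.le_one (l + 1) j
    rw [CalderonMityagin.averageRows]
    split_ifs <;> linarith
  row i hi := by
    simp only [CalderonMityagin.averageRows]
    split_ifs
    · rw [← Finset.sum_div, Finset.sum_add_distrib]
      have h2 := hA.row l (by omega)
      have h3 := hA.row (l + 1) hl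
      linarith
    · exact hA.row i hi
  col j hj := by
    rw [sum_averageRows, if_neg (by omega)]
    exact hA.col j hj
  anti k hk j hj := by
    rw [sum_averageRows, sum_averageRows]
    split_ifs
    · have h2 := hA.anti l (by omega) j hj
      have h3 := hA.anti (l + 2) (by omega) j hj
      linarith
    · exact hA.anti k hk j hj

theorem isClosed_isOrderContr (N : ℕ) : IsClosed {A | IsOrderContr N A} := by
  have e : {A | IsOrderContr N A} = {A | ((((∀ i j, 0 ≤ A i j) ∧ (∀ i j, A i j ≤ 1)) ∧
      (∀ i, i < N → ∑ j ∈ Finset.range N, A i j ≤ 1)) ∧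
      (∀ j, j < N → ∑ i ∈ Finset.range N, A i j ≤ 1)) ∧
      (∀ k, k ≤ N → ∀ j, j + 1 < N →
        ∑ i ∈ Finset.range k, A i (j + 1) ≤ ∑ i ∈ Finset.range k, A i j)} := by
    ext A
    exact ⟨fun h => ⟨⟨⟨⟨h.1, h.2⟩, h.3⟩, h.4⟩, h.5⟩, fun h => ⟨h.1.1.1.1, h.1.1.1.2, h.1.1.2, h.1.2,
      h.2⟩⟩
  rw [e]
  have c : ∀ i j, Continuous fun A : ℕ → ℕ → ℝ => A i j := fun i j => by fun_prop
  have hall : ∀ {ι : Type} {p : ι → (ℕ → ℕ → ℝ) → Prop}, (∀ i, IsClosed {A | p i A}) →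
      IsClosed {A | ∀ i, p i A} := fun h => by
    rw [ofPred_forall]
    exact isClosed_iInter h
  have himp : ∀ {q : Prop} {p : (ℕ → ℕ → ℝ) → Prop}, IsClosed {A | p A} →
      IsClosed {A | q → p A} := fun {q p} h => by
    by_cases hq : q <;> simp [hq, h]
  refine (((IsClosed.inter ?_ ?_).inter ?_).inter ?_).inter ?_
  · exact hall fun i => hall fun j => isClosed_le continuous_const (c i j)
  · exact hall fun i => hall fun j => isClosed_le (c i j) continuous_const
  · exact hall fun i => himp (isClosed_le (continuous_finsetSum _ fun j _ => c i j)
      continuous_const)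
  · exact hall fun j => himp (isClosed_le (continuous_finsetSum _ fun i _ => c i j)
      continuous_const)
  · exact hall fun k => himp (hall fun j => himp (isClosed_le
      (continuous_finsetSum _ fun i _ => c i (j + 1)) (continuous_finsetSum _ fun i _ => c i j)))

/-- All entries, also those outside the `N × N` corner, are bounded by zero and one, so the set is
closed in a product of unit intervals. -/
theorem isCompact_isOrderContr (N : ℕ) : IsCompact {A | IsOrderContr N A} := by
  refine IsCompact.of_isClosed_subset (isCompact_univ_pi fun _ : ℕ =>
    isCompact_univ_pi fun _ : ℕ => isCompact_Icc (a := (0 : ℝ)) (b := 1))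
    (isClosed_isOrderContr N) fun A hA i _ j _ => ⟨hA.nonneg i j, hA.le_one i j⟩

theorem sum_sum_averageRows (l : ℕ) (A : ℕ → ℕ → ℝ) (v : ℕ → ℝ) (N k : ℕ) :
    ∑ i ∈ Finset.range k, ∑ j ∈ Finset.range N, averageRows l A i j * v j =
      if k = l + 1 then
        (∑ i ∈ Finset.range l, ∑ j ∈ Finset.range N, A i j * v j +
          ∑ i ∈ Finset.range (l + 2), ∑ j ∈ Finset.range N, A i j * v j) / 2
      else ∑ i ∈ Finset.range k, ∑ j ∈ Finset.range N, A i j * v j := by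
  have h : ∀ k (B : ℕ → ℕ → ℝ), ∑ i ∈ Finset.range k, ∑ j ∈ Finset.range N, B i j * v j =
      ∑ j ∈ Finset.range N, (∑ i ∈ Finset.range k, B i j) * v j := fun k B => by
    rw [Finset.sum_comm]
    simp only [Finset.sum_mul]
  simp only [h, sum_averageRows]
  split_ifs
  · rw [← Finset.sum_add_distrib, Finset.sum_div]
    exact Finset.sum_congr rfl fun j _ => by ring
  · rfl

/-- Every vector has an image under a matrix of the class that is decreasing and has larger
partial sums. -/
theorem exists_isOrderContr_antitone (N : ℕ) (v : ℕ → ℝ) :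
    ∃ A, IsOrderContr N A ∧
      (∀ i j, i ≤ j → j < N →
        ∑ l ∈ Finset.range N, A j l * v l ≤ ∑ l ∈ Finset.range N, A i l * v l) ∧
      ∀ k ≤ N, ∑ i ∈ Finset.range k, v i ≤
        ∑ i ∈ Finset.range k, ∑ l ∈ Finset.range N, A i l * v l := by
  set S : (ℕ → ℕ → ℝ) → ℕ → ℝ := fun A k =>
    ∑ i ∈ Finset.range k, ∑ l ∈ Finset.range N, A i l * v l with hS
  have hcont : ∀ k, Continuous fun A => S A k := fun k => by
    simp only [hS]
    fun_prop
  set 𝒦 : Set (ℕ → ℕ → ℝ) := {A | IsOrderContr N A} ∩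
    {A | ∀ k ∈ Finset.range (N + 1), ∑ i ∈ Finset.range k, v i ≤ S A k} with h𝒦
  have hcomp : IsCompact 𝒦 := by
    refine (isCompact_isOrderContr N).inter_right ?_
    simp only [ofPred_forall]
    exact isClosed_biInter fun k _ => isClosed_le continuous_const (hcont k)
  have hne : 𝒦.Nonempty := ⟨_, isOrderContr_one N, fun k hk => le_of_eq <|
    Finset.sum_congr rfl fun i hi => by
      have h1 := Finset.mem_range.1 hi
      have h2 := Finset.mem_range.1 hk
      have h3 : i < N := by omega
      simp [h3]⟩
  -- The maximizer of the sum of all partial sums has a decreasing image: were an entry smaller than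
  -- the next, averaging the two rows would increase one partial sum and keep the others.
  obtain ⟨A, ⟨hA, hA2⟩, hmax⟩ := hcomp.exists_isMaxOn hne
    (f := fun A => ∑ k ∈ Finset.range (N + 1), S A k)
    (continuous_finsetSum _ fun k _ => hcont k).continuousOn
  refine ⟨A, hA, ?_, fun k hk => hA2 k (Finset.mem_range.2 (by omega))⟩
  have key : ∀ l, l + 1 < N → ∑ j ∈ Finset.range N, A (l + 1) j * v j ≤
      ∑ j ∈ Finset.range N, A l j * v j := fun l hl => by
    by_contra hlt
    push Not at hlt
    have e1 : S A (l + 1) = S A l + ∑ j ∈ Finset.range N, A l j * v j := by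
      simp only [hS, Finset.sum_range_succ]
    have e2 : S A (l + 2) = S A (l + 1) + ∑ j ∈ Finset.range N, A (l + 1) j * v j := by
      simp only [hS, Finset.sum_range_succ]
    have hform : ∀ k, S (averageRows l A) k = if k = l + 1 then (S A l + S A (l + 2)) / 2
        else S A k := fun k => sum_sum_averageRows l A v N k
    have hle : ∀ k, S A k ≤ S (averageRows l A) k := fun k => by
      rw [hform]
      split_ifs with h
      · rw [h]
        linarith
      · exact le_rfl
    have hmem : averageRows l A ∈ 𝒦 := ⟨hA.averageRows hl, fun k hk => (hA2 k hk).trans (hle k)⟩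
    have h1 : ∑ k ∈ Finset.range (N + 1), S (averageRows l A) k ≤
      ∑ k ∈ Finset.range (N + 1), S A k := hmax hmem
    refine absurd h1 (not_le.2 (Finset.sum_lt_sum (fun k _ => hle k)
      ⟨l + 1, Finset.mem_range.2 (by omega), ?_⟩))
    rw [hform, if_pos rfl]
    linarith
  intro i j hij hj
  induction j, hij using Nat.le_induction with
  | base => exact le_rfl
  | succ m _ ih => exact (key m hj).trans (ih (by omega))

/-- The sums of the first `k` entries decrease from column to column, so Hardy's lemma replaces `w`
by the constant `C`; the row sums then give `C * k`. -/
theorem IsOrderContr.levelContr {N : ℕ} {A : ℕ → ℕ → ℝ} (hA : IsOrderContr N A) :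
    LevelContr N A := by
  intro w hw C hC k hk
  rcases Nat.eq_zero_or_pos k with rfl | hk0
  · simp
  have hC0 : 0 ≤ C := by
    have := hC 1 (by omega)
    simp only [Finset.range_one, Finset.sum_singleton, Nat.cast_one, mul_one] at this
    exact (hw 0).trans this
  have e : ∑ i ∈ Finset.range k, ∑ j ∈ Finset.range N, |A i j| * w j =
      ∑ j ∈ Finset.range N, (∑ i ∈ Finset.range k, A i j) * w j := by
    rw [Finset.sum_comm]
    simp only [Finset.sum_mul, abs_of_nonneg (hA.nonneg _ _)]
  rw [e]
  calc _ ≤ ∑ j ∈ Finset.range N, (∑ i ∈ Finset.range k, A i j) * C :=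
        sum_mul_le_sum_mul_of_antitone (fun i j hij hj => hA.anti' hk hij hj)
          (fun j _ => Finset.sum_nonneg fun i _ => hA.nonneg i j)
          (fun m hm => by simpa [mul_comm] using hC m hm)
    _ = C * ∑ i ∈ Finset.range k, ∑ j ∈ Finset.range N, A i j := by
        rw [← Finset.sum_mul, mul_comm, Finset.sum_comm]
    _ ≤ C * ∑ i ∈ Finset.range k, 1 := by
        gcongr with i hi
        exact hA.row i ((Finset.mem_range.1 hi).trans_le hk)
    _ = C * k := by simp

/-- Here the transpose acts: `d` is the transpose of `A` applied to `c`. It decreases by Hardy's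
lemma, with `c` as the weights, and its sum is controlled by the row sums of `A`. -/
theorem IsOrderContr.tildeContr {N : ℕ} {A U : ℕ → ℕ → ℝ} (hA : IsOrderContr N A)
    (hU : ∀ i j, |U i j| ≤ A j i) : TildeContr N U := by
  intro c hc
  by_cases hfin : ∀ j ∈ Finset.range N, c j ≠ ∞
  · refine ⟨fun i => ENNReal.ofReal (∑ j ∈ Finset.range N, A j i * (c j).toReal), ?_, ?_, ?_⟩
    · intro i hi j hj hij
      refine ENNReal.ofReal_le_ofReal ?_
      have := sum_mul_le_sum_mul_of_antitone (N := N) (a := fun l => (c l).toReal)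
        (b := fun l => A l j) (c := fun l => A l i)
        (fun p q hpq hq => ENNReal.toReal_mono
          (hfin p (Finset.mem_range.2 (by omega))) (hc hpq))
        (fun _ _ => ENNReal.toReal_nonneg) (fun k hk => hA.anti' hk hij hj)
      simpa only [mul_comm] using this
    · intro i hi
      beta_reduce
      rw [ENNReal.ofReal_sum_of_nonneg fun j _ =>
        mul_nonneg (hA.nonneg j i) ENNReal.toReal_nonneg]
      refine Finset.sum_le_sum fun j hj => ?_
      rw [ENNReal.ofReal_mul (hA.nonneg j i), ENNReal.ofReal_toReal (hfin j hj),
        Real.enorm_eq_ofReal_abs]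
      gcongr
      exact hU i j
    · rw [← ENNReal.ofReal_sum_of_nonneg fun i _ => Finset.sum_nonneg fun j _ =>
        mul_nonneg (hA.nonneg j i) ENNReal.toReal_nonneg, Finset.sum_comm]
      calc _ ≤ ENNReal.ofReal (∑ j ∈ Finset.range N, (c j).toReal) := by
            refine ENNReal.ofReal_le_ofReal (Finset.sum_le_sum fun j hj => ?_)
            rw [← Finset.sum_mul]
            exact mul_le_of_le_one_left ENNReal.toReal_nonneg
              (hA.row j (Finset.mem_range.1 hj))
        _ = _ := by
            rw [ENNReal.ofReal_sum_of_nonneg fun _ _ => ENNReal.toReal_nonneg]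
            exact Finset.sum_congr rfl fun j hj => ENNReal.ofReal_toReal (hfin j hj)
  -- If some `c j` is infinite, the constant sequence `∞` serves as `d`.
  · push Not at hfin
    obtain ⟨j, hj, hj2⟩ := hfin
    refine ⟨fun _ => ∞, fun _ _ _ _ _ => le_rfl, fun _ _ => le_top, ?_⟩
    rw [ENNReal.sum_eq_top.2 ⟨j, hj, hj2⟩]
    exact le_top

/-! ### Lattice couples, multipliers and matrix contractions. -/

/-- Both norms depend only on the absolute value, in a monotone way. -/
structure IsLatticeCouple (Y : Couple (ℝ →ₘ[halfLine] ℝ)) : Prop where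
  mono₀ : ∀ f g : ℝ →ₘ[halfLine] ℝ, (∀ᵐ s ∂halfLine, ‖g s‖ₑ ≤ ‖f s‖ₑ) → Y.norm₀ g ≤ Y.norm₀ f
  mono₁ : ∀ f g : ℝ →ₘ[halfLine] ℝ, (∀ᵐ s ∂halfLine, ‖g s‖ₑ ≤ ‖f s‖ₑ) → Y.norm₁ g ≤ Y.norm₁ f

theorem isLatticeCouple_coupleL : IsLatticeCouple (coupleL halfLine) where
  mono₀ _ _ h := eLpNorm_mono_enorm_ae h
  mono₁ f g h := show eLpNorm g ∞ halfLine ≤ eLpNorm f ∞ halfLine from eLpNorm_mono_enorm_ae h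

theorem isLatticeCouple_coupleTilde : IsLatticeCouple (coupleTilde halfLine) where
  mono₀ f g h := by
    rw [coupleTilde_norm₀, coupleTilde_norm₀]
    refine lintegral_mono (ldm_le_of_ae_le (ldm_antitone halfLine f) ?_)
    filter_upwards [h, ae_enorm_le_ldm halfLine f] with s h1 h2 using h1.trans h2
  mono₁ := isLatticeCouple_coupleL.mono₁

theorem isLatticeCouple_coupleLevel : IsLatticeCouple (coupleLevel halfLine) where
  mono₀ _ _ h := eLpNorm_mono_enorm_ae h
  mono₁ f _ h := coupleLevel_norm₁_le_iff.2 fun x =>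
    (lintegral_mono_ae (ae_restrict_of_ae h)).trans (setLIntegral_le_coupleLevel_norm₁ f x)

/-- The operator given by the matrix is a contraction of the couple. -/
structure MatContr (Y : Couple (ℝ →ₘ[halfLine] ℝ)) (n : ℕ) (U : ℕ → ℕ → ℝ) : Prop where
  le₀ : ∀ f, Y.norm₀ f < ∞ → Y.norm₀ (matOp n U f) ≤ Y.norm₀ f
  le₁ : ∀ f, Y.norm₁ f < ∞ → Y.norm₁ (matOp n U f) ≤ Y.norm₁ f

theorem sum_enorm_le_one_iff {s : Finset ℕ} {u : ℕ → ℝ} :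
    ∑ i ∈ s, ‖u i‖ₑ ≤ 1 ↔ ∑ i ∈ s, |u i| ≤ 1 := by
  simp only [Real.enorm_eq_ofReal_abs]
  rw [← ENNReal.ofReal_sum_of_nonneg fun _ _ => abs_nonneg _, ENNReal.ofReal_le_one]

theorem matContr_coupleL {n : ℕ} {U : ℕ → ℕ → ℝ}
    (hrow : ∀ i < 4 ^ n, ∑ j ∈ Finset.range (4 ^ n), |U i j| ≤ 1)
    (hcol : ∀ j < 4 ^ n, ∑ i ∈ Finset.range (4 ^ n), |U i j| ≤ 1) :
    MatContr (coupleL halfLine) n U where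
  le₀ f _ := by
    rw [coupleL_norm₀, coupleL_norm₀]
    exact lintegral_matOp_le n (fun j hj => sum_enorm_le_one_iff.2 (hcol j hj)) f
  le₁ f _ := eLpNorm_top_matOp_le n (fun i hi => sum_enorm_le_one_iff.2 (hrow i hi)) f

theorem matContr_coupleTilde {n : ℕ} {U : ℕ → ℕ → ℝ}
    (hrow : ∀ i < 4 ^ n, ∑ j ∈ Finset.range (4 ^ n), |U i j| ≤ 1)
    (hU : TildeContr (4 ^ n) U) : MatContr (coupleTilde halfLine) n U where
  le₀ f _ := by
    rw [coupleTilde_norm₀, coupleTilde_norm₀]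
    exact lintegral_ldm_matOp_le n hU f
  le₁ f _ := eLpNorm_top_matOp_le n (fun i hi => sum_enorm_le_one_iff.2 (hrow i hi)) f

theorem matContr_coupleLevel {n : ℕ} {U : ℕ → ℕ → ℝ}
    (hcol : ∀ j < 4 ^ n, ∑ i ∈ Finset.range (4 ^ n), |U i j| ≤ 1)
    (hU : LevelContr (4 ^ n) U) : MatContr (coupleLevel halfLine) n U where
  le₀ f _ := by
    rw [coupleLevel_norm₀, coupleLevel_norm₀]
    exact lintegral_matOp_le n (fun j hj => sum_enorm_le_one_iff.2 (hcol j hj)) f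
  le₁ f hf := level_matOp_le n hU hf

theorem mul_add_coeFn (σ f g : ℝ →ₘ[halfLine] ℝ) : σ * (f + g) = σ * f + σ * g := by
  refine AEEqFun.ext ?_
  filter_upwards [AEEqFun.coeFn_mul σ (f + g), AEEqFun.coeFn_mul σ f, AEEqFun.coeFn_mul σ g,
    AEEqFun.coeFn_add f g, AEEqFun.coeFn_add (σ * f) (σ * g)] with s h1 h2 h3 h4 h5
  rw [h1, h5, Pi.mul_apply, Pi.add_apply, h4, h2, h3]
  exact mul_add _ _ _

theorem mul_smul_coeFn (c : ℝ) (σ f : ℝ →ₘ[halfLine] ℝ) : σ * (c • f) = c • (σ * f) := by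
  refine AEEqFun.ext ?_
  filter_upwards [AEEqFun.coeFn_mul σ (c • f), AEEqFun.coeFn_mul σ f, AEEqFun.coeFn_smul c f,
    AEEqFun.coeFn_smul c (σ * f)] with s h1 h2 h3 h4
  rw [h1, h4, Pi.mul_apply, Pi.smul_apply, h2, h3]
  exact mul_left_comm _ _ _

theorem enorm_mul_coeFn_le {σ : ℝ →ₘ[halfLine] ℝ} (hσ : ∀ᵐ s ∂halfLine, ‖σ s‖ₑ ≤ 1)
    (f : ℝ →ₘ[halfLine] ℝ) : ∀ᵐ s ∂halfLine, ‖(σ * f : ℝ →ₘ[halfLine] ℝ) s‖ₑ ≤ ‖f s‖ₑ := by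
  filter_upwards [hσ, AEEqFun.coeFn_mul σ f] with s h1 h2
  rw [h2, Pi.mul_apply, enorm_mul]
  exact mul_le_of_le_one_left zero_le h1

theorem LocInt.mono {f g : ℝ →ₘ[halfLine] ℝ} (hf : LocInt f)
    (h : ∀ᵐ s ∂halfLine, ‖g s‖ₑ ≤ ‖f s‖ₑ) : LocInt g := fun R =>
  (lintegral_mono_ae (ae_restrict_of_ae h)).trans_lt (hf R)

open Couple in
theorem exists_op_mul {Y : Couple (ℝ →ₘ[halfLine] ℝ)} (hY : Y.IsSeminorm)
    (hYl : IsLatticeCouple Y) {σ : ℝ →ₘ[halfLine] ℝ} (hσ : ∀ᵐ s ∂halfLine, ‖σ s‖ₑ ≤ 1) :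
    ∃ T : Y.sum →ₗ[ℝ] Y.sum, OpNormLE Y Y 1 T ∧
      ∀ f, (T f : ℝ →ₘ[halfLine] ℝ) = σ * (f : ℝ →ₘ[halfLine] ℝ) :=
  exists_op hY (fun f => σ * f) (fun f _ g _ => mul_add_coeFn σ f g)
    (fun a f _ => mul_smul_coeFn a σ f)
    (fun f _ => by simpa using hYl.mono₀ _ _ (enorm_mul_coeFn_le hσ f))
    (fun f _ => by simpa using hYl.mono₁ _ _ (enorm_mul_coeFn_le hσ f))

open Couple in
theorem exists_op_matOp {Y : Couple (ℝ →ₘ[halfLine] ℝ)} (hY : IsHalfLineCouple Y) {n : ℕ}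
    {U : ℕ → ℕ → ℝ} (hU : MatContr Y n U) :
    ∃ T : Y.sum →ₗ[ℝ] Y.sum, OpNormLE Y Y 1 T ∧
      ∀ f, (T f : ℝ →ₘ[halfLine] ℝ) = matOp n U (f : ℝ →ₘ[halfLine] ℝ) :=
  exists_op hY.seminorm (matOp n U)
    (fun _ hf _ hg => matOp_add n U (hY.locInt hf) (hY.locInt hg))
    (fun a f _ => matOp_smul n U a f)
    (fun f hf => by simpa using hU.le₀ f hf) (fun f hf => by simpa using hU.le₁ f hf)

/-- The sign of a function. -/
noncomputable def signClass (x : ℝ →ₘ[halfLine] ℝ) : ℝ →ₘ[halfLine] ℝ :=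
  AEEqFun.mk (fun s => if 0 ≤ x s then 1 else -1)
    (Measurable.ite (measurableSet_le measurable_const x.measurable) measurable_const
      measurable_const).aestronglyMeasurable

theorem enorm_signClass_le (x : ℝ →ₘ[halfLine] ℝ) : ∀ᵐ s ∂halfLine, ‖signClass x s‖ₑ ≤ 1 := by
  filter_upwards [AEEqFun.coeFn_mk (μ := halfLine) (fun s => if 0 ≤ x s then (1 : ℝ) else -1)
    (Measurable.ite (measurableSet_le measurable_const x.measurable) measurable_const
      measurable_const).aestronglyMeasurable] with s h
  rw [signClass, h]
  split_ifs <;> simp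

theorem signClass_mul_self (x : ℝ →ₘ[halfLine] ℝ) : signClass x * x = |x| := by
  refine AEEqFun.ext ?_
  filter_upwards [AEEqFun.coeFn_mk (μ := halfLine) (fun s => if 0 ≤ x s then (1 : ℝ) else -1)
    (Measurable.ite (measurableSet_le measurable_const x.measurable) measurable_const
      measurable_const).aestronglyMeasurable, AEEqFun.coeFn_mul (signClass x) x,
    AEEqFun.coeFn_abs x] with s h1 h2 h3
  rw [h2, h3, Pi.mul_apply, signClass, h1]
  split_ifs with h
  · rw [one_mul, abs_of_nonneg h]
  · rw [neg_one_mul, abs_of_neg (not_le.1 h)]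

theorem enorm_abs_coeFn (x : ℝ →ₘ[halfLine] ℝ) :
    ∀ᵐ s ∂halfLine, ‖(|x| : ℝ →ₘ[halfLine] ℝ) s‖ₑ = ‖x s‖ₑ := by
  filter_upwards [AEEqFun.coeFn_abs x] with s h
  rw [h, Real.enorm_eq_ofReal_abs, abs_abs, Real.enorm_eq_ofReal_abs]

theorem LocInt.abs {x : ℝ →ₘ[halfLine] ℝ} (hx : LocInt x) :
    LocInt (|x| : ℝ →ₘ[halfLine] ℝ) :=
  hx.mono ((enorm_abs_coeFn x).mono fun _ h => h.le)

open Couple in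
-- Multiplication by the sign of `x` is a contraction for lattice norms; performed first, it lets
-- the matrix act on `|x|` while the operator remains linear.
theorem exists_op_matOp_sign {Y : Couple (ℝ →ₘ[halfLine] ℝ)} (hY : IsHalfLineCouple Y)
    (hYl : IsLatticeCouple Y) {n : ℕ} {U : ℕ → ℕ → ℝ} (hU : MatContr Y n U) (x : Y.sum) :
    ∃ T : Y.sum →ₗ[ℝ] Y.sum, OpNormLE Y Y 1 T ∧
      (T x : ℝ →ₘ[halfLine] ℝ) = matOp n U |(x : ℝ →ₘ[halfLine] ℝ)| := by
  obtain ⟨S, hS, hS2⟩ := exists_op_mul hY.seminorm hYl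
    (enorm_signClass_le (x : ℝ →ₘ[halfLine] ℝ))
  obtain ⟨T, hT, hT2⟩ := exists_op_matOp hY hU
  refine ⟨T ∘ₗ S, by simpa using hT.comp hS, ?_⟩
  rw [LinearMap.comp_apply, hT2, hS2, signClass_mul_self]

/-! ### Bounds for the K-functionals -/

open Couple in
theorem IsHalfLineCouple.setLIntegral_le_K {Y : Couple (ℝ →ₘ[halfLine] ℝ)}
    (hY : IsHalfLineCouple Y) (t : ℝ≥0) (y : ℝ →ₘ[halfLine] ℝ) :
    ∫⁻ s in Iic (t : ℝ), ‖y s‖ₑ ∂halfLine ≤ Y.K t y := by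
  refine hY.seminorm.le_K fun f₀ f₁ _ _ h => ?_
  calc _ ≤ ∫⁻ s in Iic (t : ℝ), ‖f₀ s‖ₑ + ‖f₁ s‖ₑ ∂halfLine := by
        refine lintegral_mono_ae (ae_restrict_of_ae ?_)
        filter_upwards [AEEqFun.coeFn_add f₀ f₁] with s hs
        rw [← h, hs]
        exact enorm_add_le _ _
    _ = _ := lintegral_add_left f₀.measurable.enorm _
    _ ≤ _ := add_le_add (hY.loc₀ _ _) ((hY.loc₁ _ _).trans (by
        rw [ENNReal.ofReal_coe_nnreal, mul_comm]))

open Couple in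
-- For `(L¹, L^∞)` any set of measure at most `t` can take the place of `(0, t]`, which is what
-- permits sorting.
theorem setLIntegral_le_K_coupleL {E : Set ℝ} {t : ℝ≥0} (hE : halfLine E ≤ t)
    (y : ℝ →ₘ[halfLine] ℝ) : ∫⁻ s in E, ‖y s‖ₑ ∂halfLine ≤ (coupleL halfLine).K t y := by
  refine (isSeminorm_coupleL _).le_K fun f₀ f₁ _ _ h => ?_
  calc _ ≤ ∫⁻ s in E, ‖f₀ s‖ₑ + ‖f₁ s‖ₑ ∂halfLine := by
        refine lintegral_mono_ae (ae_restrict_of_ae ?_)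
        filter_upwards [AEEqFun.coeFn_add f₀ f₁] with s hs
        rw [← h, hs]
        exact enorm_add_le _ _
    _ = _ := lintegral_add_left f₀.measurable.enorm _
    _ ≤ _ := by
        refine add_le_add ?_ ?_
        · rw [coupleL_norm₀]
          exact lintegral_mono' Measure.restrict_le_self le_rfl
        · calc _ ≤ ∫⁻ _s in E, eLpNorm f₁ ∞ halfLine ∂halfLine :=
                lintegral_mono_ae (ae_restrict_of_ae (ae_le_eLpNormEssSup (f := f₁)))
            _ ≤ _ := by
                rw [setLIntegral_const, mul_comm]
                exact mul_le_mul_left hE _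

open Couple in
theorem setLIntegral_ldm_le_K (t : ℝ≥0) (y : ℝ →ₘ[halfLine] ℝ) :
    ∫⁻ s in Iic (t : ℝ), ldm halfLine y s ∂halfLine ≤ (coupleTilde halfLine).K t y := by
  refine (isSeminorm_coupleTilde _).le_K fun f₀ f₁ _ _ h => ?_
  calc _ ≤ ∫⁻ s in Iic (t : ℝ), ldm halfLine f₀ s + ldm halfLine f₁ s ∂halfLine := by
        rw [← h]
        exact lintegral_mono fun s => ldm_add_le halfLine f₀ f₁ s
    _ = _ := lintegral_add_left (measurable_ldm _ _) _
    _ ≤ _ := by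
        refine add_le_add ?_ ?_
        · rw [coupleTilde_norm₀]
          exact lintegral_mono' Measure.restrict_le_self le_rfl
        · calc _ ≤ ∫⁻ _s in Iic (t : ℝ), eLpNorm f₁ ∞ halfLine ∂halfLine :=
                lintegral_mono fun s => ldm_le_essSup _ _ _
            _ = _ := by
                rw [setLIntegral_const, halfLine_Iic, ENNReal.ofReal_coe_nnreal, mul_comm]
                rfl

/-- Truncation of a function at the levels `±c`. -/
noncomputable def clampClass (c : ℝ≥0) (x : ℝ →ₘ[halfLine] ℝ) : ℝ →ₘ[halfLine] ℝ :=
  AEEqFun.mk (fun s => max (min (x s) c) (-c))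
    ((x.measurable.min measurable_const).max measurable_const).aestronglyMeasurable

theorem clampClass_bounds (c : ℝ≥0) (x : ℝ →ₘ[halfLine] ℝ) : ∀ᵐ s ∂halfLine,
    ‖clampClass c x s‖ₑ ≤ c ∧ ‖(x - clampClass c x : ℝ →ₘ[halfLine] ℝ) s‖ₑ ≤ ‖x s‖ₑ - c := by
  filter_upwards [AEEqFun.coeFn_sub x (clampClass c x), AEEqFun.coeFn_mk (μ := halfLine)
    (fun s => max (min (x s) (c : ℝ)) (-c))
    ((x.measurable.min measurable_const).max measurable_const).aestronglyMeasurable] with s h1 h2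
  rw [h1, Pi.sub_apply, clampClass, h2]
  have hc : (0 : ℝ) ≤ c := c.2
  constructor
  · rw [Real.enorm_eq_ofReal_abs, ← ENNReal.ofReal_coe_nnreal]
    refine ENNReal.ofReal_le_ofReal (abs_le.2 ⟨le_max_right _ _, max_le (min_le_right _ _) ?_⟩)
    linarith
  · rw [Real.enorm_eq_ofReal_abs, Real.enorm_eq_ofReal_abs, ← ENNReal.ofReal_coe_nnreal,
      ← ENNReal.ofReal_sub _ hc]
    rcases le_total (x s) c with ha | ha
    · rw [min_eq_left ha]
      rcases le_total (x s) (-c) with hb | hb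
      · rw [max_eq_right hb, abs_of_nonpos (by linarith), abs_of_nonpos (by linarith)]
        exact ENNReal.ofReal_le_ofReal (by linarith)
      · rw [max_eq_left hb]
        simp
    · rw [min_eq_right ha, max_eq_left (by linarith), abs_of_nonneg (by linarith),
        abs_of_nonneg (by linarith)]

open Couple in
theorem K_coupleL_le {t : ℝ≥0} (ht : 0 < t) (c : ℝ≥0) (x : ℝ →ₘ[halfLine] ℝ) :
    (coupleL halfLine).K t x ≤ ∫⁻ s, (‖x s‖ₑ - c) ∂halfLine + t * c := by
  refine (K_le ht (f₀ := x - clampClass c x) (f₁ := clampClass c x) (by abel)).trans ?_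
  refine add_le_add ?_ (mul_le_mul_right ?_ _)
  · rw [coupleL_norm₀]
    exact lintegral_mono_ae ((clampClass_bounds c x).mono fun s hs => hs.2)
  · change eLpNorm _ ∞ halfLine ≤ _
    rw [eLpNorm_exponent_top]
    exact essSup_le_of_ae_le _ ((clampClass_bounds c x).mono fun s hs => hs.1)

open Couple in
-- Truncate at the height `c = ldm halfLine x t`. The excess has the decreasing majorant `ldm
-- halfLine x - c`, cut off at zero and hence vanishing beyond `t`, and `t * c` restores what was
-- subtracted on `(0, t]`. If `c` is infinite, so is the right side.
theorem K_coupleTilde_le {t : ℝ≥0} (ht : 0 < t) (x : ℝ →ₘ[halfLine] ℝ) :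
    (coupleTilde halfLine).K t x ≤ ∫⁻ s in Iic (t : ℝ), ldm halfLine x s ∂halfLine := by
  have hconst : ∀ c : ℝ≥0∞, ∫⁻ _s in Iic (t : ℝ), c ∂halfLine = t * c := fun c => by
    rw [setLIntegral_const, halfLine_Iic, ENNReal.ofReal_coe_nnreal, mul_comm]
  rcases eq_or_ne (ldm halfLine x t) ∞ with hc | hc
  · have : (∞ : ℝ≥0∞) ≤ ∫⁻ s in Iic (t : ℝ), ldm halfLine x s ∂halfLine := by
      calc (∞ : ℝ≥0∞) = ∫⁻ _s in Iic (t : ℝ), ∞ ∂halfLine := by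
            rw [hconst, ENNReal.mul_top (by positivity)]
        _ ≤ _ := setLIntegral_mono' measurableSet_Iic fun s hs => by
            rw [← hc]
            exact ldm_antitone _ _ hs
    exact le_top.trans this
  · obtain ⟨c, hc⟩ : ∃ c : ℝ≥0, (c : ℝ≥0∞) = ldm halfLine x t := ⟨_, ENNReal.coe_toNNReal hc⟩
    refine (K_le ht (f₀ := x - clampClass c x) (f₁ := clampClass c x) (by abel)).trans ?_
    have h1 : (coupleTilde halfLine).norm₀ (x - clampClass c x) ≤
        ∫⁻ s in Iic (t : ℝ), (ldm halfLine x s - c) ∂halfLine := by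
      rw [coupleTilde_norm₀, ← lintegral_indicator measurableSet_Iic]
      refine lintegral_mono (fun s => (ldm_le_of_ae_le (w := fun s => ldm halfLine x s - c)
        (fun a b h => tsub_le_tsub_right (ldm_antitone _ _ h) _) ?_ s).trans ?_)
      · filter_upwards [clampClass_bounds c x, ae_enorm_le_ldm halfLine x] with r h1 h2
        exact h1.2.trans (tsub_le_tsub_right h2 _)
      · by_cases hs : s ∈ Iic (t : ℝ)
        · rw [indicator_of_mem hs]
        · rw [indicator_of_notMem hs, hc, tsub_eq_zero_of_le]
          exact ldm_antitone _ _ (not_le.1 hs).le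
    have h2 : (coupleTilde halfLine).norm₁ (clampClass c x) ≤ c := by
      change eLpNorm _ ∞ halfLine ≤ _
      rw [eLpNorm_exponent_top]
      exact essSup_le_of_ae_le _ ((clampClass_bounds c x).mono fun s hs => hs.1)
    calc _ ≤ ∫⁻ s in Iic (t : ℝ), (ldm halfLine x s - c) ∂halfLine +
          ∫⁻ _s in Iic (t : ℝ), c ∂halfLine := by
          rw [hconst]
          gcongr
      _ = ∫⁻ s in Iic (t : ℝ), (ldm halfLine x s - c + c) ∂halfLine :=
          (lintegral_add_right _ measurable_const).symm
      _ = _ := setLIntegral_congr_fun measurableSet_Iic fun s hs => by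
          refine tsub_add_cancel_of_le ?_
          rw [hc]
          exact ldm_antitone _ _ hs

theorem exists_setLIntegral_eq {x : ℝ →ₘ[halfLine] ℝ} (hx : LocInt x) {a s : ℝ} (ha : 0 ≤ a)
    (hs : 0 ≤ s) (h : ENNReal.ofReal a ≤ ∫⁻ r in Iic s, ‖x r‖ₑ ∂halfLine) :
    ∃ r, ∫⁻ r in Iic r, ‖x r‖ₑ ∂halfLine = ENNReal.ofReal a := by
  have hintegrable : ∀ b c : ℝ, IntervalIntegrable (fun r => ‖x r‖) halfLine b c := fun b c =>
    intervalIntegrable_iff.2 (((hx.integrableOn (max b c)).mono_set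
      (uIoc_subset_uIcc.trans fun r hr => hr.2)).norm)
  have : NullSingletonClass halfLine := by unfold halfLine; infer_instance
  have hcont := intervalIntegral.continuous_primitive hintegrable 0
  have hval : ∀ r, 0 ≤ r → ENNReal.ofReal (∫ u in 0..r, ‖x u‖ ∂halfLine) =
      ∫⁻ u in Iic r, ‖x u‖ₑ ∂halfLine := fun r hr => by
    rw [intervalIntegral.integral_of_le hr, halfLine_restrict_of_subset measurableSet_Ioc
      Ioc_subset_Ioi_self, ← halfLine_restrict_Iic, integral_norm_eq_lintegral_enorm
      x.aestronglyMeasurable.restrict, ENNReal.ofReal_toReal (hx r).ne]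
  have hmem : a ∈ Icc (∫ u in 0..0, ‖x u‖ ∂halfLine) (∫ u in 0..s, ‖x u‖ ∂halfLine) := by
    refine ⟨by simpa using ha, ?_⟩
    rw [← hval s hs] at h
    exact (ENNReal.ofReal_le_ofReal_iff (intervalIntegral.integral_nonneg hs
      fun _ _ => norm_nonneg _)).1 h
  obtain ⟨r, hr, hr2⟩ := intermediate_value_Icc hs hcont.continuousOn hmem
  exact ⟨r, by rw [← hval r hr.1]; exact congrArg _ hr2⟩

open Couple in
-- Cut `x` at a point `r` where its primitive equals `a`. The first piece has `L¹` norm `a`; beyond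
-- `r` the primitive of the second is the original one minus `a`, hence at most `b * s`, so that its
-- norm in `(L^∞)ᵒ` is at most `b`. If the primitive stays below `a`, no cut is needed.
theorem K_coupleLevel_le {t : ℝ≥0} (ht : 0 < t) {x : ℝ →ₘ[halfLine] ℝ} (hx : LocInt x) {a b : ℝ}
    (ha : 0 ≤ a) (hb : 0 ≤ b)
    (h : ∀ s, 0 ≤ s → ∫⁻ r in Iic s, ‖x r‖ₑ ∂halfLine ≤ ENNReal.ofReal (a + b * s)) :
    (coupleLevel halfLine).K t x ≤ ENNReal.ofReal (a + b * t) := by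
  have hle : ENNReal.ofReal a ≤ ENNReal.ofReal (a + b * t) :=
    ENNReal.ofReal_le_ofReal (by have := mul_nonneg hb t.coe_nonneg; linarith)
  by_cases hr : ∃ s, 0 ≤ s ∧ ENNReal.ofReal a ≤ ∫⁻ r in Iic s, ‖x r‖ₑ ∂halfLine
  · obtain ⟨s, hs, hs2⟩ := hr
    obtain ⟨r, hr⟩ := exists_setLIntegral_eq hx ha hs hs2
    set x₀ : ℝ →ₘ[halfLine] ℝ := AEEqFun.mk ((Iic r).indicator x)
      (x.measurable.indicator measurableSet_Iic).aestronglyMeasurable with hx₀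
    have e₀ : ∀ᵐ s ∂halfLine, x₀ s = (Iic r).indicator x s := AEEqFun.coeFn_mk _ _
    have e₁ : ∀ᵐ s ∂halfLine, (x - x₀ : ℝ →ₘ[halfLine] ℝ) s = (Ioi r).indicator x s := by
      filter_upwards [e₀, AEEqFun.coeFn_sub x x₀] with s h1 h2
      rw [h2, Pi.sub_apply, h1]
      by_cases hs : s ≤ r
      · rw [indicator_of_mem (show s ∈ Iic r from hs), indicator_of_notMem (by simpa using hs),
          sub_self]
      · rw [indicator_of_notMem (show s ∉ Iic r from hs),
          indicator_of_mem (show s ∈ Ioi r from not_le.1 hs), sub_zero]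
    refine (K_le ht (f₀ := x₀) (f₁ := x - x₀) (by abel)).trans ?_
    rw [ENNReal.ofReal_add ha (mul_nonneg hb t.coe_nonneg), mul_comm b, ENNReal.ofReal_mul t.coe_nonneg,
      ENNReal.ofReal_coe_nnreal]
    refine add_le_add (le_of_eq ?_) (mul_le_mul_right ?_ _)
    · rw [coupleLevel_norm₀, ← hr, ← lintegral_indicator measurableSet_Iic]
      refine lintegral_congr_ae (e₀.mono fun s hs => ?_)
      simp only [hs, indicator]
      split_ifs <;> simp
    · refine coupleLevel_norm₁_le_iff.2 fun s => ?_
      rw [halfLine_Iic]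
      have e : ∫⁻ u in Iic s, ‖(x - x₀ : ℝ →ₘ[halfLine] ℝ) u‖ₑ ∂halfLine =
          ∫⁻ u in Ioc r s, ‖x u‖ₑ ∂halfLine := by
        rw [← Ioi_inter_Iic, ← Measure.restrict_restrict measurableSet_Ioi,
          ← lintegral_indicator measurableSet_Ioi]
        refine lintegral_congr_ae (ae_restrict_of_ae (e₁.mono fun s hs => ?_))
        simp only [hs, indicator]
        split_ifs <;> simp
      rw [e]
      rcases le_total s r with hsr | hsr
      · rw [Ioc_eq_empty (not_lt.2 hsr)]
        simp
      rcases le_total s 0 with hs0 | hs0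
      · have : halfLine (Ioc r s) = 0 := measure_mono_null (fun u hu => hu.2) (by
          rw [halfLine_Iic, ENNReal.ofReal_of_nonpos hs0] : halfLine (Iic s) = 0)
        rw [setLIntegral_measure_zero _ _ this]
        exact zero_le
      have h1 := h s hs0
      have hdisj : Disjoint (Iic r) (Ioc r s) :=
        Set.disjoint_left.2 fun u hu hu2 => absurd hu (not_le.2 hu2.1)
      rw [← Iic_union_Ioc_eq_Iic hsr, lintegral_union measurableSet_Ioc hdisj, hr,
        ENNReal.ofReal_add ha (mul_nonneg hb hs0), ENNReal.ofReal_mul hb] at h1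
      exact (ENNReal.add_le_add_iff_left ENNReal.ofReal_ne_top).1 h1
  · push Not at hr
    refine (K_le ht (f₀ := x) (f₁ := 0) (add_zero x)).trans ?_
    have h1 : (coupleLevel halfLine).norm₁ (0 : ℝ →ₘ[halfLine] ℝ) = 0 := by
      have := (isSeminorm_coupleLevel halfLine).smul₁ 0 0
      simpa using this
    rw [h1, mul_zero, add_zero, coupleLevel_norm₀]
    refine le_trans ?_ hle
    have h2 : ∫⁻ s, ‖x s‖ₑ ∂halfLine = ⨆ n : ℕ, ∫⁻ s in Iic (n : ℝ), ‖x s‖ₑ ∂halfLine := by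
      rw [← setLIntegral_iUnion_of_directed]
      · rw [iUnion_Iic_of_not_bddAbove_range, setLIntegral_univ]
        rintro ⟨c, hc⟩
        obtain ⟨n, hn⟩ := exists_nat_gt c
        exact absurd (hc ⟨n, rfl⟩) (not_le.2 hn)
      · exact Monotone.directed_le fun i j hij => Iic_subset_Iic.2 (by exact_mod_cast hij)
    rw [h2]
    exact iSup_le fun n => (hr n (Nat.cast_nonneg n)).le

/-! ### Averages and primitives at grid points. -/

theorem locInt_stepClass (n : ℕ) (v : ℕ → ℝ) : LocInt (stepClass n v) := fun R => by
  refine (lintegral_mono' Measure.restrict_le_self le_rfl).trans_lt ?_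
  rw [lintegral_enorm_stepClass]
  exact ENNReal.sum_lt_top.2 fun i _ => ENNReal.mul_lt_top ENNReal.ofReal_lt_top enorm_lt_top

theorem setIntegral_stepClass {n j : ℕ} (hj : j ≤ 4 ^ n) (v : ℕ → ℝ) :
    ∫ s in Iic (j * mesh n), stepClass n v s ∂halfLine = mesh n * ∑ i ∈ Finset.range j, v i := by
  rw [← sum_integral_block (locInt_stepClass n v), Finset.mul_sum]
  exact Finset.sum_congr rfl fun i hi =>
    integral_block_stepClass ((Finset.mem_range.1 hi).trans_le hj) v

theorem avg_stepClass {n k : ℕ} (hk : k < 4 ^ n) (v : ℕ → ℝ) : avg n (stepClass n v) k = v k := by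
  rw [avg, integral_block_stepClass hk, ← mul_assoc, pow_mul_mesh, one_mul]

theorem setLIntegral_step {n j : ℕ} (hj : j ≤ 4 ^ n) (v : ℕ → ℝ≥0∞) :
    ∫⁻ s in Iic (j * mesh n), step n v s ∂halfLine =
      ∑ i ∈ Finset.range j, ENNReal.ofReal (mesh n) * v i := by
  rw [← sum_lintegral_block]
  refine Finset.sum_congr rfl fun i hi => ?_
  rw [setLIntegral_congr_fun (measurableSet_block n i) (g := fun _ => v i) fun s hs =>
    step_apply ((Finset.mem_range.1 hi).trans_le hj) v hs, setLIntegral_const, halfLine_block,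
    mul_comm]

theorem tendsto_blockAvg {y : ℝ →ₘ[halfLine] ℝ} (hy : LocInt y) :
    ∀ᵐ s ∂halfLine, Tendsto (fun m => blockAvg m y s) atTop (𝓝 (y s)) := by
  have h : ∀ᵐ s ∂halfLine, ∀ m, blockAvg m y s = step m (avg m y) s :=
    ae_all_iff.2 fun m => coeFn_stepClass _ _
  filter_upwards [h, ae_hasDerivAt_setIntegral hy, ae_halfLine_pos] with s h1 h2 h3
  simp only [h1]
  refine (tendsto_step_slope h3 h2).congr fun m => ?_
  simp only [setIntegral_sub_eq_avg hy]

theorem avg_abs_nonneg (m : ℕ) (x : ℝ →ₘ[halfLine] ℝ) (k : ℕ) :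
    0 ≤ avg m (|x| : ℝ →ₘ[halfLine] ℝ) k := by
  refine mul_nonneg (by positivity) (integral_nonneg_of_ae (ae_restrict_of_ae ?_))
  filter_upwards [AEEqFun.coeFn_abs x] with s h
  rw [h]
  exact abs_nonneg _

theorem setLIntegral_eq_avg {x : ℝ →ₘ[halfLine] ℝ} (hx : LocInt x) (m l : ℕ) :
    ∫⁻ s in Iic (l * mesh m), ‖x s‖ₑ ∂halfLine =
      ENNReal.ofReal (mesh m * ∑ i ∈ Finset.range l, avg m (|x| : ℝ →ₘ[halfLine] ℝ) i) := by
  rw [Finset.mul_sum]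
  simp only [mesh_mul_avg]
  rw [sum_integral_block hx.abs, ofReal_integral_eq_lintegral_ofReal (hx.abs.integrableOn _)]
  · refine lintegral_congr_ae (ae_restrict_of_ae ?_)
    filter_upwards [AEEqFun.coeFn_abs x] with s h
    rw [h, Real.enorm_eq_ofReal_abs]
  · refine ae_restrict_of_ae ?_
    filter_upwards [AEEqFun.coeFn_abs x] with s h
    rw [h]
    exact abs_nonneg _

theorem mul_mesh_add (k n d : ℕ) : ((k * 2 ^ d : ℕ) : ℝ) * mesh (n + d) = k * mesh n := by
  simp only [mesh, pow_add]
  push_cast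
  field_simp

theorem mul_two_pow_le {k n : ℕ} (hk : k ≤ 4 ^ n) (d : ℕ) : k * 2 ^ d ≤ 4 ^ (n + d) := by
  rw [pow_add]
  exact Nat.mul_le_mul hk (Nat.pow_le_pow_left (by norm_num) d)

/-- The points of the grid of order `n`. -/
noncomputable def gridPt (n k : ℕ) : ℝ≥0 := (k * mesh n).toNNReal

theorem coe_gridPt (n k : ℕ) : (gridPt n k : ℝ) = k * mesh n :=
  Real.coe_toNNReal _ (mul_nonneg (Nat.cast_nonneg k) (mesh_pos n).le)

theorem gridPt_pos {n k : ℕ} (hk : 0 < k) : 0 < gridPt n k := by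
  rw [← NNReal.coe_pos, coe_gridPt]
  exact mul_pos (by exact_mod_cast hk) (mesh_pos n)

/-- The K-functional of each element is recovered, in the limit, by the primitives of images of
its absolute value under matrices. -/
def IsSource (X : Couple (ℝ →ₘ[halfLine] ℝ)) : Prop :=
  ∀ x ∈ X.sum, ∃ U : ℕ → ℕ → ℕ → ℝ, (∀ m, MatContr X m (U m) ∧ ∀ i j, 0 ≤ U m i j) ∧
    ∀ n k, 0 < k → k ≤ 4 ^ n → ∀ ε > 0, ∀ᶠ d in atTop,
      X.K (gridPt n k) x ≤ ENNReal.ofReal (mesh (n + d) * ∑ i ∈ Finset.range (k * 2 ^ d),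
        ∑ j ∈ Finset.range (4 ^ (n + d)), U (n + d) i j *
          avg (n + d) (|x| : ℝ →ₘ[halfLine] ℝ) j + ε)

open Couple in
-- The matrix acts on a finer grid of order `n + d`, with one `d` for the finitely many grid points
-- of order `n`; `k` coarse blocks consist of `k * 2 ^ d` fine ones.
theorem IsSource.exists_op {X : Couple (ℝ →ₘ[halfLine] ℝ)} (hX : IsSource X)
    (hXh : IsHalfLineCouple X) (hXl : IsLatticeCouple X) (x : X.sum) (n : ℕ) {ε : ℝ}
    (hε : 0 < ε) :
    ∃ R : X.sum →ₗ[ℝ] X.sum, OpNormLE X X 1 R ∧ ∀ k, 0 < k → k ≤ 4 ^ n →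
      (X.K (gridPt n k) (x : ℝ →ₘ[halfLine] ℝ)).toReal ≤ mesh n *
        ∑ i ∈ Finset.range k, avg n (R x : ℝ →ₘ[halfLine] ℝ) i + ε := by
  obtain ⟨U, hU, h⟩ := hX x x.2
  have h1 : ∀ᶠ d in atTop, ∀ k ∈ Finset.range (4 ^ n + 1), 0 < k →
      X.K (gridPt n k) (x : ℝ →ₘ[halfLine] ℝ) ≤ ENNReal.ofReal (mesh (n + d) *
        ∑ i ∈ Finset.range (k * 2 ^ d), ∑ j ∈ Finset.range (4 ^ (n + d)), U (n + d) i j *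
          avg (n + d) (|x| : ℝ →ₘ[halfLine] ℝ) j + ε) := by
    refine (Filter.eventually_all_finset _).2 fun k hk => ?_
    by_cases hk0 : 0 < k
    · filter_upwards [h n k hk0 (by have := Finset.mem_range.1 hk; omega) ε hε] with d hd _ using hd
    · exact Eventually.of_forall fun d h => absurd h hk0
  obtain ⟨d, hd⟩ := h1.exists
  obtain ⟨R, hR, hRx⟩ := exists_op_matOp_sign hXh hXl (hU (n + d)).1 x
  refine ⟨R, hR, fun k hk0 hk => (ENNReal.toReal_le_of_le_ofReal (add_nonneg (mul_nonneg
    (mesh_pos _).le (Finset.sum_nonneg fun i _ => Finset.sum_nonneg fun j _ =>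
      mul_nonneg ((hU _).2 i j) (avg_abs_nonneg _ _ _))) hε.le)
    (hd k (Finset.mem_range.2 (by omega)) hk0)).trans (le_of_eq ?_)⟩
  rw [Finset.mul_sum (Finset.range k)]
  simp only [mesh_mul_avg]
  rw [sum_integral_block (hXh.locInt (R x).2), hRx, ← mul_mesh_add k n d, matOp,
    setIntegral_stepClass (mul_two_pow_le hk d)]

/-- An asymptotic bound is reduced to excluding a subsequence along which `b` stays at least `ε`
below `κ`; compactness arguments refute such subsequences. -/
theorem eventually_of_not_subseq {b : ℕ → ℝ} {κ : ℝ≥0∞} (hκ : κ ≠ ∞) {ε : ℝ} (hb : ∀ d, 0 ≤ b d)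
    (hε : 0 < ε)
    (h : ∀ φ : ℕ → ℕ, StrictMono φ → ¬ ∀ d, b (φ d) + ε ≤ κ.toReal) :
    ∀ᶠ d in atTop, κ ≤ ENNReal.ofReal (b d + ε) := by
  by_contra hn
  rw [not_eventually] at hn
  obtain ⟨φ, hφ, h1⟩ := extraction_of_frequently_atTop hn
  refine h φ hφ fun d => ?_
  have := not_le.1 (h1 d)
  rw [ENNReal.ofReal_lt_iff_lt_toReal (by have := hb (φ d); linarith) hκ] at this
  exact this.le

/-! ### Sorting -/

theorem exists_perm_antitone (N : ℕ) (v : ℕ → ℝ) : ∃ π : Equiv.Perm ℕ,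
    (∀ i, π i < N ↔ i < N) ∧ ∀ i j, i ≤ j → j < N → v (π j) ≤ v (π i) := by
  set f : Fin N → ℝ := fun i => - v i with hf
  set σ := Tuple.sort f with hσ
  have hmono : Monotone (f ∘ σ) := Tuple.monotone_sort f
  set π : Equiv.Perm ℕ := σ.extendDomain Fin.equivSubtype with hπ
  have hval : ∀ i (hi : i < N), π i = σ ⟨i, hi⟩ := fun i hi => by
    rw [hπ, Equiv.Perm.extendDomain_apply_subtype (p := fun j => j < N) σ Fin.equivSubtype (b := i) hi]
    rfl
  refine ⟨π, fun i => ⟨fun h => ?_, fun h => ?_⟩, fun i j hij hj => ?_⟩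
  · by_contra hi
    rw [hπ, Equiv.Perm.extendDomain_apply_not_subtype (p := fun j => j < N) σ Fin.equivSubtype (b := i) hi] at h
    exact hi h
  · rw [hval i h]
    exact (σ ⟨i, h⟩).2
  · rw [hval j hj, hval i (hij.trans_lt hj)]
    have := hmono (show (⟨i, hij.trans_lt hj⟩ : Fin N) ≤ ⟨j, hj⟩ from hij)
    simp only [hf, Function.comp_apply] at this
    linarith

theorem sum_range_perm {N : ℕ} {π : Equiv.Perm ℕ} (hπ : ∀ i, π i < N ↔ i < N) (f : ℕ → ℝ) :
    ∑ i ∈ Finset.range N, f (π i) = ∑ i ∈ Finset.range N, f i :=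
  Finset.sum_equiv π (fun i => by simp [hπ]) fun _ _ => rfl

theorem sum_max_sub_eq {N j : ℕ} (hj0 : 0 < j) (hj : j ≤ N) {b : ℕ → ℝ}
    (hb : ∀ i l, i ≤ l → l < N → b l ≤ b i) :
    ∑ i ∈ Finset.range N, max (b i - b (j - 1)) 0 = ∑ i ∈ Finset.range j, (b i - b (j - 1)) := by
  rw [← Finset.sum_subset (Finset.range_mono hj)]
  · refine Finset.sum_congr rfl fun i hi => max_eq_left (sub_nonneg.2 (hb _ _ ?_ (by omega)))
    have := Finset.mem_range.1 hi
    omega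
  · intro i hi hij
    have h1 := Finset.mem_range.1 hi
    have h2 : ¬ i < j := fun h => hij (Finset.mem_range.2 h)
    exact max_eq_right (sub_nonpos.2 (hb _ _ (by omega) h1))

/-! ### The three couples as sources. -/

theorem abs_ite_one (p : Prop) [Decidable p] : |(if p then 1 else 0 : ℝ)| = if p then 1 else 0 := by
  split_ifs <;> simp

/-- The matrix sorts the averages of `|x|`. With `lam` the sorted value at `t`, the sorted sum up to
`t` is the sum of the excesses over `lam` plus `t * lam`. If this stayed below the K-functional
along a subsequence, `lam` would have a limit point `l`, and by Fatou the truncation of `x` at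
height `l` would be cheaper than the K-functional allows. -/
theorem isSource_coupleL : IsSource (coupleL halfLine) := by
  intro x hx
  have hloc : LocInt x := isHalfLineCouple_coupleL.locInt hx
  choose π hπ hanti using fun m : ℕ => exists_perm_antitone (4 ^ m)
    (avg m (|x| : ℝ →ₘ[halfLine] ℝ))
  refine ⟨fun m i j => if π m i = j then 1 else 0, fun m => ⟨matContr_coupleL (fun i hi => ?_)
    fun j hj => ?_, fun i j => by positivity⟩, ?_⟩
  · simp only [abs_ite_one, Finset.sum_ite_eq]
    split_ifs <;> norm_num
  · simp only [abs_ite_one, ← Equiv.eq_symm_apply, Finset.sum_ite_eq']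
    split_ifs <;> norm_num
  intro n k hk0 hk ε hε
  set a : ℕ → ℕ → ℝ := fun m => avg m (|x| : ℝ →ₘ[halfLine] ℝ) with ha
  have ha0 : ∀ m i, 0 ≤ a m i := fun m i => avg_abs_nonneg m x i
  have hsum : ∀ d, ∑ i ∈ Finset.range (k * 2 ^ d), ∑ j ∈ Finset.range (4 ^ (n + d)),
      (if π (n + d) i = j then 1 else 0) * avg (n + d) (|x| : ℝ →ₘ[halfLine] ℝ) j =
      ∑ i ∈ Finset.range (k * 2 ^ d), a (n + d) (π (n + d) i) := fun d => by
    refine Finset.sum_congr rfl fun i hi => ?_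
    have hi' : π (n + d) i < 4 ^ (n + d) :=
      (hπ (n + d) i).2 ((Finset.mem_range.1 hi).trans_le (mul_two_pow_le hk d))
    simp [hi', ha]
  simp only [hsum]
  have ht := gridPt_pos (n := n) hk0
  set t := gridPt n k with ht'
  have htR : (0 : ℝ) < t := ht
  have hKtop := (isSeminorm_coupleL halfLine).K_lt_top ht hx
  refine eventually_of_not_subseq hKtop.ne (fun d => mul_nonneg (mesh_pos _).le
    (Finset.sum_nonneg fun i _ => ha0 _ _)) hε fun φ hφ hle => ?_
  set κ := ((coupleL halfLine).K t x).toReal with hκ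
  set b : ℕ → ℝ := fun d => mesh (n + d) *
    ∑ i ∈ Finset.range (k * 2 ^ d), a (n + d) (π (n + d) i) with hb
  -- The index `k * 2 ^ d - 1` belongs to the last fine block in `(0, t]`.
  set lam : ℕ → ℝ := fun d => a (n + d) (π (n + d) (k * 2 ^ d - 1)) with hlam
  have hlam0 : ∀ d, 0 ≤ lam d := fun d => ha0 _ _
  set v : ℕ → ℕ → ℝ := fun d i => max (a (n + d) i - lam d) 0 with hv
  have hj0 : ∀ d, 0 < k * 2 ^ d := fun d => by positivity
  have hsum2 : ∀ d, mesh (n + d) * ∑ i ∈ Finset.range (4 ^ (n + d)), v d i + t * lam d = b d :=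
    fun d => by
      rw [← sum_range_perm (hπ (n + d)) (v d)]
      have := sum_max_sub_eq (hj0 d) (mul_two_pow_le hk d)
        (b := fun i => a (n + d) (π (n + d) i)) (hanti (n + d))
      simp only [hv, hlam, this, Finset.sum_sub_distrib, Finset.sum_const, Finset.card_range,
        nsmul_eq_mul, hb]
      rw [ht', coe_gridPt, ← mul_mesh_add k n d]
      ring
  have hg : ∀ d, ∫⁻ s, ‖stepClass (n + d) (v d) s‖ₑ ∂halfLine = ENNReal.ofReal (b d - t * lam d) :=
    fun d => by
      rw [lintegral_enorm_stepClass, ← hsum2 d, add_sub_cancel_right, Finset.mul_sum,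
        ENNReal.ofReal_sum_of_nonneg fun i _ => mul_nonneg (mesh_pos _).le (le_max_right _ _)]
      refine Finset.sum_congr rfl fun i _ => ?_
      rw [ENNReal.ofReal_mul (mesh_pos _).le, Real.enorm_of_nonneg (le_max_right _ _)]
  have hlamle : ∀ d, t * lam d ≤ b d := fun d => by
    rw [← hsum2 d]
    have : 0 ≤ mesh (n + d) * ∑ i ∈ Finset.range (4 ^ (n + d)), v d i :=
      mul_nonneg (mesh_pos _).le (Finset.sum_nonneg fun i _ => le_max_right _ _)
    linarith
  obtain ⟨l, hl, ψ, hψ, hlim⟩ := (isCompact_Icc (a := (0 : ℝ)) (b := κ / t)).tendsto_subseq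
    (x := fun d => lam (φ d)) fun d => ⟨hlam0 _, by
      rw [le_div_iff₀ htR, mul_comm]
      have h1 := hlamle (φ d)
      have h2 := hle d
      linarith⟩
  have htl : t * l ≤ κ - ε := le_of_tendsto' (hlim.const_mul (t : ℝ)) fun d => by
    have h1 := hlamle (φ (ψ d))
    have h2 := hle (ψ d)
    simp only [Function.comp_apply]
    linarith
  -- Fatou needs its bound for all indices, so the sequence starts at `D`, after which `t * lam`
  -- exceeds `t * l - ε / 2`.
  obtain ⟨D, hD⟩ := eventually_atTop.1
    ((hlim.const_mul (t : ℝ)).eventually_const_lt (show t * l - ε / 2 < t * l by linarith))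
  have htend : Tendsto (fun d => n + φ (ψ (d + D))) atTop atTop :=
    tendsto_atTop_mono (fun d => Nat.le_add_left _ n)
      (hφ.tendsto_atTop.comp (hψ.tendsto_atTop.comp (tendsto_add_atTop_nat D)))
  have hfin : ∫⁻ s, ‖max (|x s| - l) 0‖ₑ ∂halfLine ≤ ENNReal.ofReal (κ - ε / 2 - t * l) := by
    refine lintegral_fatou (g := fun d => stepClass (n + φ (ψ (d + D))) (v (φ (ψ (d + D)))))
      (fun d => AEEqFun.measurable _) (fun d => ?_) ?_
    · rw [hg]
      refine ENNReal.ofReal_le_ofReal ?_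
      have h1 := hle (ψ (d + D))
      have h2 := hD (d + D) (by omega)
      simp only [Function.comp_apply] at h2
      linarith
    · have h1 : ∀ᵐ s ∂halfLine, ∀ d, stepClass (n + d) (v d) s = step (n + d) (v d) s :=
        ae_all_iff.2 fun d => coeFn_stepClass _ _
      have h2 : ∀ᵐ s ∂halfLine, ∀ m, blockAvg m (|x| : ℝ →ₘ[halfLine] ℝ) s = step m (a m) s :=
        ae_all_iff.2 fun d => coeFn_stepClass _ _
      filter_upwards [h1, h2, tendsto_blockAvg hloc.abs, AEEqFun.coeFn_abs x, ae_halfLine_pos]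
        with s e1 e2 e3 e4 e5
      rw [e4] at e3
      have e6 := ((e3.comp htend).sub ((tendsto_add_atTop_iff_nat D).2 hlim)).max
        (tendsto_const_nhds (x := (0 : ℝ)))
      refine e6.congr fun d => ?_
      simp only [Function.comp_apply, e1, e2]
      obtain ⟨i, hi⟩ := exists_mem_block (n + φ (ψ (d + D))) e5
      rcases lt_or_ge i (4 ^ (n + φ (ψ (d + D)))) with h | h
      · rw [step_apply h _ hi, step_apply h _ hi]
      · rw [step_eq_zero h _ hi, step_eq_zero h _ hi]
        exact max_eq_right (by have := hlam0 (φ (ψ (d + D))); linarith)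
  have hK := K_coupleL_le ht l.toNNReal x
  have e : ∀ s, ‖x s‖ₑ - (l.toNNReal : ℝ≥0∞) = ‖max (|x s| - l) 0‖ₑ := fun s => by
    rw [Real.enorm_of_nonneg (le_max_right _ _), ENNReal.ofReal_max, ENNReal.ofReal_zero,
      max_eq_left zero_le, ENNReal.ofReal_sub _ hl.1, Real.enorm_eq_ofReal_abs]
    rfl
  simp only [e] at hK
  have hK2 := hK.trans (add_le_add_left hfin _)
  have e2 : (t : ℝ≥0∞) * (l.toNNReal : ℝ≥0∞) = ENNReal.ofReal (t * l) := by
    rw [ENNReal.ofReal_mul htR.le, ENNReal.ofReal_coe_nnreal]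
    rfl
  rw [e2, ← ENNReal.ofReal_add (by linarith) (mul_nonneg htR.le hl.1)] at hK2
  have hK3 := ENNReal.toReal_mono ENNReal.ofReal_ne_top hK2
  have hpos : 0 ≤ t * l := mul_nonneg htR.le hl.1
  rw [ENNReal.toReal_ofReal (by linarith)] at hK3
  linarith

theorem exists_argmax (N : ℕ) (v : ℕ → ℝ) : ∃ ι : ℕ → ℕ,
    (∀ k < N, k ≤ ι k ∧ ι k < N ∧ ∀ i, k ≤ i → i < N → v i ≤ v (ι k)) := by
  have h : ∀ k, ∃ l, k < N → k ≤ l ∧ l < N ∧ ∀ i, k ≤ i → i < N → v i ≤ v l := fun k => by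
    by_cases hk : k < N
    · obtain ⟨l, hl, hmax⟩ := (Finset.Ico k N).exists_max_image v ⟨k, Finset.mem_Ico.2 ⟨le_rfl, hk⟩⟩
      rw [Finset.mem_Ico] at hl
      exact ⟨l, fun _ => ⟨hl.1, hl.2, fun i hi hi2 => hmax i (Finset.mem_Ico.2 ⟨hi, hi2⟩)⟩⟩
    · exact ⟨0, fun h => absurd h hk⟩
  choose ι hι using h
  exact ⟨ι, hι⟩

/-- Row `i` selects the largest average of `|x|` with index at least `i`, a discrete least
decreasing majorant. Column sums may be large, but `c (ι i) ≤ c i` for decreasing `c`, which is all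
that `TildeContr` requires. Fatou for majorants bounds the K-functional by the lower limit of the
discrete integrals. -/
theorem isSource_coupleTilde : IsSource (coupleTilde halfLine) := by
  intro x hx
  have hloc : LocInt x := isHalfLineCouple_coupleTilde.locInt hx
  choose ι hι using fun m : ℕ => exists_argmax (4 ^ m) (avg m (|x| : ℝ →ₘ[halfLine] ℝ))
  refine ⟨fun m i j => if ι m i = j then 1 else 0, fun m => ⟨matContr_coupleTilde (fun i hi => ?_)
    (fun c hc => ⟨c, fun _ _ _ _ h => hc h, fun i hi => ?_, le_rfl⟩),
    fun i j => by positivity⟩, ?_⟩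
  · simp only [abs_ite_one, Finset.sum_ite_eq]
    split_ifs <;> norm_num
  · rw [Finset.sum_eq_single (ι m i)]
    · simpa using hc (hι m i hi).1
    · intro j _ hj
      simp [hj.symm]
    · intro h
      exact absurd (Finset.mem_range.2 (hι m i hi).2.1) h
  intro n k hk0 hk ε hε
  set a : ℕ → ℕ → ℝ := fun m => avg m (|x| : ℝ →ₘ[halfLine] ℝ) with ha
  have ha0 : ∀ m i, 0 ≤ a m i := fun m i => avg_abs_nonneg m x i
  have hsum : ∀ d, ∑ i ∈ Finset.range (k * 2 ^ d), ∑ j ∈ Finset.range (4 ^ (n + d)),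
      (if ι (n + d) i = j then 1 else 0) * avg (n + d) (|x| : ℝ →ₘ[halfLine] ℝ) j =
      ∑ i ∈ Finset.range (k * 2 ^ d), a (n + d) (ι (n + d) i) := fun d => by
    refine Finset.sum_congr rfl fun i hi => ?_
    have hi' : ι (n + d) i < 4 ^ (n + d) :=
      (hι (n + d) i ((Finset.mem_range.1 hi).trans_le (mul_two_pow_le hk d))).2.1
    simp [hi', ha]
  simp only [hsum]
  have ht := gridPt_pos (n := n) hk0
  have hKtop := (isSeminorm_coupleTilde halfLine).K_lt_top ht hx
  set u : ℕ → ℝ≥0∞ := fun d => ∫⁻ s in Iic ((gridPt n k : ℝ≥0) : ℝ),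
    ldm halfLine (blockAvg (n + d) (|x| : ℝ →ₘ[halfLine] ℝ)) s ∂halfLine with hu
  have hub : ∀ d, u d ≤ ENNReal.ofReal (mesh (n + d) *
      ∑ i ∈ Finset.range (k * 2 ^ d), a (n + d) (ι (n + d) i)) := fun d => by
    have h1 : ∀ᵐ s ∂halfLine, ldm halfLine (blockAvg (n + d) (|x| : ℝ →ₘ[halfLine] ℝ)) s ≤
        step (n + d) (fun i => ENNReal.ofReal (a (n + d) (ι (n + d) i))) s := by
      filter_upwards [ae_halfLine_pos] with s hs
      refine ldm_halfLine_le (antitoneOn_step fun i hi j hj hij => ENNReal.ofReal_le_ofReal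
        ((hι _ i hi).2.2 _ (hij.trans (hι _ j hj).1) (hι _ j hj).2.1)) ?_ hs
      filter_upwards [coeFn_stepClass (n + d) (avg (n + d) (|x| : ℝ →ₘ[halfLine] ℝ)),
        ae_halfLine_pos] with r h1 h2
      rw [blockAvg, h1, enorm_step _ h2]
      obtain ⟨i, hi⟩ := exists_mem_block (n + d) h2
      rcases lt_or_ge i (4 ^ (n + d)) with h | h
      · rw [step_apply h _ hi, step_apply h _ hi, Real.enorm_of_nonneg (ha0 _ _)]
        exact ENNReal.ofReal_le_ofReal ((hι _ i h).2.2 i le_rfl h)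
      · rw [step_eq_zero h _ hi]
        exact zero_le
    refine (lintegral_mono_ae (ae_restrict_of_ae h1)).trans ?_
    rw [coe_gridPt, ← mul_mesh_add k n d, setLIntegral_step (mul_two_pow_le hk d), Finset.mul_sum,
      ENNReal.ofReal_sum_of_nonneg fun i _ => mul_nonneg (mesh_pos _).le (ha0 _ _)]
    exact Finset.sum_le_sum fun i _ => by rw [ENNReal.ofReal_mul (mesh_pos _).le]
  have hKu : (coupleTilde halfLine).K (gridPt n k) x ≤ liminf u atTop := by
    refine (K_coupleTilde_le ht x).trans (le_trans (lintegral_mono fun s => ?_)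
      (lintegral_liminf_le fun d => measurable_ldm _ _))
    have e : ldm halfLine x s = ldm halfLine (|x| : ℝ →ₘ[halfLine] ℝ) s := by
      refine essSup_congr_ae (ae_restrict_of_ae ?_)
      filter_upwards [enorm_abs_coeFn x] with r hr
      exact hr.symm
    rw [e]
    refine ldm_le_liminf ?_ s
    filter_upwards [tendsto_blockAvg hloc.abs] with r hr
    exact hr.comp (tendsto_atTop_mono (fun d => Nat.le_add_left d n) tendsto_id)
  have hε' : ENNReal.ofReal ε ≠ 0 := by simpa using hε
  rcases eq_or_ne ((coupleTilde halfLine).K (gridPt n k) x) 0 with h0 | h0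
  · rw [h0]
    exact Eventually.of_forall fun _ => zero_le
  · filter_upwards [eventually_lt_of_lt_liminf
      ((ENNReal.sub_lt_self hKtop.ne h0 hε').trans_le hKu)] with d hd
    rw [ENNReal.ofReal_add (mul_nonneg (mesh_pos _).le (Finset.sum_nonneg fun i _ => ha0 _ _)) hε.le]
    exact tsub_le_iff_right.1 (hd.le.trans (hub d))

/-- The terms are non-negative before the index `j` and non-positive from there on, so the partial
sums peak at `j`. -/
theorem sum_sub_le_sum_sub {N j l : ℕ} (hj0 : 0 < j) (hj : j ≤ N) (hl : l ≤ N) {b : ℕ → ℝ}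
    (hb : ∀ i l, i ≤ l → l < N → b l ≤ b i) :
    ∑ i ∈ Finset.range l, (b i - b (j - 1)) ≤ ∑ i ∈ Finset.range j, (b i - b (j - 1)) := by
  rw [← sum_max_sub_eq hj0 hj hb]
  calc _ ≤ ∑ i ∈ Finset.range l, max (b i - b (j - 1)) 0 :=
        Finset.sum_le_sum fun i _ => le_max_left _ _
    _ ≤ _ := Finset.sum_le_sum_of_subset_of_nonneg (Finset.range_mono hl)
        fun i _ _ => le_max_right _ _

/-- The image of the averages of `|x|` is decreasing with larger partial sums, so these are concave,
and the line touching them at `t`, with intercept `α` and slope `β`, dominates the primitive of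
`|x|` at grid points. If its value at `t` stayed below the K-functional along a subsequence, a limit
line would dominate the primitive everywhere, against `K_coupleLevel_le`. -/
theorem isSource_coupleLevel : IsSource (coupleLevel halfLine) := by
  intro x hx
  have hloc : LocInt x := isHalfLineCouple_coupleLevel.locInt hx
  choose A hA hanti hge using fun m : ℕ => exists_isOrderContr_antitone (4 ^ m)
    (avg m (|x| : ℝ →ₘ[halfLine] ℝ))
  refine ⟨A, fun m => ⟨matContr_coupleLevel (fun j hj => ?_) (hA m).levelContr,
    (hA m).nonneg⟩, ?_⟩
  · simpa only [abs_of_nonneg ((hA m).nonneg _ _)] using (hA m).col j hj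
  intro n k hk0 hk ε hε
  set c : ℕ → ℕ → ℝ := fun m i => ∑ j ∈ Finset.range (4 ^ m), A m i j *
    avg m (|x| : ℝ →ₘ[halfLine] ℝ) j with hc
  have hc0 : ∀ m i, 0 ≤ c m i := fun m i =>
    Finset.sum_nonneg fun j _ => mul_nonneg ((hA m).nonneg i j) (avg_abs_nonneg m x j)
  have ht := gridPt_pos (n := n) hk0
  set t := gridPt n k with ht'
  have htR : (0 : ℝ) < t := ht
  have hKtop := (isSeminorm_coupleLevel halfLine).K_lt_top ht hx
  refine eventually_of_not_subseq (b := fun d => mesh (n + d) *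
    ∑ i ∈ Finset.range (k * 2 ^ d), c (n + d) i) hKtop.ne (fun d => mul_nonneg (mesh_pos _).le
    (Finset.sum_nonneg fun i _ => hc0 _ _)) hε fun φ hφ hle => ?_
  set κ := ((coupleLevel halfLine).K t x).toReal with hκ
  have hj0 : ∀ d, 0 < k * 2 ^ d := fun d => by positivity
  set β : ℕ → ℝ := fun d => c (n + d) (k * 2 ^ d - 1) with hβ
  set α : ℕ → ℝ := fun d => mesh (n + d) * ∑ i ∈ Finset.range (k * 2 ^ d), (c (n + d) i - β d)
    with hα
  have hβ0 : ∀ d, 0 ≤ β d := fun d => hc0 _ _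
  have hα0 : ∀ d, 0 ≤ α d := fun d => mul_nonneg (mesh_pos _).le (Finset.sum_nonneg fun i hi =>
    sub_nonneg.2 (hanti (n + d) i _ (by have := Finset.mem_range.1 hi; omega)
      (by have := hj0 d; have := mul_two_pow_le hk d; omega)))
  have hαβ : ∀ d, α d + β d * t = mesh (n + d) * ∑ i ∈ Finset.range (k * 2 ^ d), c (n + d) i :=
    fun d => by
      simp only [hα, Finset.sum_sub_distrib, Finset.sum_const, Finset.card_range, nsmul_eq_mul]
      rw [ht', coe_gridPt, ← mul_mesh_add k n d]
      ring
  have hmaj : ∀ d l : ℕ, l ≤ 4 ^ (n + d) → ∫⁻ r in Iic (l * mesh (n + d)), ‖x r‖ₑ ∂halfLine ≤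
      ENNReal.ofReal (α d + β d * (l * mesh (n + d))) := fun d l hl => by
    rw [setLIntegral_eq_avg hloc]
    refine ENNReal.ofReal_le_ofReal ?_
    have h1 := sum_sub_le_sum_sub (hj0 d) (mul_two_pow_le hk d) hl (b := c (n + d)) (hanti (n + d))
    have h2 := hge (n + d) l hl
    have h3 := mul_le_mul_of_nonneg_left h1 (mesh_pos (n + d)).le
    have h4 := mul_le_mul_of_nonneg_left h2 (mesh_pos (n + d)).le
    rw [Finset.sum_sub_distrib, Finset.sum_const, Finset.card_range, nsmul_eq_mul] at h3
    simp only [hα, hβ]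
    linarith
  have hbd : ∀ d, (α (φ d), β (φ d)) ∈ Icc (0 : ℝ) κ ×ˢ Icc (0 : ℝ) (κ / t) := fun d => by
    have h1 := hle d
    rw [← hαβ] at h1
    have h2 := mul_nonneg (hβ0 (φ d)) htR.le
    refine ⟨⟨hα0 _, by linarith⟩, hβ0 _, ?_⟩
    rw [le_div_iff₀ htR]
    have h3 := hα0 (φ d)
    linarith
  obtain ⟨⟨p, q⟩, hpq, ψ, hψ, hlim⟩ := (isCompact_Icc.prod isCompact_Icc).tendsto_subseq hbd
  have hp : Tendsto (fun d => α (φ (ψ d))) atTop (𝓝 p) := (continuous_fst.tendsto _).comp hlim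
  have hq : Tendsto (fun d => β (φ (ψ d))) atTop (𝓝 q) := (continuous_snd.tendsto _).comp hlim
  have hpq2 : p + q * t ≤ κ - ε := le_of_tendsto' (hp.add (hq.mul_const (t : ℝ))) fun d => by
    rw [hαβ]
    have := hle (ψ d)
    linarith
  have htend : Tendsto (fun d => n + φ (ψ d)) atTop atTop :=
    tendsto_atTop_mono (fun d => Nat.le_add_left _ n) (hφ.tendsto_atTop.comp hψ.tendsto_atTop)
  have hfin : ∀ s, 0 ≤ s → ∫⁻ r in Iic s, ‖x r‖ₑ ∂halfLine ≤ ENNReal.ofReal (p + q * s) :=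
    fun s hs => by
      have h1 : Tendsto (fun d => ENNReal.ofReal (α (φ (ψ d)) +
          β (φ (ψ d)) * (s + mesh (n + φ (ψ d))))) atTop (𝓝 (ENNReal.ofReal (p + q * (s + 0)))) :=
        ENNReal.tendsto_ofReal (hp.add (hq.mul (tendsto_const_nhds.add
          (tendsto_mesh.comp htend))))
      rw [add_zero] at h1
      refine ge_of_tendsto h1 ?_
      -- Once `s ≤ 2 ^ m`, there is a grid point within one mesh above `s`.
      filter_upwards [htend.eventually
        ((tendsto_pow_atTop_atTop_of_one_lt one_lt_two).eventually_ge_atTop s)] with d hd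
      set m := n + φ (ψ d) with hm
      have hmp := mesh_pos m
      have hl1 : s ≤ (⌈s / mesh m⌉₊ : ℝ) * mesh m := by
        rw [← div_le_iff₀ hmp]
        exact Nat.le_ceil _
      have hl2 : (⌈s / mesh m⌉₊ : ℝ) * mesh m ≤ s + mesh m := by
        have := (Nat.ceil_lt_add_one (div_nonneg hs hmp.le)).le
        calc _ ≤ (s / mesh m + 1) * mesh m := mul_le_mul_of_nonneg_right this hmp.le
          _ = s + mesh m := by field_simp
      have hl3 : ⌈s / mesh m⌉₊ ≤ 4 ^ m := by
        rw [Nat.ceil_le, div_le_iff₀ hmp]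
        push_cast
        rw [four_pow_mul_mesh]
        exact hd
      calc _ ≤ ∫⁻ r in Iic ((⌈s / mesh m⌉₊ : ℝ) * mesh m), ‖x r‖ₑ ∂halfLine :=
            lintegral_mono_set (Iic_subset_Iic.2 hl1)
        _ ≤ _ := hmaj _ _ hl3
        _ ≤ _ := ENNReal.ofReal_le_ofReal (by gcongr; exact hβ0 _)
  have hK := K_coupleLevel_le ht hloc hpq.1.1 hpq.2.1 hfin
  have hK2 := ENNReal.toReal_mono ENNReal.ofReal_ne_top hK
  have h1 : 0 ≤ p := hpq.1.1
  have h2 : 0 ≤ q * t := mul_nonneg hpq.2.1 htR.le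
  rw [ENNReal.toReal_ofReal (by linarith)] at hK2
  linarith

/-! ### The three couples as targets. -/

/-- Linear functionals of the block averages of `y` are dominated by those of images under
matrices of vectors whose partial sums dominate `κ`. -/
def IsTarget (Y : Couple (ℝ →ₘ[halfLine] ℝ)) (y : ℝ →ₘ[halfLine] ℝ) (κ : ℝ≥0 → ℝ≥0∞) : Prop :=
  ∀ (n : ℕ) (φ : ℕ → ℝ), ∃ U : ℕ → ℕ → ℝ, MatContr Y n U ∧ ∃ M : ℝ, 0 ≤ M ∧
    ∀ (w : ℕ → ℝ) (δ : ℝ), 0 ≤ δ →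
      (∀ k, 0 < k → k ≤ 4 ^ n →
        (κ (gridPt n k)).toReal ≤ mesh n * ∑ i ∈ Finset.range k, w i + δ) →
      ∑ k ∈ Finset.range (4 ^ n), φ k * avg n y k ≤
        ∑ k ∈ Finset.range (4 ^ n), φ k * ∑ j ∈ Finset.range (4 ^ n), U k j * w j + M * δ

open Couple in
-- For each functional the operator is a source contraction, the inclusion of `X` in `Y`, and a
-- target contraction, in this order. The target multiplies the error of the source by `M`, whence
-- the accuracy `ε / (M + 1)`.
theorem exists_op_of_source_target {X Y : Couple (ℝ →ₘ[halfLine] ℝ)} (hXs : IsSource X)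
    (hXh : IsHalfLineCouple X) (hXl : IsLatticeCouple X) (hYh : IsHalfLineCouple Y)
    (hle₀ : ∀ f, Y.norm₀ f ≤ X.norm₀ f) (hle₁ : ∀ f, Y.norm₁ f ≤ X.norm₁ f) {x : X.sum}
    {y : ℝ →ₘ[halfLine] ℝ} {κ : ℝ≥0 → ℝ≥0∞} (hy : LocInt y) (hT : IsTarget Y y κ)
    (hκ : ∀ t, 0 < t → κ t ≤ X.K t (x : ℝ →ₘ[halfLine] ℝ)) :
    ∃ T : X.sum →ₗ[ℝ] Y.sum, OpNormLE X Y 1 T ∧ (T x : ℝ →ₘ[halfLine] ℝ) = y := by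
  refine exists_op_of_forall_separated hXh.seminorm hYh hy fun n φ ε hε => ?_
  obtain ⟨U, hU, M, hM, h⟩ := hT n φ
  have hδ : 0 < ε / (M + 1) := by positivity
  obtain ⟨R, hR, hRx⟩ := hXs.exists_op hXh hXl x n hδ
  obtain ⟨S, hS, hSx⟩ := exists_op_matOp hYh hU
  obtain ⟨J, hJ, hJx⟩ := exists_op (X := X) (Y := Y) (c := 1) hXh.seminorm id
    (fun _ _ _ _ => rfl) (fun _ _ _ => rfl) (fun f _ => by simpa using hle₀ f)
    (fun f _ => by simpa using hle₁ f)
  refine ⟨S ∘ₗ J ∘ₗ R, by simpa using hS.comp (hJ.comp hR), ?_⟩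
  have h1 := h (avg n (R x : ℝ →ₘ[halfLine] ℝ)) _ hδ.le fun k hk0 hk => by
    refine le_trans (ENNReal.toReal_mono ?_ (hκ _ (gridPt_pos hk0))) (hRx k hk0 hk)
    exact (hXh.seminorm.K_lt_top (gridPt_pos hk0) x.2).ne
  have h2 : M * (ε / (M + 1)) ≤ ε := by
    rw [mul_div_assoc', div_le_iff₀ (by positivity)]
    nlinarith
  refine h1.trans (add_le_add (le_of_eq (Finset.sum_congr rfl fun k hk => ?_)) h2)
  rw [LinearMap.comp_apply, LinearMap.comp_apply, hSx, hJx, matOp,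
    avg_stepClass (Finset.mem_range.1 hk)]
  rfl

/-- Hardy's lemma with a uniform error `η`, which is added to the first entry of `c` and so meets
the weight `a 0` only. -/
theorem sum_mul_le_sum_mul_add {N : ℕ} (hN : 0 < N) {a b c : ℕ → ℝ} {η : ℝ}
    (ha : ∀ i j, i ≤ j → j < N → a j ≤ a i) (ha0 : ∀ i < N, 0 ≤ a i)
    (h : ∀ k, 0 < k → k ≤ N → ∑ i ∈ Finset.range k, b i ≤ ∑ i ∈ Finset.range k, c i + η) :
    ∑ i ∈ Finset.range N, a i * b i ≤ ∑ i ∈ Finset.range N, a i * c i + a 0 * η := by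
  have h1 := sum_mul_le_sum_mul_of_antitone (N := N) (a := a) (b := b)
    (c := fun i => c i + if i = 0 then η else 0) ha ha0 fun k hk => by
      rcases Nat.eq_zero_or_pos k with rfl | hk0
      · simp
      · rw [Finset.sum_add_distrib, Finset.sum_ite_eq', if_pos (Finset.mem_range.2 hk0)]
        exact h k hk0 hk
  refine h1.trans (le_of_eq ?_)
  simp only [mul_add, Finset.sum_add_distrib, mul_ite, mul_zero, Finset.sum_ite_eq',
    Finset.mem_range, hN, if_true]

theorem sum_le_sum_add_of_mesh {n k : ℕ} {b w : ℕ → ℝ} {δ κ : ℝ}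
    (h1 : mesh n * ∑ i ∈ Finset.range k, b i ≤ κ)
    (h2 : κ ≤ mesh n * ∑ i ∈ Finset.range k, w i + δ) :
    ∑ i ∈ Finset.range k, b i ≤ ∑ i ∈ Finset.range k, w i + 2 ^ n * δ := by
  have h := mul_le_mul_of_nonneg_left (h1.trans h2) (by positivity : (0 : ℝ) ≤ 2 ^ n)
  rwa [mul_add, ← mul_assoc, ← mul_assoc, pow_mul_mesh, one_mul, one_mul] at h

/-- The matrix that moves the entry with index `j` to the place `θ j`, with the sign of `φ`. -/
noncomputable def signedMove (φ : ℕ → ℝ) (θ : ℕ → ℕ) (k j : ℕ) : ℝ :=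
  if θ j = k then (if 0 ≤ φ k then 1 else -1) else 0

theorem abs_signedMove (φ : ℕ → ℝ) (θ : ℕ → ℕ) (k j : ℕ) :
    |signedMove φ θ k j| = if θ j = k then 1 else 0 := by
  unfold signedMove
  split_ifs <;> simp

theorem sum_mul_signedMove {N : ℕ} (φ : ℕ → ℝ) {θ : ℕ → ℕ} (hθ : ∀ j < N, θ j < N) (w : ℕ → ℝ) :
    ∑ k ∈ Finset.range N, φ k * ∑ j ∈ Finset.range N, signedMove φ θ k j * w j =
      ∑ j ∈ Finset.range N, |φ (θ j)| * w j := by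
  simp only [Finset.mul_sum]
  rw [Finset.sum_comm]
  refine Finset.sum_congr rfl fun j hj => ?_
  rw [Finset.sum_eq_single (θ j)]
  · rw [signedMove, if_pos rfl, ← mul_assoc]
    split_ifs with h
    · rw [mul_one, abs_of_nonneg h]
    · rw [mul_neg_one, abs_of_neg (not_le.1 h)]
  · intro k _ hk
    simp [signedMove, hk.symm]
  · intro h
    exact absurd (Finset.mem_range.2 (hθ j (Finset.mem_range.1 hj))) h

theorem sum_abs_signedMove_col {N : ℕ} (φ : ℕ → ℝ) (θ : ℕ → ℕ) (j : ℕ) :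
    ∑ i ∈ Finset.range N, |signedMove φ θ i j| ≤ 1 := by
  simp only [abs_signedMove, Finset.sum_ite_eq]
  split_ifs <;> norm_num

theorem ofReal_mesh_mul_sum_abs_avg_le (n : ℕ) (s : Finset ℕ) (y : ℝ →ₘ[halfLine] ℝ) :
    ENNReal.ofReal (mesh n * ∑ i ∈ s, |avg n y i|) ≤
      ∫⁻ r in ⋃ i ∈ s, block n i, ‖y r‖ₑ ∂halfLine := by
  rw [lintegral_biUnion_finset (fun i _ j _ hij => pairwise_disjoint_block n hij)
    (fun i _ => measurableSet_block n i), Finset.mul_sum,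
    ENNReal.ofReal_sum_of_nonneg fun i _ => mul_nonneg (mesh_pos _).le (abs_nonneg _)]
  refine Finset.sum_le_sum fun i _ => ?_
  rw [ENNReal.ofReal_mul (mesh_pos _).le, ← Real.enorm_eq_ofReal_abs]
  exact ofReal_mesh_mul_enorm_avg_le n y i

theorem le_toReal_of_ofReal_le {a : ℝ} {b : ℝ≥0∞} (hb : b ≠ ∞) (h : ENNReal.ofReal a ≤ b) :
    a ≤ b.toReal := (ENNReal.ofReal_le_iff_le_toReal hb).1 h

theorem four_pow_pos (n : ℕ) : 0 < 4 ^ n := Nat.pow_pos (by norm_num)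

/-- Once `|φ|` is sorted, Hardy's lemma asks for sums of `|avg n y|` over arbitrary sets of `k`
blocks, and the K-functional of `(L¹, L^∞)` controls integrals over any set of that measure. -/
theorem isTarget_coupleL {y : ℝ →ₘ[halfLine] ℝ} (hy : y ∈ (coupleL halfLine).sum) :
    IsTarget (coupleL halfLine) y fun t => (coupleL halfLine).K t y := by
  intro n φ
  obtain ⟨π, hπ, hanti⟩ := exists_perm_antitone (4 ^ n) fun i => |φ i|
  refine ⟨signedMove φ π, matContr_coupleL (fun i hi => ?_)
    (fun j _ => sum_abs_signedMove_col φ π j), |φ (π 0)| * 2 ^ n, by positivity,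
    fun w δ _ h => ?_⟩
  · simp only [abs_signedMove, ← Equiv.eq_symm_apply, Finset.sum_ite_eq']
    split_ifs <;> norm_num
  rw [sum_mul_signedMove φ fun j hj => (hπ j).2 hj]
  calc _ ≤ ∑ k ∈ Finset.range (4 ^ n), |φ k| * |avg n y k| :=
        Finset.sum_le_sum fun k _ => (le_abs_self _).trans (abs_mul _ _).le
    _ = ∑ k ∈ Finset.range (4 ^ n), |φ (π k)| * |avg n y (π k)| :=
        (sum_range_perm hπ fun k => |φ k| * |avg n y k|).symm
    _ ≤ ∑ k ∈ Finset.range (4 ^ n), |φ (π k)| * w k + |φ (π 0)| * (2 ^ n * δ) := by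
        refine sum_mul_le_sum_mul_add (four_pow_pos n) hanti (fun _ _ => abs_nonneg _)
          fun k hk0 hk => sum_le_sum_add_of_mesh ?_ (h k hk0 hk)
        refine le_toReal_of_ofReal_le
          ((isSeminorm_coupleL halfLine).K_lt_top (gridPt_pos hk0) hy).ne ?_
        have e : ∑ i ∈ Finset.range k, |avg n y (π i)| =
            ∑ i ∈ (Finset.range k).image π, |avg n y i| :=
          (Finset.sum_image (f := fun i => |avg n y i|) fun a _ b _ hab => π.injective hab).symm
        rw [e]
        refine (ofReal_mesh_mul_sum_abs_avg_le n _ y).trans (setLIntegral_le_K_coupleL ?_ y)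
        refine (measure_biUnion_finset_le _ _).trans (le_of_eq ?_)
        simp only [halfLine_block]
        rw [Finset.sum_const, Finset.card_image_of_injective _ π.injective, Finset.card_range,
          nsmul_eq_mul, ← ENNReal.ofReal_natCast, ← ENNReal.ofReal_mul (Nat.cast_nonneg k)]
        rfl
    _ = _ := by ring

theorem biUnion_block_subset (n k : ℕ) :
    ⋃ i ∈ Finset.range k, block n i ⊆ Iic ((gridPt n k : ℝ≥0) : ℝ) := by
  rw [biUnion_block, coe_gridPt]
  exact Ioc_subset_Iic_self

/-- Moving entry `j` to the place `ι j ≥ j` replaces `|φ|` by its discrete least decreasing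
majorant. Moves to the right can only lower initial sums of non-negative vectors, so the matrix is a
contraction for the level norm. With decreasing weights only initial sums of `|avg n y|` matter. -/
theorem isTarget_coupleLevel {y : ℝ →ₘ[halfLine] ℝ} (hy : y ∈ (coupleLevel halfLine).sum) :
    IsTarget (coupleLevel halfLine) y fun t => (coupleLevel halfLine).K t y := by
  intro n φ
  obtain ⟨ι, hι⟩ := exists_argmax (4 ^ n) fun i => |φ i|
  refine ⟨signedMove φ ι, matContr_coupleLevel (fun j _ => sum_abs_signedMove_col φ ι j)
    fun w hw C hC k hk => ?_, |φ (ι 0)| * 2 ^ n, by positivity, fun w δ _ h => ?_⟩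
  · refine le_trans ?_ (hC k hk)
    rw [Finset.sum_comm]
    have e : ∀ j ∈ Finset.range (4 ^ n), ∑ i ∈ Finset.range k, |signedMove φ ι i j| * w j ≤
        if j < k then w j else 0 := fun j hj => by
      simp only [abs_signedMove, ite_mul, one_mul, zero_mul, Finset.sum_ite_eq, Finset.mem_range]
      have h1 := (hι j (Finset.mem_range.1 hj)).1
      split_ifs
      · exact le_rfl
      · omega
      · exact hw j
      · exact le_rfl
    refine (Finset.sum_le_sum e).trans (le_of_eq ?_)
    rw [← Finset.sum_filter]
    refine Finset.sum_congr ?_ fun _ _ => rfl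
    ext j
    simp only [Finset.mem_filter, Finset.mem_range]
    omega
  rw [sum_mul_signedMove φ fun j hj => (hι j hj).2.1]
  calc _ ≤ ∑ k ∈ Finset.range (4 ^ n), |φ (ι k)| * |avg n y k| := by
        refine Finset.sum_le_sum fun k hk => (le_abs_self _).trans ?_
        rw [abs_mul]
        have hk' := Finset.mem_range.1 hk
        exact mul_le_mul_of_nonneg_right ((hι k hk').2.2 k le_rfl hk') (abs_nonneg _)
    _ ≤ ∑ k ∈ Finset.range (4 ^ n), |φ (ι k)| * w k + |φ (ι 0)| * (2 ^ n * δ) := by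
        refine sum_mul_le_sum_mul_add (four_pow_pos n) (fun i j hij hj => ?_)
          (fun _ _ => abs_nonneg _) fun k hk0 hk => sum_le_sum_add_of_mesh ?_ (h k hk0 hk)
        · exact (hι i (hij.trans_lt hj)).2.2 _ (hij.trans (hι j hj).1) (hι j hj).2.1
        refine le_toReal_of_ofReal_le
          ((isSeminorm_coupleLevel halfLine).K_lt_top (gridPt_pos hk0) hy).ne ?_
        exact (ofReal_mesh_mul_sum_abs_avg_le n _ y).trans ((lintegral_mono_set
          (biUnion_block_subset n k)).trans (isHalfLineCouple_coupleLevel.setLIntegral_le_K _ y))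
    _ = _ := by ring

theorem avg_le_of_ae_le {f : ℝ →ₘ[halfLine] ℝ} (hf : LocInt f) {n k : ℕ} {c : ℝ}
    (h : ∀ᵐ s ∂halfLine, s ∈ block n k → f s ≤ c) : avg n f k ≤ c := by
  have h1 : ∫ s in block n k, f s ∂halfLine ≤ ∫ _s in block n k, c ∂halfLine :=
    setIntegral_mono_on_ae (hf.integrableOn_block n k)
      (integrableOn_const (by rw [halfLine_block]; exact ENNReal.ofReal_ne_top))
      (measurableSet_block n k) h
  rw [setIntegral_const, Measure.real, halfLine_block, ENNReal.toReal_ofReal (mesh_pos n).le,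
    smul_eq_mul] at h1
  calc avg n f k ≤ 2 ^ n * (mesh n * c) := mul_le_mul_of_nonneg_left h1 (by positivity)
    _ = c := by rw [← mul_assoc, pow_mul_mesh, one_mul]

theorem le_avg_of_le_ae {f : ℝ →ₘ[halfLine] ℝ} (hf : LocInt f) {n k : ℕ} {c : ℝ}
    (h : ∀ᵐ s ∂halfLine, s ∈ block n k → c ≤ f s) : c ≤ avg n f k := by
  have h1 : ∫ _s in block n k, c ∂halfLine ≤ ∫ s in block n k, f s ∂halfLine :=
    setIntegral_mono_on_ae
      (integrableOn_const (by rw [halfLine_block]; exact ENNReal.ofReal_ne_top))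
      (hf.integrableOn_block n k) (measurableSet_block n k) h
  rw [setIntegral_const, Measure.real, halfLine_block, ENNReal.toReal_ofReal (mesh_pos n).le,
    smul_eq_mul] at h1
  calc c = 2 ^ n * (mesh n * c) := by rw [← mul_assoc, pow_mul_mesh, one_mul]
    _ ≤ avg n f k := mul_le_mul_of_nonneg_left h1 (by positivity)

theorem setLIntegral_ldm_lt_top {y : ℝ →ₘ[halfLine] ℝ} (hy : y ∈ (coupleTilde halfLine).sum) (R : ℝ) :
    ∫⁻ s in Iic R, ldm halfLine y s ∂halfLine < ∞ := by
  have ht : 0 < (max R 1).toNNReal := by simp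
  refine lt_of_le_of_lt ?_ ((isSeminorm_coupleTilde halfLine).K_lt_top ht hy)
  refine le_trans (lintegral_mono_set (Iic_subset_Iic.2 ?_)) (setLIntegral_ldm_le_K _ y)
  exact (le_max_left _ _).trans (Real.le_coe_toNNReal _)

/-- An infinite value at `s` would persist on all of `(0, s]` and contradict integrability there. -/
theorem ldm_lt_top {y : ℝ →ₘ[halfLine] ℝ} (hy : y ∈ (coupleTilde halfLine).sum)
    {s : ℝ} (hs : 0 < s) : ldm halfLine y s < ∞ := by
  by_contra h
  rw [not_lt_top_iff] at h
  have h1 : ∫⁻ _s in Iic s, (∞ : ℝ≥0∞) ∂halfLine ≤ ∫⁻ s in Iic s, ldm halfLine y s ∂halfLine :=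
    setLIntegral_mono' measurableSet_Iic fun r hr => by
      rw [← h]
      exact ldm_antitone _ _ hr
  rw [setLIntegral_const, halfLine_Iic, ENNReal.top_mul (by simpa using hs)] at h1
  exact absurd (setLIntegral_ldm_lt_top hy s) (not_lt.2 h1)

theorem coeFn_ldmClass (y : ℝ →ₘ[halfLine] ℝ) :
    ∀ᵐ s ∂halfLine, ldmClass halfLine y s = (ldm halfLine y s).toReal :=
  AEEqFun.coeFn_mk _ _

theorem enorm_ldmClass {y : ℝ →ₘ[halfLine] ℝ} (hy : y ∈ (coupleTilde halfLine).sum) :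
    ∀ᵐ s ∂halfLine, ‖ldmClass halfLine y s‖ₑ = ldm halfLine y s := by
  filter_upwards [coeFn_ldmClass y, ae_halfLine_pos] with s h1 h2
  rw [h1, Real.enorm_of_nonneg ENNReal.toReal_nonneg, ENNReal.ofReal_toReal (ldm_lt_top hy h2).ne]

theorem locInt_ldmClass {y : ℝ →ₘ[halfLine] ℝ} (hy : y ∈ (coupleTilde halfLine).sum) :
    LocInt (ldmClass halfLine y) := fun R => by
  rw [lintegral_congr_ae (ae_restrict_of_ae (enorm_ldmClass hy))]
  exact setLIntegral_ldm_lt_top hy R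

theorem avg_ldmClass_nonneg {y : ℝ →ₘ[halfLine] ℝ} (hy : y ∈ (coupleTilde halfLine).sum)
    (n k : ℕ) : 0 ≤ avg n (ldmClass halfLine y) k := by
  refine le_avg_of_le_ae (locInt_ldmClass hy) ?_
  filter_upwards [coeFn_ldmClass y] with s hs _
  rw [hs]
  exact ENNReal.toReal_nonneg

theorem antitone_avg_ldmClass {y : ℝ →ₘ[halfLine] ℝ} (hy : y ∈ (coupleTilde halfLine).sum)
    (n : ℕ) : Antitone (avg n (ldmClass halfLine y)) := by
  refine antitone_nat_of_succ_le fun j => ?_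
  have hpos : 0 < ((j : ℝ) + 1) * mesh n := mul_pos (by positivity) (mesh_pos n)
  refine (avg_le_of_ae_le (locInt_ldmClass hy)
    (c := (ldm halfLine y (((j : ℝ) + 1) * mesh n)).toReal) ?_).trans
    (le_avg_of_le_ae (locInt_ldmClass hy) ?_)
  · filter_upwards [coeFn_ldmClass y] with s hs hb
    have h1 := hb.1
    push_cast at h1
    rw [hs]
    exact ENNReal.toReal_mono (ldm_lt_top hy hpos).ne (ldm_antitone _ _ h1.le)
  · filter_upwards [coeFn_ldmClass y] with s hs hb
    rw [hs]
    exact ENNReal.toReal_mono (ldm_lt_top hy (block_subset_Ioi n j hb)).ne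
      (ldm_antitone _ _ hb.2)

/-- The averages `a` of the majorant are non-negative and decreasing. Hence `φ` may be replaced by
its positive part, and this in turn, by Hardy's lemma with weights `a`, by its decreasing image `c`
under `A`. The matrix is the transpose of `A` with the rows where `φ` is negative erased. A second
use of Hardy's lemma, now with weights `c`, compares `a` with `w`. -/
theorem isTarget_coupleTilde {y : ℝ →ₘ[halfLine] ℝ} (hy : y ∈ (coupleTilde halfLine).sum) :
    IsTarget (coupleTilde halfLine) (ldmClass halfLine y)
    fun t => (coupleTilde halfLine).K t y := by
  intro n φ
  obtain ⟨A, hA, hanti, hge⟩ := exists_isOrderContr_antitone (4 ^ n) fun i => max (φ i) 0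
  set c : ℕ → ℝ := fun i => ∑ l ∈ Finset.range (4 ^ n), A i l * max (φ l) 0 with hc
  have hc0 : ∀ i, 0 ≤ c i := fun i =>
    Finset.sum_nonneg fun l _ => mul_nonneg (hA.nonneg i l) (le_max_right _ _)
  have hUA : ∀ i j, |if 0 ≤ φ i then A j i else 0| ≤ A j i := fun i j => by
    split_ifs
    · rw [abs_of_nonneg (hA.nonneg j i)]
    · simpa using hA.nonneg j i
  refine ⟨fun k j => if 0 ≤ φ k then A j k else 0, matContr_coupleTilde (fun i hi => ?_)
    (hA.tildeContr hUA), c 0 * 2 ^ n, mul_nonneg (hc0 0) (by positivity), fun w δ _ h => ?_⟩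
  · exact (Finset.sum_le_sum fun j _ => hUA i j).trans (hA.col i hi)
  have e : ∑ k ∈ Finset.range (4 ^ n), φ k * ∑ j ∈ Finset.range (4 ^ n),
      (if 0 ≤ φ k then A j k else 0) * w j = ∑ j ∈ Finset.range (4 ^ n), c j * w j := by
    simp only [Finset.mul_sum, hc, Finset.sum_mul]
    rw [Finset.sum_comm]
    refine Finset.sum_congr rfl fun j _ => Finset.sum_congr rfl fun k _ => ?_
    split_ifs with hk
    · rw [max_eq_left hk]
      ring
    · rw [max_eq_right (not_le.1 hk).le]
      ring
  rw [e]
  set a := avg n (ldmClass halfLine y) with ha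
  have ha0 : ∀ k, 0 ≤ a k := avg_ldmClass_nonneg hy n
  calc _ ≤ ∑ k ∈ Finset.range (4 ^ n), a k * max (φ k) 0 :=
        Finset.sum_le_sum fun k _ => by
          rw [mul_comm]
          exact mul_le_mul_of_nonneg_left (le_max_left _ _) (ha0 k)
    _ ≤ ∑ k ∈ Finset.range (4 ^ n), a k * c k :=
        sum_mul_le_sum_mul_of_antitone (fun i j hij _ => antitone_avg_ldmClass hy n hij)
          (fun i _ => ha0 i) hge
    _ = ∑ k ∈ Finset.range (4 ^ n), c k * a k := by simp only [mul_comm]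
    _ ≤ ∑ k ∈ Finset.range (4 ^ n), c k * w k + c 0 * (2 ^ n * δ) := by
        refine sum_mul_le_sum_mul_add (four_pow_pos n) hanti (fun i _ => hc0 i)
          fun k hk0 hk => sum_le_sum_add_of_mesh ?_ (h k hk0 hk)
        refine le_toReal_of_ofReal_le
          ((isSeminorm_coupleTilde halfLine).K_lt_top (gridPt_pos hk0) hy).ne ?_
        refine le_trans ?_ (setLIntegral_ldm_le_K _ y)
        rw [← lintegral_congr_ae (ae_restrict_of_ae (enorm_ldmClass hy))]
        have e2 : ∀ i, a i = |a i| := fun i => (abs_of_nonneg (ha0 i)).symm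
        rw [Finset.sum_congr rfl fun i _ => e2 i]
        exact (ofReal_mesh_mul_sum_abs_avg_le n _ _).trans
          (lintegral_mono_set (biUnion_block_subset n k))
    _ = _ := by ring

open Couple

/-! ### The pairs on the half line -/

theorem coupleL_norm₀_le_coupleTilde (f : ℝ →ₘ[halfLine] ℝ) :
    (coupleL halfLine).norm₀ f ≤ (coupleTilde halfLine).norm₀ f := by
  rw [coupleL_norm₀, coupleTilde_norm₀]
  exact lintegral_mono_ae (ae_enorm_le_ldm halfLine f)

theorem coupleLevel_norm₁_le_coupleL (f : ℝ →ₘ[halfLine] ℝ) :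
    (coupleLevel halfLine).norm₁ f ≤ (coupleL halfLine).norm₁ f := by
  refine coupleLevel_norm₁_le_iff.2 fun s => ?_
  rw [halfLine_Iic]
  exact isHalfLineCouple_coupleL.loc₁ f s

theorem isExactRelCM_coupleL_coupleL :
    (coupleL halfLine).IsExactRelCM (coupleL halfLine) := fun _ y h => by
  obtain ⟨T, hT, hTx⟩ := exists_op_of_source_target isSource_coupleL isHalfLineCouple_coupleL
    isLatticeCouple_coupleL isHalfLineCouple_coupleL (fun _ => le_rfl) (fun _ => le_rfl)
    (isHalfLineCouple_coupleL.locInt y.2) (isTarget_coupleL y.2) h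
  exact ⟨T, hT, Subtype.ext hTx⟩

theorem isExactRelCM_coupleTilde_coupleL :
    (coupleTilde halfLine).IsExactRelCM (coupleL halfLine) := fun _ y h => by
  obtain ⟨T, hT, hTx⟩ := exists_op_of_source_target isSource_coupleTilde
    isHalfLineCouple_coupleTilde isLatticeCouple_coupleTilde isHalfLineCouple_coupleL
    coupleL_norm₀_le_coupleTilde (fun _ => le_rfl)
    (isHalfLineCouple_coupleL.locInt y.2) (isTarget_coupleL y.2) h
  exact ⟨T, hT, Subtype.ext hTx⟩

theorem isExactRelCM_coupleL_coupleLevel :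
    (coupleL halfLine).IsExactRelCM (coupleLevel halfLine) := fun _ y h => by
  obtain ⟨T, hT, hTx⟩ := exists_op_of_source_target isSource_coupleL
    isHalfLineCouple_coupleL isLatticeCouple_coupleL isHalfLineCouple_coupleLevel
    (fun _ => le_rfl) coupleLevel_norm₁_le_coupleL
    (isHalfLineCouple_coupleLevel.locInt y.2) (isTarget_coupleLevel y.2) h
  exact ⟨T, hT, Subtype.ext hTx⟩

theorem isExactRelCM_coupleLevel_coupleLevel :
    (coupleLevel halfLine).IsExactRelCM (coupleLevel halfLine) := fun _ y h => by
  obtain ⟨T, hT, hTx⟩ := exists_op_of_source_target isSource_coupleLevel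
    isHalfLineCouple_coupleLevel isLatticeCouple_coupleLevel isHalfLineCouple_coupleLevel
    (fun _ => le_rfl) (fun _ => le_rfl)
    (isHalfLineCouple_coupleLevel.locInt y.2) (isTarget_coupleLevel y.2) h
  exact ⟨T, hT, Subtype.ext hTx⟩

/-- A function is the product of its least decreasing majorant and a function bounded by one. -/
theorem exists_mul_ldmClass_eq {y : ℝ →ₘ[halfLine] ℝ} (hy : y ∈ (coupleTilde halfLine).sum) :
    ∃ σ : ℝ →ₘ[halfLine] ℝ, (∀ᵐ s ∂halfLine, ‖σ s‖ₑ ≤ 1) ∧ σ * ldmClass halfLine y = y := by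
  have hm : Measurable fun s => y s / (ldm halfLine y s).toReal :=
    y.measurable.div (measurable_ldm halfLine y).ennreal_toReal
  have hle : ∀ᵐ s ∂halfLine, |y s| ≤ (ldm halfLine y s).toReal := by
    filter_upwards [ae_enorm_le_ldm halfLine y, ae_halfLine_pos] with s h1 h2
    refine le_toReal_of_ofReal_le (ldm_lt_top hy h2).ne ?_
    rwa [← Real.enorm_eq_ofReal_abs]
  refine ⟨AEEqFun.mk _ hm.aestronglyMeasurable, ?_, AEEqFun.ext ?_⟩
  · filter_upwards [AEEqFun.coeFn_mk (μ := halfLine) _ hm.aestronglyMeasurable, hle] with s h1 h2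
    rw [h1, Real.enorm_eq_ofReal_abs, ENNReal.ofReal_le_one, abs_div,
      abs_of_nonneg ENNReal.toReal_nonneg]
    exact div_le_one_of_le₀ h2 ENNReal.toReal_nonneg
  · filter_upwards [AEEqFun.coeFn_mk (μ := halfLine) _ hm.aestronglyMeasurable, hle,
      coeFn_ldmClass y, AEEqFun.coeFn_mul (AEEqFun.mk _ hm.aestronglyMeasurable)
        (ldmClass halfLine y)] with s h1 h2 h3 h4
    rw [h4, Pi.mul_apply, h1, h3]
    rcases eq_or_ne (ldm halfLine y s).toReal 0 with h0 | h0
    · rw [h0] at h2 ⊢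
      rw [mul_zero]
      exact (abs_nonpos_iff.1 h2).symm
    · exact div_mul_cancel₀ _ h0

/-- The separation argument reaches the majorant of `y`; a multiplier bounded by one then recovers
`y`. -/
theorem isExactRelCM_coupleTilde_coupleTilde :
    (coupleTilde halfLine).IsExactRelCM (coupleTilde halfLine) := fun x y h => by
  obtain ⟨T, hT, hTx⟩ := exists_op_of_source_target isSource_coupleTilde
    isHalfLineCouple_coupleTilde isLatticeCouple_coupleTilde isHalfLineCouple_coupleTilde
    (fun _ => le_rfl) (fun _ => le_rfl) (locInt_ldmClass y.2) (isTarget_coupleTilde y.2) h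
  obtain ⟨σ, hσ, hσy⟩ := exists_mul_ldmClass_eq y.2
  obtain ⟨S, hS, hSf⟩ := exists_op_mul isHalfLineCouple_coupleTilde.seminorm
    isLatticeCouple_coupleTilde hσ
  refine ⟨S ∘ₗ T, by simpa using hS.comp hT, Subtype.ext ?_⟩
  rw [LinearMap.comp_apply, hSf, hTx, hσy]

/-- The `L¹` norm is at most the `L̃¹` norm, and for the latter couple the K-functional of the
majorant is bounded by its own integral over `(0, t]`. -/
theorem K_coupleL_ldmClass_le {y : ℝ →ₘ[halfLine] ℝ} (hy : y ∈ (coupleTilde halfLine).sum)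
    {t : ℝ≥0} (ht : 0 < t) :
    (coupleL halfLine).K t (ldmClass halfLine y) ≤ (coupleTilde halfLine).K t y := by
  calc (coupleL halfLine).K t (ldmClass halfLine y)
      ≤ (coupleTilde halfLine).K t (ldmClass halfLine y) := by
        refine (isSeminorm_coupleTilde _).le_K fun f₀ f₁ _ _ h => (K_le ht h).trans ?_
        exact add_le_add (coupleL_norm₀_le_coupleTilde f₀) le_rfl
    _ ≤ ∫⁻ s in Iic (t : ℝ), ldm halfLine (ldmClass halfLine y) s ∂halfLine :=
        K_coupleTilde_le ht _
    _ ≤ ∫⁻ s in Iic (t : ℝ), ldm halfLine y s ∂halfLine :=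
        lintegral_mono (ldm_le_of_ae_le (ldm_antitone halfLine y)
          ((enorm_ldmClass hy).mono fun s hs => hs.le))
    _ ≤ _ := setLIntegral_ldm_le_K t y

theorem isUniformRelCM_coupleL_coupleTilde {m : ℝ≥0} (hm : IsMConst m) :
    (coupleL halfLine).IsUniformRelCM m (coupleTilde halfLine) := fun x y h => by
  obtain ⟨g, hg, M, hM, hMg⟩ := hm y
  obtain ⟨T, hT, hTx⟩ := isExactRelCM_coupleL_coupleL x g fun t ht => by
    rw [hg]
    exact (K_coupleL_ldmClass_le y.2 ht).trans (h t ht)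
  refine ⟨M ∘ₗ T, by simpa using hM.comp hT, ?_⟩
  rw [LinearMap.comp_apply, hTx, hMg]

theorem distr_halfLine {s : ℝ} (hs : 0 ≤ s) : distr halfLine s = s := by
  rw [distr, Measure.real, halfLine_Iic, ENNReal.toReal_ofReal hs]

/-- A decomposition of `x` gives the constant term from its `L¹` part and the slope from the other,
so on the sum space `level` is always given by a concave majorant. -/
theorem affineMajorants_nonempty {x : ℝ →ₘ[halfLine] ℝ} (hx : x ∈ (coupleLevel halfLine).sum) :
    (affineMajorants halfLine fun s => ‖x s‖ₑ).Nonempty := by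
  obtain ⟨f₀, f₁, h₀, h₁, rfl⟩ := (isSeminorm_coupleLevel halfLine).exists_add_eq hx
  refine ⟨(((coupleLevel halfLine).norm₀ f₀).toReal, ((coupleLevel halfLine).norm₁ f₁).toReal),
    ENNReal.toReal_nonneg, ENNReal.toReal_nonneg, fun s => ?_⟩
  have hd : 0 ≤ distr halfLine s := measureReal_nonneg
  have e : ENNReal.ofReal (distr halfLine s) = halfLine (Iic s) :=
    ENNReal.ofReal_toReal (FiniteIic.lt_top s).ne
  rw [ENNReal.ofReal_add ENNReal.toReal_nonneg (mul_nonneg ENNReal.toReal_nonneg hd),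
    ENNReal.ofReal_mul ENNReal.toReal_nonneg, ENNReal.ofReal_toReal h₀.ne,
    ENNReal.ofReal_toReal h₁.ne, e]
  calc _ ≤ ∫⁻ r in Iic s, ‖f₀ r‖ₑ + ‖f₁ r‖ₑ ∂halfLine := by
        refine lintegral_mono_ae (ae_restrict_of_ae ?_)
        filter_upwards [AEEqFun.coeFn_add f₀ f₁] with r hr
        rw [hr]
        exact enorm_add_le _ _
    _ = _ := lintegral_add_left f₀.measurable.enorm _
    _ ≤ _ := add_le_add (isHalfLineCouple_coupleLevel.loc₀ f₀ s)
        (setLIntegral_le_coupleLevel_norm₁ f₁ s)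

/-- Every affine majorant of the primitive of `|x|` lies above the K-functional at `t`. So does
their infimum, the hull, which is the primitive of the level function. -/
theorem K_coupleLevel_le_setLIntegral_level {x : ℝ →ₘ[halfLine] ℝ}
    (hx : x ∈ (coupleLevel halfLine).sum) {t : ℝ≥0} (ht : 0 < t) :
    (coupleLevel halfLine).K t x ≤ ∫⁻ s in Iic (t : ℝ), level halfLine x s ∂halfLine := by
  have hne := affineMajorants_nonempty hx
  have hlev : level halfLine x = levelAux halfLine fun s => ‖x s‖ₑ := by
    rw [level, if_pos (concaveMajorants_nonempty_iff.2 hne)]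
  rw [hlev, setLIntegral_levelAux hne, distr_halfLine t.coe_nonneg]
  have hK := (isSeminorm_coupleLevel halfLine).K_lt_top ht hx
  rw [← ENNReal.ofReal_toReal hK.ne]
  refine ENNReal.ofReal_le_ofReal (le_hull hne fun p hp => ?_)
  refine ENNReal.toReal_le_of_le_ofReal
    (add_nonneg hp.1 (mul_nonneg hp.2.1 t.coe_nonneg)) ?_
  refine K_coupleLevel_le ht (isHalfLineCouple_coupleLevel.locInt hx) hp.1 hp.2.1 fun s hs => ?_
  have := hp.2.2 s
  rwa [distr_halfLine hs] at this

theorem level_lt_top {x : ℝ →ₘ[halfLine] ℝ} (hx : x ∈ (coupleLevel halfLine).sum) :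
    ∀ᵐ s ∂halfLine, level halfLine x s < ∞ := by
  have hne := affineMajorants_nonempty hx
  have hlev : level halfLine x = levelAux halfLine fun s => ‖x s‖ₑ := by
    rw [level, if_pos (concaveMajorants_nonempty_iff.2 hne)]
  have hmeas : AEMeasurable (level halfLine x) halfLine := by
    rw [hlev]
    exact ⟨_, measurable_hullDensity, levelAux_ae_eq hne⟩
  have h : ∀ n : ℕ, ∀ᵐ s ∂halfLine, s ∈ Iic (n : ℝ) → level halfLine x s < ∞ := fun n => by
    rw [← ae_restrict_iff' measurableSet_Iic]
    refine ae_lt_top' hmeas.restrict ?_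
    rw [hlev, setLIntegral_levelAux hne]
    exact ENNReal.ofReal_ne_top
  filter_upwards [ae_all_iff.2 h] with s hs
  obtain ⟨n, hn⟩ := exists_nat_ge s
  exact hs n hn

/-- The K-functional of `x` is at most the primitive of its level function, hence at most the
K-functional of the level function in `(L¹, L^∞)`; from there the exact result for `(L¹, L^∞)` leads
to `y`. -/
theorem isUniformRelCM_coupleLevel_coupleL {n : ℝ≥0} (hn : IsNConst n) :
    (coupleLevel halfLine).IsUniformRelCM n (coupleL halfLine) := fun x y h => by
  obtain ⟨N, hN, hNx⟩ := hn x
  obtain ⟨T, hT, hTx⟩ := isExactRelCM_coupleL_coupleL (N x) y fun t ht => by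
    refine ((h t ht).trans (K_coupleLevel_le_setLIntegral_level x.2 ht)).trans
      (le_trans (le_of_eq ?_) (isHalfLineCouple_coupleL.setLIntegral_le_K t _))
    refine lintegral_congr_ae (ae_restrict_of_ae ?_)
    filter_upwards [hNx, level_lt_top x.2] with s h1 h2
    rw [h1, Real.enorm_of_nonneg ENNReal.toReal_nonneg, ENNReal.ofReal_toReal h2.ne]
  refine ⟨T ∘ₗ N, by simpa using hT.comp hN, ?_⟩
  rw [LinearMap.comp_apply, hTx]

/-! ### Transfer to general measures -/

/-- `pull` and `push` are contractions between a couple over `ρ` and a couple over the half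
line. -/
structure IsTransfer (ρ : Measure ℝ) [FiniteIic ρ] (X : Couple (ℝ →ₘ[ρ] ℝ))
    (X' : Couple (ℝ →ₘ[halfLine] ℝ)) : Prop where
  seminorm : X.IsSeminorm
  halfLine : IsHalfLineCouple X'
  pull₀ : ∀ f, X'.norm₀ (pull ρ f) ≤ X.norm₀ f
  pull₁ : ∀ f, X'.norm₁ (pull ρ f) ≤ X.norm₁ f
  push₀ : ∀ h, X.norm₀ (push ρ h) ≤ X'.norm₀ h
  push₁ : ∀ h, X.norm₁ (push ρ h) ≤ X'.norm₁ h

theorem isTransfer_coupleL (ρ : Measure ℝ) [FiniteIic ρ] :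
    IsTransfer ρ (coupleL ρ) (coupleL halfLine) where
  seminorm := isSeminorm_coupleL ρ
  halfLine := isHalfLineCouple_coupleL
  pull₀ f := by
    rw [coupleL_norm₀, coupleL_norm₀]
    exact (lintegral_pull ρ f).le
  pull₁ f := eLpNorm_top_pull_le ρ f
  push₀ h := by
    rw [coupleL_norm₀, coupleL_norm₀]
    exact lintegral_push_le ρ h
  push₁ h := eLpNorm_top_push_le ρ h

theorem isTransfer_coupleTilde (ρ : Measure ℝ) [FiniteIic ρ] :
    IsTransfer ρ (coupleTilde ρ) (coupleTilde halfLine) where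
  seminorm := isSeminorm_coupleTilde ρ
  halfLine := isHalfLineCouple_coupleTilde
  pull₀ f := by
    rw [coupleTilde_norm₀, coupleTilde_norm₀]
    exact lintegral_ldm_pull_le ρ f
  pull₁ f := eLpNorm_top_pull_le ρ f
  push₀ h := by
    rw [coupleTilde_norm₀, coupleTilde_norm₀]
    exact lintegral_ldm_push_le ρ h
  push₁ h := eLpNorm_top_push_le ρ h

theorem isTransfer_coupleLevel (ρ : Measure ℝ) [FiniteIic ρ] :
    IsTransfer ρ (coupleLevel ρ) (coupleLevel halfLine) where
  seminorm := isSeminorm_coupleLevel ρ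
  halfLine := isHalfLineCouple_coupleLevel
  pull₀ := (isTransfer_coupleL ρ).pull₀
  pull₁ f := level_pull_le ρ f
  push₀ := (isTransfer_coupleL ρ).push₀
  push₁ h := level_push_le ρ h

theorem IsTransfer.exists_pull {ρ : Measure ℝ} [FiniteIic ρ] {X : Couple (ℝ →ₘ[ρ] ℝ)}
    {X' : Couple (ℝ →ₘ[CalderonMityagin.halfLine] ℝ)} (hX : IsTransfer ρ X X') :
    ∃ P : X.sum →ₗ[ℝ] X'.sum, OpNormLE X X' 1 P ∧
      ∀ f, (P f : ℝ →ₘ[CalderonMityagin.halfLine] ℝ) = pull ρ f :=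
  exists_op hX.seminorm (pull ρ) (fun f _ g _ => pull_add ρ f g) (fun a f _ => pull_smul ρ a f)
    (fun f _ => by simpa using hX.pull₀ f) (fun f _ => by simpa using hX.pull₁ f)

theorem IsTransfer.exists_push {ρ : Measure ℝ} [FiniteIic ρ] {X : Couple (ℝ →ₘ[ρ] ℝ)}
    {X' : Couple (ℝ →ₘ[CalderonMityagin.halfLine] ℝ)} (hX : IsTransfer ρ X X') :
    ∃ Q : X'.sum →ₗ[ℝ] X.sum, OpNormLE X' X 1 Q ∧ ∀ h, (Q h : ℝ →ₘ[ρ] ℝ) = push ρ h :=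
  exists_op hX.halfLine.seminorm (push ρ)
    (fun _ hf _ hg => push_add ρ (hX.halfLine.locInt hf) (hX.halfLine.locInt hg))
    (fun a f _ => push_smul ρ a f)
    (fun f _ => by simpa using hX.push₀ f) (fun f _ => by simpa using hX.push₁ f)

/-- `pull` does not increase the K-functional of `y`, and that of `x` is at most that of its
pull-back because `push` leads back to `x`. The hypothesis therefore holds on the half line, and the
operator obtained there is placed between `pull` and `push`. -/
theorem IsTransfer.isUniformRelCM {μ ν : Measure ℝ} [FiniteIic μ] [FiniteIic ν]
    {X : Couple (ℝ →ₘ[μ] ℝ)} {Y : Couple (ℝ →ₘ[ν] ℝ)}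
    {X' Y' : Couple (ℝ →ₘ[CalderonMityagin.halfLine] ℝ)} (hX : IsTransfer μ X X')
    (hY : IsTransfer ν Y Y') {c : ℝ≥0} (h : X'.IsUniformRelCM c Y') : X.IsUniformRelCM c Y := by
  intro x y hxy
  obtain ⟨P, hP, hPf⟩ := hX.exists_pull
  obtain ⟨Q, hQ, hQf⟩ := hX.exists_push
  obtain ⟨P', hP', hPf'⟩ := hY.exists_pull
  obtain ⟨Q', hQ', hQf'⟩ := hY.exists_push
  have e : Q (P x) = x := Subtype.ext (by rw [hQf, hPf, push_pull])
  have e' : Q' (P' y) = y := Subtype.ext (by rw [hQf', hPf', push_pull])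
  obtain ⟨T, hT, hTx⟩ := h (P x) (P' y) fun t ht => by
    refine ((hP'.K_le hY.seminorm ht y).trans (hxy t ht)).trans ?_
    have := hQ.K_le hX.halfLine.seminorm ht (P x)
    rwa [e] at this
  refine ⟨Q' ∘ₗ T ∘ₗ P, by simpa using hQ'.comp (hT.comp hP), ?_⟩
  rw [LinearMap.comp_apply, LinearMap.comp_apply, hTx, e']

end CalderonMityagin

theorem theorem4p3 (μ ν : MeasureTheory.Measure ℝ)
    (hμ : ∀ x, μ (Set.Iic x) < ⊤) (hν : ∀ x, ν (Set.Iic x) < ⊤) :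
    (CalderonMityagin.coupleTilde μ).IsExactCM ∧
    (CalderonMityagin.coupleTilde μ).IsExactRelCM (CalderonMityagin.coupleTilde ν) ∧
    (CalderonMityagin.coupleTilde μ).IsExactRelCM (CalderonMityagin.coupleL ν) ∧
    (∀ m : NNReal, CalderonMityagin.IsMConst m →
      (CalderonMityagin.coupleL μ).IsUniformRelCM m (CalderonMityagin.coupleTilde ν)) ∧
    (CalderonMityagin.coupleLevel μ).IsExactCM ∧
    (CalderonMityagin.coupleLevel μ).IsExactRelCM (CalderonMityagin.coupleLevel ν) ∧
    (CalderonMityagin.coupleL μ).IsExactRelCM (CalderonMityagin.coupleLevel ν) ∧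
    (∀ n : NNReal, CalderonMityagin.IsNConst n →
      (CalderonMityagin.coupleLevel μ).IsUniformRelCM n (CalderonMityagin.coupleL ν)) := by
  have : CalderonMityagin.FiniteIic μ := ⟨hμ⟩
  have : CalderonMityagin.FiniteIic ν := ⟨hν⟩
  have hLμ := CalderonMityagin.isTransfer_coupleL μ
  have hLν := CalderonMityagin.isTransfer_coupleL ν
  have hTμ := CalderonMityagin.isTransfer_coupleTilde μ
  have hTν := CalderonMityagin.isTransfer_coupleTilde ν
  have hOμ := CalderonMityagin.isTransfer_coupleLevel μ
  have hOν := CalderonMityagin.isTransfer_coupleLevel ν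
  exact ⟨hTμ.isUniformRelCM hTμ CalderonMityagin.isExactRelCM_coupleTilde_coupleTilde,
    hTμ.isUniformRelCM hTν CalderonMityagin.isExactRelCM_coupleTilde_coupleTilde,
    hTμ.isUniformRelCM hLν CalderonMityagin.isExactRelCM_coupleTilde_coupleL,
    fun _ hm => hLμ.isUniformRelCM hTν (CalderonMityagin.isUniformRelCM_coupleL_coupleTilde hm),
    hOμ.isUniformRelCM hOμ CalderonMityagin.isExactRelCM_coupleLevel_coupleLevel,
    hOμ.isUniformRelCM hOν CalderonMityagin.isExactRelCM_coupleLevel_coupleLevel,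
    hLμ.isUniformRelCM hOν CalderonMityagin.isExactRelCM_coupleL_coupleLevel,
    fun _ hn => hOμ.isUniformRelCM hLν (CalderonMityagin.isUniformRelCM_coupleLevel_coupleL hn)⟩
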